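/- An *imprecise terrain* $T$ is a finite, possibly non-planar, simple undirected graph $G=(V,E)$ whose nodes are distinct points of $\mathbb{R}^2$, together with bounds $\mathrm{low}(v)\le \mathrm{high}(v)$ for every node $v$. A *realization* $R$ of $T$ assigns to every node $v$ an elevation $\mathrm{elev}(R,v)\in[\mathrm{low}(v),\mathrm{high}(v)]$. A *local minimum* of $R$ is a nonempty connected set $P\subseteq V$ of nodes of equal elevation that is strictly lower than the elevation of every node outside $P$ adjacent to $P$. For an edge $(p,q)$ let $\sigma(R,p,q)=(\mathrm{elev}(R,p)-\mathrm{elev}(R,q))/|pq|$, with $|pq|$ the Euclidean distance in $\mathbb{R}^2$; a neighbor $q$ of $p$ is a *steepest descent neighbor* of $p$ if $\sigma(R,p,q)$ is non-negative and maximal among all neighbors of $p$. Water in $p$ flows to all steepest descent neighbors of $p$, unless $p$ lies in a local minimum $P$, in which case it flows to the neighbors of $p$ in $P$; write $p\to_R q$ if $q=p$ or water from $p$ reaches $q$ in finitely many such steps. A *flow path* in $R$ is a finite sequence of nodes in which each node is followed by one of its steepest descent neighbors and which visits all nodes of some local minimum of $R$ (nodes may be repeated). For $Q\subseteq V$, the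 *potential watershed* $\mathrm{PoWS}(Q)$ is the set of nodes $p$ such that $p\to_R q$ for some realization $R$ and some $q\in Q$. For $Q,S\subseteq V$, the *$Q$-avoiding potential watershed* $\mathrm{AvWS}_Q(S)$ is the set of nodes $p$ for which there are a realization $R$, a flow path $\pi$ in $R$ and a node $s\in S$ such that $\pi$ has a subpath from $p$ to $s$ (both included) that contains no node of $Q$. The *persistent watershed* of $Q$ is $$\mathrm{PsWS}(Q)=V\setminus \mathrm{AvWS}_Q\bigl(V\setminus \mathrm{PoWS}(Q)\bigr).$$ **Theorem.** There is an algorithm that, given an imprecise terrain $T$ and a set $Q$ of its nodes, computes $\mathrm{PsWS}(Q)$; on terrains with $n\ge 2$ edges and without isolated nodes it runs in time $O(n\log n)$, with a constant that depends neither on $T$ nor on $Q$. Here an algorithm is a program for the real RAM: a random access machine with memory for natural numbers (operations $+$, truncated $-$, halving, comparison, and use as array indices) and for exact real numbers (operations $+,-,\cdot,/,\sqrt{\ }$, comparison), where every operation and every memory access takes one unit of time. The input consists of the numbers of nodes and of edges, the coordinates and elevation bounds of the nodes, a list of the edges in arbitrary order and orientation, and the 0/1-indicator array of $Q$; the output is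 the 0/1-indicator array of $\mathrm{PsWS}(Q)$. -/

import Mathlib

/-! ## Imprecise terrains and water flow in the network model -/

/-- An imprecise terrain with node type `V`: a geometric graph whose nodes have distinct positions
in the plane, each node carrying an interval `[low v, high v]` of possible elevations. -/
structure ImpreciseTerrain (V : Type*) where
  pos : V → EuclideanSpace ℝ (Fin 2)
  pos_injective : Function.Injective pos
  graph : SimpleGraph V
  low : V → ℝ
  high : V → ℝ
  low_le_high : ∀ v, low v ≤ high v

namespace ImpreciseTerrain

variable {V : Type*}

/-- A realization: a choice of an elevation in its interval for every node. -/
structure Realization (T : ImpreciseTerrain V) where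
  elev : V → ℝ
  low_le_elev : ∀ v, T.low v ≤ elev v
  elev_le_high : ∀ v, elev v ≤ T.high v

/-- The neighborhood of a set of nodes. -/
def neighborhood (T : ImpreciseTerrain V) (P : Set V) : Set V :=
  {s | s ∉ P ∧ ∃ t ∈ P, T.graph.Adj s t}

namespace Realization

variable {T : ImpreciseTerrain V}

/-- A local minimum: a (nonempty) connected set of nodes of equal elevation, strictly lower than
every node of its neighborhood. -/
def IsLocalMin (R : T.Realization) (P : Set V) : Prop :=
  (T.graph.induce P).Connected ∧
    (∀ u ∈ P, ∀ v ∈ P, R.elev u = R.elev v) ∧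
    ∀ u ∈ P, ∀ v ∈ T.neighborhood P, R.elev u < R.elev v

/-- Steepness of descent from `p` to `q` (used for adjacent `p` and `q`, so `|pq| > 0`). -/
noncomputable def steepness (R : T.Realization) (p q : V) : ℝ :=
  (R.elev p - R.elev q) / dist (T.pos p) (T.pos q)

/-- `q` is a steepest descent neighbor of `p`. -/
def SteepestDescent (R : T.Realization) (p q : V) : Prop :=
  T.graph.Adj p q ∧ 0 ≤ R.steepness p q ∧
    ∀ r, T.graph.Adj p r → R.steepness p r ≤ R.steepness p q

/-- One step of water flow. Outside local minima, water flows to every steepest descent neighbor;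
inside a local minimum `P`, it flows to every neighbor in `P`. -/
def FlowStep (R : T.Realization) (p q : V) : Prop :=
  ((¬ ∃ P, R.IsLocalMin P ∧ p ∈ P) ∧ R.SteepestDescent p q) ∨
    ∃ P, R.IsLocalMin P ∧ p ∈ P ∧ q ∈ P ∧ T.graph.Adj p q

/-- `p` flows to `q` in `R` (every node flows to itself). -/
def FlowsTo (R : T.Realization) : V → V → Prop :=
  Relation.ReflTransGen R.FlowStep

/-- The discrete watershed of a node in a realization. -/
def watershed (R : T.Realization) (q : V) : Set V :=
  {p | R.FlowsTo p q}

/-- A flow path in `R`: a sequence of nodes in which each node is followed by one of its steepest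
descent neighbors and which reaches a local minimum and visits all nodes of it. -/
def IsFlowPath (R : T.Realization) (π : List V) : Prop :=
  π.IsChain R.SteepestDescent ∧ ∃ P, R.IsLocalMin P ∧ ∀ v ∈ P, v ∈ π

end Realization

/-- The potential watershed of `Q`: the union of the watersheds of the nodes of `Q` over all
realizations. -/
def PoWS (T : ImpreciseTerrain V) (Q : Set V) : Set V :=
  ⋃ R : T.Realization, ⋃ q ∈ Q, R.watershed q

/-- The `Q`-avoiding potential watershed of `S`: the nodes `p` for which some flow path of some
realization has a subpath `ρ` from `p` to a node `s ∈ S`, endpoints included, that contains no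
node of `Q`. -/
def AvWS (T : ImpreciseTerrain V) (Q S : Set V) : Set V :=
  {p | ∃ R : T.Realization, ∃ s ∈ S, ∃ π₁ ρ π₂ : List V, R.IsFlowPath (π₁ ++ ρ ++ π₂) ∧
    ρ.head? = some p ∧ ρ.getLast? = some s ∧ ∀ v ∈ ρ, v ∉ Q}

/-- The persistent watershed of `Q`. -/
def PsWS (T : ImpreciseTerrain V) (Q : Set V) : Set V :=
  (T.AvWS Q (T.PoWS Q)ᶜ)ᶜ

end ImpreciseTerrain

/-! ## The real RAM

A random access machine with registers and indexable memory arrays for natural numbers (used for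
indices and pointers) and for exact real numbers. Naturals support `+`, truncated `-`, halving and
comparison; reals support `+`, `-`, `*`, `/`, square root and comparison. Every operation and every
memory access takes one unit of time. There is no conversion between reals and naturals, no
rounding, and no multiplication of naturals. Registers and arrays are named by constants of the
program, so that a program uses finitely many of them. -/

namespace RealRAM

/-- A memory state: registers and arrays, of naturals and of reals. -/
structure State where
  natReg : ℕ → ℕ
  realReg : ℕ → ℝ
  natArr : ℕ → ℕ → ℕ
  realArr : ℕ → ℕ → ℝ

/-- Natural number expressions; `arr a e` reads entry `e` of array number `a`. -/
inductive NatExp where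
  | const (k : ℕ)
  | reg (r : ℕ)
  | arr (a : ℕ) (e : NatExp)
  | add (e₁ e₂ : NatExp)
  | sub (e₁ e₂ : NatExp)
  | half (e : NatExp)

/-- Real number expressions; constants are natural numbers. -/
inductive RealExp where
  | const (k : ℕ)
  | reg (r : ℕ)
  | arr (a : ℕ) (e : NatExp)
  | add (e₁ e₂ : RealExp)
  | sub (e₁ e₂ : RealExp)
  | mul (e₁ e₂ : RealExp)
  | div (e₁ e₂ : RealExp)
  | sqrt (e : RealExp)

/-- Tests. -/
inductive Test where
  | natEq (e₁ e₂ : NatExp)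
  | natLt (e₁ e₂ : NatExp)
  | realLe (e₁ e₂ : RealExp)
  | not (b : Test)
  | and (b₁ b₂ : Test)

/-- Programs. -/
inductive Program where
  | skip
  | setNatReg (r : ℕ) (e : NatExp)
  | setRealReg (r : ℕ) (e : RealExp)
  | setNatArr (a : ℕ) (i : NatExp) (e : NatExp)
  | setRealArr (a : ℕ) (i : NatExp) (e : RealExp)
  | seq (c₁ c₂ : Program)
  | cond (b : Test) (c₁ c₂ : Program)
  | loop (b : Test) (c : Program)

/-- The value of an expression in a state. -/
def NatExp.eval (σ : State) : NatExp → ℕ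
  | const k => k
  | reg r => σ.natReg r
  | arr a e => σ.natArr a (e.eval σ)
  | add e₁ e₂ => e₁.eval σ + e₂.eval σ
  | sub e₁ e₂ => e₁.eval σ - e₂.eval σ
  | half e => e.eval σ / 2

/-- The time to evaluate an expression: the number of its symbols. -/
def NatExp.cost : NatExp → ℕ
  | const _ => 1
  | reg _ => 1
  | arr _ e => e.cost + 1
  | add e₁ e₂ => e₁.cost + e₂.cost + 1
  | sub e₁ e₂ => e₁.cost + e₂.cost + 1
  | half e => e.cost + 1

/-- The value of a real expression in a state. -/
noncomputable def RealExp.eval (σ : State) : RealExp → ℝ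
  | const k => k
  | reg r => σ.realReg r
  | arr a e => σ.realArr a (e.eval σ)
  | add e₁ e₂ => e₁.eval σ + e₂.eval σ
  | sub e₁ e₂ => e₁.eval σ - e₂.eval σ
  | mul e₁ e₂ => e₁.eval σ * e₂.eval σ
  | div e₁ e₂ => e₁.eval σ / e₂.eval σ
  | sqrt e => Real.sqrt (e.eval σ)

/-- The time to evaluate a real expression. -/
def RealExp.cost : RealExp → ℕ
  | const _ => 1
  | reg _ => 1
  | arr _ e => e.cost + 1
  | add e₁ e₂ => e₁.cost + e₂.cost + 1
  | sub e₁ e₂ => e₁.cost + e₂.cost + 1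
  | mul e₁ e₂ => e₁.cost + e₂.cost + 1
  | div e₁ e₂ => e₁.cost + e₂.cost + 1
  | sqrt e => e.cost + 1

/-- The truth of a test in a state. -/
def Test.Holds (σ : State) : Test → Prop
  | natEq e₁ e₂ => e₁.eval σ = e₂.eval σ
  | natLt e₁ e₂ => e₁.eval σ < e₂.eval σ
  | realLe e₁ e₂ => e₁.eval σ ≤ e₂.eval σ
  | not b => ¬ b.Holds σ
  | and b₁ b₂ => b₁.Holds σ ∧ b₂.Holds σ

/-- The time to evaluate a test. -/
def Test.cost : Test → ℕ
  | natEq e₁ e₂ => e₁.cost + e₂.cost + 1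
  | natLt e₁ e₂ => e₁.cost + e₂.cost + 1
  | realLe e₁ e₂ => e₁.cost + e₂.cost + 1
  | not b => b.cost + 1
  | and b₁ b₂ => b₁.cost + b₂.cost + 1

namespace State

/-- Write a natural number register. -/
def setNatReg (σ : State) (r x : ℕ) : State :=
  { σ with natReg := Function.update σ.natReg r x }

/-- Write a real register. -/
def setRealReg (σ : State) (r : ℕ) (x : ℝ) : State :=
  { σ with realReg := Function.update σ.realReg r x }

/-- Write entry `i` of the natural number array `a`. -/
def setNatArr (σ : State) (a i x : ℕ) : State :=
  { σ with natArr := Function.update σ.natArr a (Function.update (σ.natArr a) i x) }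

/-- Write entry `i` of the real array `a`. -/
def setRealArr (σ : State) (a i : ℕ) (x : ℝ) : State :=
  { σ with realArr := Function.update σ.realArr a (Function.update (σ.realArr a) i x) }

end State

/-- `Exec c σ σ' t`: started in state `σ`, the program `c` halts after `t` units of time in
state `σ'`. -/
inductive Exec : Program → State → State → ℕ → Prop where
  | skip (σ : State) : Exec .skip σ σ 1
  | setNatReg (σ : State) (r : ℕ) (e : NatExp) :
      Exec (.setNatReg r e) σ (σ.setNatReg r (e.eval σ)) (e.cost + 1)
  | setRealReg (σ : State) (r : ℕ) (e : RealExp) :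
      Exec (.setRealReg r e) σ (σ.setRealReg r (e.eval σ)) (e.cost + 1)
  | setNatArr (σ : State) (a : ℕ) (i e : NatExp) :
      Exec (.setNatArr a i e) σ (σ.setNatArr a (i.eval σ) (e.eval σ)) (i.cost + e.cost + 1)
  | setRealArr (σ : State) (a : ℕ) (i : NatExp) (e : RealExp) :
      Exec (.setRealArr a i e) σ (σ.setRealArr a (i.eval σ) (e.eval σ)) (i.cost + e.cost + 1)
  | seq {c₁ c₂ : Program} {σ σ' σ'' : State} {t t' : ℕ} :
      Exec c₁ σ σ' t → Exec c₂ σ' σ'' t' → Exec (.seq c₁ c₂) σ σ'' (t + t')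
  | cond_true {b : Test} {c₁ c₂ : Program} {σ σ' : State} {t : ℕ} :
      b.Holds σ → Exec c₁ σ σ' t → Exec (.cond b c₁ c₂) σ σ' (b.cost + 1 + t)
  | cond_false {b : Test} {c₁ c₂ : Program} {σ σ' : State} {t : ℕ} :
      ¬ b.Holds σ → Exec c₂ σ σ' t → Exec (.cond b c₁ c₂) σ σ' (b.cost + 1 + t)
  | loop_false {b : Test} {c : Program} {σ : State} :
      ¬ b.Holds σ → Exec (.loop b c) σ σ (b.cost + 1)
  | loop_true {b : Test} {c : Program} {σ σ' σ'' : State} {t t' : ℕ} :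
      b.Holds σ → Exec c σ σ' t → Exec (.loop b c) σ' σ'' t' →
        Exec (.loop b c) σ σ'' (b.cost + 1 + t + t')

end RealRAM

/-! ## Representation of the input -/

/-- `src i, dst i` (`i < n`) lists every edge of `G` exactly once, in an arbitrary order and with
arbitrary orientations. In particular `G` has exactly `n` edges. -/
def IsEdgeList {m n : ℕ} (G : SimpleGraph (Fin m)) (src dst : Fin n → Fin m) : Prop :=
  Function.Injective (fun i => s(src i, dst i)) ∧
    Set.range (fun i => s(src i, dst i)) = G.edgeSet

/-- Extend a finite sequence by zeros. -/
def padZero {α : Type*} [Zero α] {k : ℕ} (f : Fin k → α) (i : ℕ) : α :=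
  if h : i < k then f ⟨i, h⟩ else 0

open Classical in
/-- The initial state of the machine on a terrain with nodes `0, …, m - 1`, edges
`(src i, dst i)` and a set `Q` of nodes. Natural number registers `0` and `1` hold `m` and `n`;
natural number arrays `0` and `1` hold the endpoints of the edges, and array `2` the indicator
of `Q`; real arrays `0`, `1` hold the coordinates of the nodes, and `2`, `3` their lower and upper
elevation bounds. All other cells hold zero. -/
noncomputable def inputState {m n : ℕ} (T : ImpreciseTerrain (Fin m)) (src dst : Fin n → Fin m)
    (Q : Set (Fin m)) : RealRAM.State where
  natReg
    | 0 => m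
    | 1 => n
    | _ => 0
  realReg _ := 0
  natArr
    | 0 => padZero fun i => (src i : ℕ)
    | 1 => padZero fun i => (dst i : ℕ)
    | 2 => padZero fun v => if v ∈ Q then 1 else 0
    | _ => fun _ => 0
  realArr
    | 0 => padZero fun v => T.pos v 0
    | 1 => padZero fun v => T.pos v 1
    | 2 => padZero fun v => T.low v
    | 3 => padZero fun v => T.high v
    | _ => fun _ => 0

/-- The array `3` of natural numbers holds the indicator of the set `W` of nodes. -/
def OutputsSet {m : ℕ} (σ : RealRAM.State) (W : Set (Fin m)) : Prop :=
  ∀ v : Fin m, (v ∈ W → σ.natArr 3 v = 1) ∧ (v ∉ W → σ.natArr 3 v = 0)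

/-! ## Water flow along steepest descent paths -/

namespace ImpreciseTerrain

variable {V : Type*} {T : ImpreciseTerrain V}

/-! Water flow is the same as following steepest descent neighbors, also inside local minima, and
every node of a finite terrain starts a flow path (`Realization.extends_of_finite`). Hence potential
and avoiding watersheds are instances of one relation `Reaches B S`: in some realization a steepest
descent path that avoids `B` leads to `S`. The potential watershed of `Q` is the instance with `B`
empty and `S = Q`; the persistent watershed is the complement of a second instance, with `B = Q` and
with the complement of the first as targets (`mem_PsWS_iff`).

One instance is solved in the manner of Dijkstra's algorithm, the label of a node being the lowest
elevation from which it can reach `S`. For a step from `q` to `u` it only helps to raise the other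
neighbors of `q` to their upper bounds and to lower `u`, so the elevations `z` of `u` and `y` of `q`
alone decide whether the step is possible (`Feasible`). As a lower `z` admits more, labels bound
elevations from below along every path (`mem_of_reaches`); as `y ≥ z`, nodes can be made final in
order of increasing label. Conversely, all labels are attained in a single realization that puts
unlabelled nodes at their upper bounds: if the intended neighbor of a node is beaten, then by a
labelled node that is strictly lower, so the water stays on labelled nodes until it meets `S`
(`reaches_of_ranked`).

To find the lowest feasible `y`, write `y = z + s * |qu|`. The conditions on the neighbors `r` of
`q` then say that at `s` the line of slope `|qu|` and offset `z` lies below the lower envelope of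
the lines of slope `|qr|` and offset `high r` (`feasible_iff_envelope`). The envelope is concave and
piecewise linear, so a binary search on its breakpoints finds the least admissible `s`
(`search_sound`, `search_complete`). Sorting all edges once by decreasing length allows every
envelope to be built by appending lines of smallest slope; each line is removed at most once.

The degrees sum to `2 * n`, so there are `2 * n` searches and at most as many label improvements,
each in logarithmic time with a tournament tree as priority queue. Without isolated nodes the number
of nodes is at most `2 * n`, which gives `O(n log n)`. -/

theorem dist_pos_of_adj {p q : V} (h : T.graph.Adj p q) : 0 < dist (T.pos p) (T.pos q) :=
  dist_pos.2 fun he => h.ne (T.pos_injective he)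

namespace Realization

variable {R : T.Realization}

theorem steepness_nonneg_iff {p q : V} (h : T.graph.Adj p q) :
    0 ≤ R.steepness p q ↔ R.elev q ≤ R.elev p := by
  rw [steepness, le_div_iff₀ (dist_pos_of_adj h), zero_mul, sub_nonneg]

theorem steepness_pos_iff {p q : V} (h : T.graph.Adj p q) :
    0 < R.steepness p q ↔ R.elev q < R.elev p := by
  rw [steepness, lt_div_iff₀ (dist_pos_of_adj h), zero_mul, sub_pos]

/-- A node of a local minimum has no lower neighbor, and its neighbors of non-negative steepness are
exactly those inside the minimum, with steepness 0. So the two rules for water flow agree. -/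
theorem flowStep_iff_steepestDescent {p q : V} : R.FlowStep p q ↔ R.SteepestDescent p q := by
  constructor
  · rintro (⟨-, h⟩ | ⟨P, ⟨-, heq, hlt⟩, hp, hq, hpq⟩)
    · exact h
    · have h0 : R.steepness p q = 0 := by simp [steepness, heq p hp q hq]
      refine ⟨hpq, h0.ge, fun r hr => ?_⟩
      rw [h0]
      by_contra! hpos
      rw [steepness_pos_iff hr] at hpos
      by_cases hrP : r ∈ P
      · exact hpos.ne (heq r hrP p hp)
      · exact lt_asymm hpos (hlt p hp r ⟨hrP, p, hp, hr.symm⟩)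
  · intro h
    by_cases hP : ∃ P, R.IsLocalMin P ∧ p ∈ P
    · obtain ⟨P, hP, hp⟩ := hP
      refine Or.inr ⟨P, hP, hp, ?_, h.1⟩
      by_contra hq
      exact ((steepness_nonneg_iff h.1).1 h.2.1).not_gt (hP.2.2 p hp q ⟨hq, p, hp, h.1.symm⟩)
    · exact Or.inl ⟨hP, h⟩

theorem SteepestDescent.elev_le {p q : V} (h : R.SteepestDescent p q) : R.elev q ≤ R.elev p :=
  (steepness_nonneg_iff h.1).1 h.2.1

/-- A node with a lower neighbor has a strictly lower steepest descent neighbor. -/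
theorem exists_steepestDescent_lt [Finite V] {p r : V} (h : T.graph.Adj p r)
    (hr : R.elev r < R.elev p) : ∃ q, R.SteepestDescent p q ∧ R.elev q < R.elev p := by
  obtain ⟨q, hq, hmax⟩ := (Set.toFinite {r | T.graph.Adj p r}).exists_maximalFor
    (R.steepness p) _ ⟨r, h⟩
  have hmax' : ∀ r, T.graph.Adj p r → R.steepness p r ≤ R.steepness p q := fun r hr =>
    (le_total _ _).elim id fun hle => hmax hr hle
  have hpos := ((steepness_pos_iff h).2 hr).trans_le (hmax' r h)
  exact ⟨q, ⟨hq, hpos.le, hmax'⟩, (steepness_pos_iff hq).1 hpos⟩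

/-- Adjacency of nodes of equal elevation. -/
def Level (R : T.Realization) (p q : V) : Prop :=
  T.graph.Adj p q ∧ R.elev p = R.elev q

theorem steepestDescent_of_level {p q : V} (h : R.Level p q)
    (hp : ∀ r, T.graph.Adj p r → R.elev p ≤ R.elev r) : R.SteepestDescent p q := by
  have h0 : R.steepness p q = 0 := by simp [steepness, h.2]
  refine ⟨h.1, h0.ge, fun r hr => ?_⟩
  rw [h0]
  by_contra! hpos
  exact ((steepness_pos_iff hr).1 hpos).not_ge (hp r hr)

theorem elev_eq_of_level {p q : V} (h : Relation.ReflTransGen R.Level p q) :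
    R.elev p = R.elev q := by
  induction h with
  | refl => rfl
  | tail _ h ih => exact ih.trans h.2

/-- Water can follow the plateau path up to its first node with a lower neighbor: before that node,
level steps are steepest descents of slope 0, and from that node some steepest descent is strict. -/
theorem exists_flow_lt [Finite V] {p x r : V} (h : Relation.ReflTransGen R.Level p x)
    (hx : T.graph.Adj x r) (hr : R.elev r < R.elev x) :
    ∃ q, Relation.ReflTransGen R.SteepestDescent p q ∧ R.elev q < R.elev p := by
  induction h using Relation.ReflTransGen.head_induction_on with
  | refl =>
    obtain ⟨q, hq, hlt⟩ := exists_steepestDescent_lt hx hr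
    exact ⟨q, .single hq, hlt⟩
  | @head a c hac _ ih =>
    by_cases ha : ∃ r, T.graph.Adj a r ∧ R.elev r < R.elev a
    · obtain ⟨r, har, hr⟩ := ha
      obtain ⟨q, hq, hlt⟩ := exists_steepestDescent_lt har hr
      exact ⟨q, .single hq, hlt⟩
    · push Not at ha
      obtain ⟨q, hq, hlt⟩ := ih
      exact ⟨q, .head (steepestDescent_of_level hac ha) hq, hac.2 ▸ hlt⟩

theorem isLocalMin_level {p : V}
    (h : ∀ x, Relation.ReflTransGen R.Level p x → ∀ r, T.graph.Adj x r → R.elev x ≤ R.elev r) :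
    R.IsLocalMin {x | Relation.ReflTransGen R.Level p x} := by
  refine ⟨?_, fun u hu v hv => (elev_eq_of_level hu).symm.trans (elev_eq_of_level hv), ?_⟩
  · rw [SimpleGraph.connected_iff_exists_forall_reachable]
    refine ⟨⟨p, .refl⟩, ?_⟩
    rintro ⟨x, hx⟩
    induction hx with
    | refl => exact .refl _
    | @tail b c hb hbc ih => exact ih.trans (SimpleGraph.Adj.reachable (by simpa using hbc.1))
  · rintro u hu v ⟨hv, t, ht, hvt⟩
    have hut : R.elev u = R.elev t := (elev_eq_of_level hu).symm.trans (elev_eq_of_level ht)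
    rw [hut]
    exact (h t ht v hvt.symm).lt_of_ne fun he => hv (ht.tail ⟨hvt.symm, he⟩)

/-- `p` can be continued to a flow path. -/
def Extends (R : T.Realization) (p : V) : Prop :=
  ∃ π, (p :: π).IsChain R.SteepestDescent ∧ ∃ P, R.IsLocalMin P ∧ ∀ v ∈ P, v ∈ p :: π

theorem Extends.of_reaches {p q : V} (h : Relation.ReflTransGen R.SteepestDescent p q)
    (hq : R.Extends q) : R.Extends p := by
  induction h using Relation.ReflTransGen.head_induction_on with
  | refl => exact hq
  | @head a c hac _ ih =>
    obtain ⟨π, hπ, P, hP, hv⟩ := ih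
    exact ⟨c :: π, .cons_cons hac hπ, P, hP, fun v hv' => List.mem_cons_of_mem _ (hv v hv')⟩

/-- A tour is obtained by concatenating connections from each listed node to the next. It serves to
visit all nodes of a local minimum. -/
theorem exists_chain_visiting {r : V → V → Prop} {p : V} {l : List V}
    (h : ∀ x ∈ l, ∀ y, (y = p ∨ y ∈ l) → Relation.ReflTransGen r y x) :
    ∃ π, (p :: π).IsChain r ∧ ∀ v ∈ l, v ∈ p :: π := by
  induction l generalizing p with
  | nil => exact ⟨[], .singleton _, by simp⟩
  | cons a l ih =>
    obtain ⟨π, hπ, hv⟩ := ih (p := a) (fun x hx y hy => h x (by simp [hx]) y (by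
      rcases hy with rfl | hy <;> simp [*]))
    have key : ∀ b, Relation.ReflTransGen r b a →
        ∃ π, (b :: π).IsChain r ∧ ∀ v ∈ a :: l, v ∈ b :: π := by
      intro b hb
      induction hb using Relation.ReflTransGen.head_induction_on with
      | refl => exact ⟨π, hπ, by simpa using hv⟩
      | @head b c hbc _ ih =>
        obtain ⟨π, hπ, hv⟩ := ih
        exact ⟨c :: π, .cons_cons hbc hπ, fun v hv' => List.mem_cons_of_mem _ (hv v hv')⟩
    exact key p (h a (by simp) p (Or.inl rfl))

/-- Induction on the elevation. If the plateau of `p` touches a lower node, water leaves it downward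
and the induction hypothesis applies; otherwise the plateau is a local minimum, on which level steps
are steepest descents, and it can be toured. -/
theorem extends_of_finite [Finite V] (R : T.Realization) (p : V) : R.Extends p := by
  have wf : WellFounded fun a b : V => R.elev a < R.elev b := by
    have : IsTrans V fun a b => R.elev a < R.elev b := ⟨fun _ _ _ => lt_trans⟩
    have : Std.Irrefl fun a b : V => R.elev a < R.elev b := ⟨fun _ => lt_irrefl _⟩
    exact Finite.wellFounded_of_trans_of_irrefl _
  induction p using wf.induction with
  | _ p ih =>
    by_cases h : ∃ x, Relation.ReflTransGen R.Level p x ∧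
        ∃ r, T.graph.Adj x r ∧ R.elev r < R.elev x
    · obtain ⟨x, hx, r, hxr, hr⟩ := h
      obtain ⟨q, hq, hlt⟩ := exists_flow_lt hx hxr hr
      exact .of_reaches hq (ih q hlt)
    · push Not at h
      set K := {x | Relation.ReflTransGen R.Level p x}
      have hK : ∀ y ∈ K, ∀ x, Relation.ReflTransGen R.Level y x →
          Relation.ReflTransGen R.SteepestDescent y x := by
        intro y hy x hx
        induction hx with
        | refl => exact .refl
        | tail hb hbc ih => exact ih.tail (steepestDescent_of_level hbc (h _ (.trans hy hb)))
      have hsymm : ∀ y ∈ K, Relation.ReflTransGen R.Level y p := by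
        intro y hy
        induction hy with
        | refl => exact .refl
        | tail hb hbc ih => exact .head ⟨hbc.1.symm, hbc.2.symm⟩ ih
      obtain ⟨π, hπ, hv⟩ := exists_chain_visiting (r := R.SteepestDescent) (p := p)
        (l := (Set.toFinite K).toFinset.toList) (by
          intro x hx y hy
          simp only [Finset.mem_toList, Set.Finite.mem_toFinset] at hx hy
          have hyK : y ∈ K := by
            rcases hy with rfl | hy
            · exact Relation.ReflTransGen.refl
            · exact hy
          exact hK y hyK x ((hsymm y hyK).trans hx))
      exact ⟨π, hπ, K, isLocalMin_level h, fun v hv' => hv v (by simpa using hv')⟩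

end Realization

/-- `p` reaches a node of `S` by a path of steepest descent steps in some realization, avoiding
the nodes of `B`. -/
def Reaches (T : ImpreciseTerrain V) (B S : Set V) (p : V) : Prop :=
  ∃ R : T.Realization, ∃ s ∈ S, p ∉ B ∧
    Relation.ReflTransGen (fun a b => R.SteepestDescent a b ∧ b ∉ B) p s

theorem mem_PoWS_iff {Q : Set V} {p : V} : p ∈ T.PoWS Q ↔ T.Reaches ∅ Q p := by
  have hfs : ∀ R : T.Realization, R.FlowStep = R.SteepestDescent := fun R => by
    funext a b; exact propext Realization.flowStep_iff_steepestDescent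
  simp [PoWS, Reaches, Realization.watershed, Realization.FlowsTo, hfs]

/-- Being part of a flow path is no restriction on a steepest descent path, since beyond its last
node it can always be continued to one; the continuation may enter `Q`. -/
theorem mem_AvWS_iff [Finite V] {Q S : Set V} {p : V} :
    p ∈ T.AvWS Q S ↔ T.Reaches Q S p := by
  constructor
  · rintro ⟨R, s, hs, π₁, ρ, π₂, ⟨hch, -⟩, hp, hl, hQ⟩
    obtain ⟨l, rfl⟩ : ∃ l, ρ = p :: l := by
      cases ρ with
      | nil => simp at hp
      | cons a l => simp at hp; exact ⟨l, by rw [hp]⟩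
    refine ⟨R, s, hs, hQ p (by simp), ?_⟩
    have h1 := hch.left_of_append.right_of_append
    refine List.relationReflTransGen_of_exists_isChain_cons l ?_ ?_
    · clear hp hl hch
      induction l generalizing p with
      | nil => exact .singleton _
      | cons b l ih =>
        rw [List.isChain_cons_cons] at h1 ⊢
        exact ⟨⟨h1.1, hQ b (by simp)⟩, ih (fun v hv => hQ v (List.mem_cons_of_mem _ hv)) h1.2⟩
    · rw [List.getLast?_eq_getLast_of_ne_nil (by simp)] at hl
      simpa using hl
  · rintro ⟨R, s, hs, hp, h⟩
    obtain ⟨π, hπ, P, hP, hv⟩ := R.extends_of_finite s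
    obtain ⟨l, hl, hlast⟩ := List.exists_isChain_cons_of_relationReflTransGen h
    refine ⟨R, s, hs, [], p :: l, π, ⟨?_, P, hP, ?_⟩, rfl, ?_, ?_⟩
    · rw [List.nil_append]
      refine List.IsChain.append (hl.imp fun _ _ h => h.1) hπ.tail ?_
      intro x hx y hy
      rw [List.getLast?_eq_getLast_of_ne_nil (by simp), hlast] at hx
      obtain rfl : s = x := by simpa using hx
      cases π with
      | nil => simp at hy
      | cons b π =>
        obtain rfl : b = y := by simpa using hy
        exact (List.isChain_cons_cons.1 hπ).1
    · intro v hvP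
      have := hv v hvP
      rw [List.mem_cons] at this
      rcases this with rfl | h
      · have : v ∈ p :: l := hlast ▸ List.getLast_mem _
        exact List.mem_append_left _ this
      · simp [h]
    · rw [List.getLast?_eq_getLast_of_ne_nil (by simp), hlast]
    · clear hlast h
      induction l generalizing p with
      | nil => simpa using hp
      | cons b l ih =>
        rw [List.isChain_cons_cons] at hl
        have := ih hl.1.2 hl.2
        simp only [List.mem_cons, forall_eq_or_imp] at this ⊢
        exact ⟨hp, this⟩

theorem mem_PsWS_iff [Finite V] {Q : Set V} {p : V} :
    p ∈ T.PsWS Q ↔ ¬ T.Reaches Q {s | ¬ T.Reaches ∅ Q s} p := by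
  have : (T.PoWS Q)ᶜ = {s | ¬ T.Reaches ∅ Q s} := by
    ext s; simp [mem_PoWS_iff]
  rw [PsWS, Set.mem_compl_iff, mem_AvWS_iff, this]

end ImpreciseTerrain

/-! ## Lowest elevations of nodes on avoiding flow paths -/

namespace ImpreciseTerrain

variable {V : Type*} {T : ImpreciseTerrain V}

/-- At elevation `y`, with `u` at elevation `z` and all other neighbors as high as possible, `u` is
a steepest descent neighbor of `q`. -/
def Feasible (T : ImpreciseTerrain V) (q u : V) (z y : ℝ) : Prop :=
  T.low q ≤ y ∧ y ≤ T.high q ∧ z ≤ y ∧ ∀ r, T.graph.Adj q r →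
    (y - T.high r) / dist (T.pos q) (T.pos r) ≤ (y - z) / dist (T.pos q) (T.pos u)

/-- Lowering `u` only makes the descent to `u` steeper. This monotonicity is why one number per
node, its lowest elevation, is enough. -/
theorem Feasible.mono {q u : V} {z z' y : ℝ} (hz : z ≤ z') (h : T.Feasible q u z' y) :
    T.Feasible q u z y :=
  ⟨h.1, h.2.1, hz.trans h.2.2.1, fun r hr => (h.2.2.2 r hr).trans
    (div_le_div_of_nonneg_right (by linarith) dist_nonneg)⟩

theorem Realization.SteepestDescent.feasible {R : T.Realization} {q u : V}
    (h : R.SteepestDescent q u) : T.Feasible q u (R.elev u) (R.elev q) :=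
  ⟨R.low_le_elev q, R.elev_le_high q, h.elev_le, fun r hr =>
    (div_le_div_of_nonneg_right (by linarith [R.elev_le_high r]) dist_nonneg).trans
      (h.2.2 r hr)⟩

-- All labels are realized at once by placing the nodes outside `W` at their upper bounds.
-- Feasibility compares `u` with neighbors at their upper bounds, so only another node of `W` can be
-- steeper than the designated `u`, and then it is strictly lower than `p`. In either case the water
-- stays in `W` and makes progress.
open Classical in
theorem reaches_of_ranked {B S W : Set V} {val : V → ℝ} {rank : V → ℕ} [Finite V]
    (hW : ∀ p ∈ W, p ∉ B ∧ T.low p ≤ val p ∧ val p ≤ T.high p ∧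
      (p ∈ S ∨ ∃ u ∈ W, T.graph.Adj p u ∧ rank u < rank p ∧ T.Feasible p u (val u) (val p))) :
    ∀ p ∈ W, T.Reaches B S p := by
  let R : T.Realization :=
    { elev := fun v => if v ∈ W then val v else T.high v
      low_le_elev := fun v => by
        by_cases h : v ∈ W
        · simpa [h] using (hW v h).2.1
        · simpa [h] using T.low_le_high v
      elev_le_high := fun v => by
        by_cases h : v ∈ W
        · simpa [h] using (hW v h).2.2.1
        · simp [h] }
  have hin : ∀ {v}, v ∈ W → R.elev v = val v := fun h => if_pos h
  have hout : ∀ {v}, v ∉ W → R.elev v = T.high v := fun h => if_neg h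
  -- Feasibility allows a step between equal elevations; the rank excludes running in circles on a
  -- plateau.
  have wf : WellFounded fun a b : V =>
      R.elev a < R.elev b ∨ R.elev a = R.elev b ∧ rank a < rank b := by
    have : IsTrans V fun a b => R.elev a < R.elev b ∨ R.elev a = R.elev b ∧ rank a < rank b :=
      ⟨by
        rintro a b c (h | ⟨h, h'⟩) (k | ⟨k, k'⟩)
        · exact Or.inl (h.trans k)
        · exact Or.inl (k ▸ h)
        · exact Or.inl (h ▸ k)
        · exact Or.inr ⟨h.trans k, h'.trans k'⟩⟩
    have : Std.Irrefl fun a b : V => R.elev a < R.elev b ∨ R.elev a = R.elev b ∧ rank a < rank b :=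
      ⟨fun _ => by simp⟩
    exact Finite.wellFounded_of_trans_of_irrefl _
  intro p hp
  suffices ∃ s ∈ S, Relation.ReflTransGen (fun a b => R.SteepestDescent a b ∧ b ∉ B) p s by
    obtain ⟨s, hs, h⟩ := this
    exact ⟨R, s, hs, (hW p hp).1, h⟩
  induction p using wf.induction with
  | _ p ih =>
    obtain ⟨-, -, -, hpS | ⟨u, hu, hpu, hrank, hf⟩⟩ := hW p hp
    · exact ⟨p, hpS, .refl⟩
    suffices ∃ q ∈ W, R.SteepestDescent p q ∧
        (R.elev q < R.elev p ∨ R.elev q = R.elev p ∧ rank q < rank p) by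
      obtain ⟨q, hq, hpq, hlt⟩ := this
      obtain ⟨s, hs, h⟩ := ih q hlt hq
      exact ⟨s, hs, .head ⟨hpq, (hW q hq).1⟩ h⟩
    obtain ⟨-, -, hle, hsteep⟩ := hf
    have hsteep' : ∀ r, T.graph.Adj p r → r ∉ W → R.steepness p r ≤ R.steepness p u := by
      intro r hr hrW
      simpa [Realization.steepness, hin hp, hin hu, hout hrW] using hsteep r hr
    by_cases hmax : ∀ r, T.graph.Adj p r → R.steepness p r ≤ R.steepness p u
    · have hle' : R.elev u ≤ R.elev p := by rwa [hin hu, hin hp]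
      exact ⟨u, hu, ⟨hpu, (Realization.steepness_nonneg_iff hpu).2 hle', hmax⟩,
        hle'.lt_or_eq.imp id fun h => ⟨h, hrank⟩⟩
    -- Some neighbor is steeper than `u`. The steepest one lies in `W`, because nodes outside `W` do
    -- not exceed `u`, and it is strictly lower than `p`, so its rank does not matter.
    · push Not at hmax
      obtain ⟨r₀, hr₀, hgt⟩ := hmax
      obtain ⟨q, hq, hqmax⟩ := (Set.toFinite {r | T.graph.Adj p r}).exists_maximalFor
        (R.steepness p) _ ⟨r₀, hr₀⟩
      have hqmax' : ∀ r, T.graph.Adj p r → R.steepness p r ≤ R.steepness p q := fun r hr =>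
        (le_total _ _).elim id fun hle => hqmax hr hle
      have hqu : R.steepness p u < R.steepness p q := hgt.trans_le (hqmax' r₀ hr₀)
      have hu0 : 0 ≤ R.steepness p u :=
        (Realization.steepness_nonneg_iff hpu).2 (by rwa [hin hu, hin hp])
      refine ⟨q, ?_, ⟨hq, hu0.trans hqu.le, hqmax'⟩,
        Or.inl ((Realization.steepness_pos_iff hq).1 (hu0.trans_lt hqu))⟩
      by_contra hqW
      exact (hsteep' q hq hqW).not_gt hqu

/-- Backward induction along the path shows that `val` bounds the elevations on it from below: the
actual step is feasible for the actual elevation of its end, hence by monotonicity also for the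
smaller label. -/
theorem mem_of_reaches {B S W : Set V} {val : V → ℝ}
    (hS : ∀ s ∈ S, s ∉ B → s ∈ W ∧ val s ≤ T.low s)
    (hcl : ∀ u ∈ W, ∀ q, T.graph.Adj q u → q ∉ B → ∀ y, T.Feasible q u (val u) y →
      q ∈ W ∧ val q ≤ y) {p : V} (hp : T.Reaches B S p) : p ∈ W := by
  obtain ⟨R, s, hs, hp, h⟩ := hp
  suffices p ∈ W ∧ val p ≤ R.elev p from this.1
  induction h using Relation.ReflTransGen.head_induction_on with
  | refl => exact ⟨(hS s hs hp).1, (hS s hs hp).2.trans (R.low_le_elev s)⟩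
  | @head a c hac _ ih =>
    obtain ⟨hc, hval⟩ := ih hac.2
    exact hcl c hc a hac.1.1 hp _ (hac.1.feasible.mono hval)

/-! ## The label setting algorithm -/

/-- Invariant of the label setting algorithm: `act` holds the labelled and `done` the final nodes,
`val` their labels, and `C u q` holds if the label of `q` takes its neighbor `u` into account. -/
structure LabelInv (T : ImpreciseTerrain V) (B S : Set V) (act done : V → Prop) (val : V → ℝ)
    (rank : V → ℕ) (C : V → V → Prop) : Prop where
  disjoint : ∀ p, done p → ¬ act p
  label : ∀ p, act p ∨ done p → p ∉ B ∧ T.low p ≤ val p ∧ val p ≤ T.high p ∧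
    (p ∈ S ∨ ∃ u, done u ∧ T.graph.Adj p u ∧ (done p → rank u < rank p) ∧
      T.Feasible p u (val u) (val p))
  source : ∀ s ∈ S, s ∉ B → (act s ∨ done s) ∧ val s ≤ T.low s
  closed : ∀ u, done u → ∀ q, T.graph.Adj q u → q ∉ B → C u q → ∀ y, T.Feasible q u (val u) y →
    (act q ∨ done q) ∧ val q ≤ y
  done_le : ∀ p, done p → ∀ a, act a → val p ≤ val a

namespace LabelInv

variable {B S : Set V} {act done : V → Prop} {val : V → ℝ} {rank : V → ℕ} {C : V → V → Prop}

/-- Once the queue is empty, the final nodes satisfy the hypotheses of both `reaches_of_ranked` and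
`mem_of_reaches`. -/
theorem done_iff [Finite V] (h : T.LabelInv B S act done val rank C) (hC : ∀ u q, C u q)
    (hact : ∀ p, ¬ act p) (p : V) : done p ↔ T.Reaches B S p := by
  constructor
  · refine reaches_of_ranked (W := {p | done p}) (val := val) (rank := rank) (fun p hp => ?_) p
    obtain ⟨h1, h2, h3, h4⟩ := h.label p (Or.inr hp)
    refine ⟨h1, h2, h3, h4.imp id ?_⟩
    rintro ⟨u, hu, hpu, hr, hf⟩
    exact ⟨u, hu, hpu, hr hp, hf⟩
  · refine mem_of_reaches (W := {p | done p}) (val := val) (fun s hs hsB => ?_)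
      (fun u hu q hq hqB y hy => ?_)
    · simpa [hact] using h.source s hs hsB
    · simpa [hact] using h.closed u hu q hq hqB (hC u q) y hy

theorem of_sources {B S : Set V} {act : V → Prop} {val : V → ℝ}
    (hact : ∀ p, act p ↔ p ∈ S ∧ p ∉ B) (hval : ∀ p, act p → val p = T.low p) :
    T.LabelInv B S act (fun _ => False) val (fun _ => 0) (fun _ _ => True) where
  disjoint := by simp
  label p hp := by
    have hp : act p := by simpa using hp
    have := (hact p).1 hp
    simp [hval p hp, this.1, this.2, T.low_le_high]
  source s hs hsB := by
    have : act s := (hact s).2 ⟨hs, hsB⟩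
    simp [this, hval s this]
  closed := by simp
  done_le := by simp

/-- The neighbors of the new final node `u` have not been treated yet, so closure is claimed only
for the other final nodes. Minimality of the label of `u` keeps final labels below those in the
queue. -/
theorem extract [Finite V] (h : T.LabelInv B S act done val rank fun _ _ => True) {u : V}
    (hu : act u) (hmin : ∀ a, act a → val u ≤ val a) {act' done' : V → Prop}
    (hact' : ∀ p, act' p ↔ act p ∧ p ≠ u) (hdone' : ∀ p, done' p ↔ done p ∨ p = u) :
    ∃ rank', T.LabelInv B S act' done' val rank' (fun v _ => v ≠ u) := by
  classical
  have hun : ¬ done u := fun hd => h.disjoint u hd hu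
  have hor : ∀ p, act' p ∨ done' p ↔ act p ∨ done p := by
    intro p
    rw [hact', hdone']
    by_cases hp : p = u
    · subst hp; simp [hu]
    · simp [hp]
  cases nonempty_fintype V
  -- The new rank exceeds all earlier ones, in particular that of the final neighbor from which `u`
  -- got its label.
  refine ⟨Function.update rank u (1 + ∑ v, rank v), ?_, ?_, ?_, ?_, ?_⟩
  · intro p hp hp'
    rw [hact'] at hp'
    rcases (hdone' p).1 hp with hp | hp
    · exact h.disjoint p hp hp'.1
    · exact hp'.2 hp
  · intro p hp
    rw [hor] at hp
    obtain ⟨h1, h2, h3, h4⟩ := h.label p hp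
    refine ⟨h1, h2, h3, h4.imp id ?_⟩
    rintro ⟨v, hv, hpv, hr, hf⟩
    refine ⟨v, (hdone' v).2 (Or.inl hv), hpv, fun hp' => ?_, hf⟩
    have hvu : v ≠ u := fun he => hun (he ▸ hv)
    rw [Function.update_of_ne hvu]
    by_cases hpu : p = u
    · subst hpu
      rw [Function.update_self]
      have := Finset.single_le_sum (f := rank) (fun i _ => Nat.zero_le _) (Finset.mem_univ v)
      omega
    · rw [Function.update_of_ne hpu]
      exact hr (((hdone' p).1 hp').resolve_right hpu)
  · intro s hs hsB
    rw [hor]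
    exact h.source s hs hsB
  · intro v hv q hq hqB hvu y hy
    rw [hor]
    exact h.closed v (((hdone' v).1 hv).resolve_right hvu) q hq hqB trivial y hy
  · intro p hp a ha
    rw [hact'] at ha
    rcases (hdone' p).1 hp with hp | rfl
    · exact h.done_le p hp a ha.1
    · exact hmin a ha.1

/-- The label of `q` need not change. -/
theorem skip (h : T.LabelInv B S act done val rank C) {u q : V}
    (hq : q ∉ B → ∀ y, T.Feasible q u (val u) y → (act q ∨ done q) ∧ val q ≤ y) :
    T.LabelInv B S act done val rank (fun v r => C v r ∨ v = u ∧ r = q) :=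
  { h with
    closed := by
      rintro v hv r hr hrB (hC | ⟨rfl, rfl⟩) y hy
      · exact h.closed v hv r hr hrB hC y hy
      · exact hq hrB y hy }

/-- As `q` is not final, no label changes on which another label rests. Feasibility includes `val u
≤ y`, so the new label is still at least every final one. -/
theorem relax [DecidableEq V] (h : T.LabelInv B S act done val rank C) {u q : V} {y : ℝ} (hu : done u)
    (hqu : T.graph.Adj q u) (hqB : q ∉ B) (hqd : ¬ done q)
    (hmax : ∀ p, done p → val p ≤ val u) (hy : T.Feasible q u (val u) y)
    (hymin : ∀ y', T.Feasible q u (val u) y' → y ≤ y') (hval : act q → y ≤ val q)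
    {act' : V → Prop} {val' : V → ℝ} (hact' : ∀ p, act' p ↔ act p ∨ p = q)
    (hval' : ∀ p, val' p = if p = q then y else val p) :
    T.LabelInv B S act' done val' rank (fun v r => C v r ∨ v = u ∧ r = q) := by
  have hne : ∀ {p}, done p → p ≠ q := fun hp he => hqd (he ▸ hp)
  have hvd : ∀ {p}, done p → val' p = val p := fun hp => by rw [hval', if_neg (hne hp)]
  have hle : ∀ p, act p ∨ done p → val' p ≤ val p := by
    intro p hp
    rw [hval']
    split_ifs with hpq
    · subst hpq
      exact hval (hp.resolve_right hqd)
    · exact le_rfl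
  refine ⟨?_, ?_, ?_, ?_, ?_⟩
  · intro p hp hp'
    rcases (hact' p).1 hp' with h' | h'
    · exact h.disjoint p hp h'
    · exact hne hp h'
  · intro p hp
    by_cases hpq : p = q
    · subst hpq
      rw [hval', if_pos rfl]
      refine ⟨hqB, hy.1, hy.2.1, Or.inr ⟨u, hu, hqu, fun hd => absurd hd hqd, ?_⟩⟩
      rwa [hvd hu]
    · rw [hact'] at hp
      obtain ⟨h1, h2, h3, h4⟩ := h.label p (by simpa [hpq] using hp)
      rw [hval', if_neg hpq]
      refine ⟨h1, h2, h3, h4.imp id ?_⟩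
      rintro ⟨v, hv, hpv, hr, hf⟩
      exact ⟨v, hv, hpv, hr, by rwa [hvd hv]⟩
  · intro s hs hsB
    obtain ⟨h1, h2⟩ := h.source s hs hsB
    exact ⟨by rw [hact']; tauto, (hle s h1).trans h2⟩
  · intro v hv r hr hrB hC w hw
    rw [hvd hv] at hw
    rcases hC with hC | ⟨rfl, rfl⟩
    · obtain ⟨h1, h2⟩ := h.closed v hv r hr hrB hC w hw
      exact ⟨by rw [hact']; tauto, (hle r h1).trans h2⟩
    · exact ⟨by simp [hact'], by rw [hval', if_pos rfl]; exact hymin w hw⟩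
  · intro p hp a ha
    rw [hvd hp, hval']
    split_ifs with haq
    · exact (hmax p hp).trans hy.2.2.1
    · exact h.done_le p hp a (((hact' a).1 ha).resolve_right haq)

theorem mono_closed {C' : V → V → Prop} (h : T.LabelInv B S act done val rank C)
    (hC : ∀ u q, done u → T.graph.Adj q u → C' u q → C u q) :
    T.LabelInv B S act done val rank C' :=
  { h with closed := fun v hv r hr hrB h' => h.closed v hv r hr hrB (hC v r hv hr h') }

end LabelInv

end ImpreciseTerrain

/-! ## Lower envelopes of lines -/

/-- The lines `s ↦ H j + s * D j`, for `j < k`, have decreasing slopes and increasing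
breakpoints. -/
structure IsConvexChain (D H : ℕ → ℝ) (k : ℕ) : Prop where
  strict : ∀ j, j + 1 < k → D (j + 1) < D j
  convex : ∀ j, j + 2 < k →
    (H (j + 1) - H j) * (D (j + 1) - D (j + 2)) ≤ (H (j + 2) - H (j + 1)) * (D j - D (j + 1))

/-- The lower envelope of the lines `s ↦ f + s * e` with `(e, f) ∈ X`. -/
structure IsEnvelope (X : Set (ℝ × ℝ)) (D H : ℕ → ℝ) (k : ℕ) : Prop
    extends IsConvexChain D H k where
  mem : ∀ j, j < k → (D j, H j) ∈ X
  dom : ∀ x ∈ X, ∀ s : ℝ, ∃ j < k, H j + s * D j ≤ x.2 + s * x.1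

namespace IsConvexChain

variable {D H : ℕ → ℝ} {k : ℕ}

theorem congr {D' H' : ℕ → ℝ} (h : IsConvexChain D H k) (hD : ∀ j < k, D' j = D j)
    (hH : ∀ j < k, H' j = H j) : IsConvexChain D' H' k where
  strict j hj := by rw [hD _ hj, hD _ (by omega)]; exact h.strict j hj
  convex j hj := by
    rw [hD _ hj, hH _ hj, hD j (by omega), hH j (by omega), hD (j + 1) (by omega),
      hH (j + 1) (by omega)]
    exact h.convex j hj

/-- The hypothesis places `s` left of the breakpoint between `j` and `j + 1`, hence left of all
later breakpoints, so the values only grow from `j` on. The inequalities are cross-multiplied to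
avoid division. -/
theorem le_of_le_succ (h : IsConvexChain D H k) {j : ℕ} {s : ℝ}
    (hj : j + 1 < k → H j + s * D j ≤ H (j + 1) + s * D (j + 1)) :
    ∀ i, i < k → j ≤ i → H j + s * D j ≤ H i + s * D i := by
  have key : ∀ i, j ≤ i → i + 1 < k → H i + s * D i ≤ H (i + 1) + s * D (i + 1) := by
    intro i hi
    induction i, hi using Nat.le_induction with
    | base => exact hj
    | succ i hi ih =>
      intro hik
      have h1 := ih (by omega)
      have h2 := h.convex i hik
      have h3 := h.strict i (by omega)
      have h4 := h.strict (i + 1) hik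
      have h5 : s * (D i - D (i + 1)) * (D (i + 1) - D (i + 2)) ≤
          (H (i + 2) - H (i + 1)) * (D i - D (i + 1)) :=
        (mul_le_mul_of_nonneg_right (by linarith) (by linarith)).trans h2
      have h6 : s * (D (i + 1) - D (i + 2)) ≤ H (i + 2) - H (i + 1) :=
        le_of_mul_le_mul_right (by linarith) (sub_pos.2 h3)
      linarith
  intro i hik hi
  induction i, hi using Nat.le_induction with
  | base => exact le_rfl
  | succ i hi ih => exact (ih (by omega)).trans (key i hi hik)

theorem le_of_le_pred (h : IsConvexChain D H k) {j : ℕ} (hjk : j < k) {s : ℝ}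
    (hj : 0 < j → H j + s * D j ≤ H (j - 1) + s * D (j - 1)) :
    ∀ i, i ≤ j → H j + s * D j ≤ H i + s * D i := by
  have key : ∀ m i, i + m + 1 = j → H (i + 1) + s * D (i + 1) ≤ H i + s * D i := by
    intro m
    induction m with
    | zero =>
      rintro i rfl
      simpa using hj
    | succ m ih =>
      intro i hi
      have h1 := ih (i + 1) (by omega)
      have h2 := h.convex i (by omega)
      have h3 := h.strict i (by omega)
      have h4 := h.strict (i + 1) (by omega)
      have h5 : (H (i + 1) - H i) * (D (i + 1) - D (i + 2)) ≤
          s * (D i - D (i + 1)) * (D (i + 1) - D (i + 2)) :=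
        h2.trans ((mul_le_mul_of_nonneg_right (b := H (i + 2) - H (i + 1))
          (c := s * (D (i + 1) - D (i + 2))) (by linarith) (sub_pos.2 h3).le).trans
            (by linarith))
      have h6 := le_of_mul_le_mul_right h5 (sub_pos.2 h4)
      linarith
  intro i hi
  obtain ⟨m, rfl⟩ := Nat.exists_eq_add_of_le hi
  clear hi hj
  induction m generalizing i with
  | zero => exact le_rfl
  | succ m ih =>
    have h1 := key m i (by omega)
    have h2 := ih (i + 1) (by omega) (fun m' i' h' => key m' i' (by omega))
    rw [show i + 1 + m = i + (m + 1) by omega] at h2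
    exact h2.trans h1

/-- For fixed `s` the values along the chain first fall and then rise, so a comparison with the two
adjacent lines is enough. -/
theorem le_of_local (h : IsConvexChain D H k) {j : ℕ} (hjk : j < k) {s : ℝ}
    (hs : j + 1 < k → H j + s * D j ≤ H (j + 1) + s * D (j + 1))
    (hp : 0 < j → H j + s * D j ≤ H (j - 1) + s * D (j - 1)) :
    ∀ i, i < k → H j + s * D j ≤ H i + s * D i := by
  intro i hi
  rcases le_total j i with hji | hij
  · exact h.le_of_le_succ hs i hi hji
  · exact h.le_of_le_pred hjk hp i hij

end IsConvexChain

/-- The parameter where the lines `j` and `j + 1` meet. -/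
noncomputable def breakpoint (D H : ℕ → ℝ) (j : ℕ) : ℝ :=
  (H (j + 1) - H j) / (D j - D (j + 1))

/-- The direction predicate of the binary search. -/
def SearchLeft (D H : ℕ → ℝ) (s₀ d z : ℝ) (j : ℕ) : Prop :=
  s₀ ≤ breakpoint D H j ∧
    (D (j + 1) ≤ d ∨ z + breakpoint D H j * d ≤ H (j + 1) + breakpoint D H j * D (j + 1))

open Classical in
/-- The parameter found by the binary search that stops at line `j`. -/
noncomputable def searchParam (D H : ℕ → ℝ) (s₀ d z : ℝ) (j : ℕ) : ℝ :=
  if D j ≤ d then s₀ else max s₀ ((z - H j) / (D j - d))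

theorem le_searchParam (D H : ℕ → ℝ) (s₀ d z : ℝ) (j : ℕ) : s₀ ≤ searchParam D H s₀ d z j := by
  unfold searchParam
  split_ifs
  · exact le_rfl
  · exact le_max_left _ _

section search

variable {D H : ℕ → ℝ} {k : ℕ} {s₀ d z : ℝ} {j : ℕ}

theorem breakpoint_spec (h : D (j + 1) < D j) :
    H j + breakpoint D H j * D j = H (j + 1) + breakpoint D H j * D (j + 1) := by
  have h1 : breakpoint D H j * (D j - D (j + 1)) = H (j + 1) - H j :=
    div_mul_cancel₀ _ (sub_pos.2 h).ne'
  linarith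

/-- If the search goes right at `j`, then either the breakpoint precedes `s₀`, or the query line is
still above the envelope there while line `j + 1` is steeper, so these two lines meet only further
right. -/
theorem breakpoint_le_searchParam (hp : ¬ SearchLeft D H s₀ d z j) :
    breakpoint D H j ≤ searchParam D H s₀ d z (j + 1) := by
  by_cases h0 : s₀ ≤ breakpoint D H j
  · have h1 : d < D (j + 1) ∧ H (j + 1) + breakpoint D H j * D (j + 1) < z + breakpoint D H j * d := by
      simpa [SearchLeft, h0] using hp
    rw [searchParam, if_neg h1.1.not_ge]
    refine le_max_of_le_right ?_
    rw [le_div_iff₀ (sub_pos.2 h1.1)]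
    linarith
  · exact (not_le.1 h0).le.trans (le_searchParam ..)

/-- Line `j` is minimal among the lines at the computed parameter: against `j - 1` because the
search went right there, against `j + 1` by the explicit test. Being below line `j` is then being
below the envelope. -/
theorem IsConvexChain.search_sound (hc : IsConvexChain D H k) (hj : j < k)
    (hlo : ∀ i, i + 1 = j → ¬ SearchLeft D H s₀ d z i)
    (htest : z + searchParam D H s₀ d z j * d ≤ H j + searchParam D H s₀ d z j * D j)
    (hnext : j + 1 < k → H j + searchParam D H s₀ d z j * D j ≤
      H (j + 1) + searchParam D H s₀ d z j * D (j + 1)) :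
    ∀ i, i < k → z + searchParam D H s₀ d z j * d ≤ H i + searchParam D H s₀ d z j * D i := by
  intro i hi
  refine htest.trans (hc.le_of_local hj hnext (fun hj0 => ?_) i hi)
  obtain ⟨l, rfl⟩ := Nat.exists_eq_succ_of_ne_zero hj0.ne'
  have h1 := hc.strict l (by omega)
  have h2 := breakpoint_le_searchParam (hlo l rfl)
  have h3 := breakpoint_spec (H := H) h1
  have h4 := mul_le_mul_of_nonneg_right h2 (sub_pos.2 h1).le
  simp only [Nat.succ_eq_add_one, Nat.add_sub_cancel] at *
  linarith

/-- Line `j` and the bound `s₀` alone already force every admissible `s` to be at least the computed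
parameter. It remains to see that the parameter does not pass the breakpoint after `j`, and this is
where `SearchLeft` enters. -/
theorem IsConvexChain.search_complete (hc : IsConvexChain D H k) (hj : j < k)
    (hhi : j + 1 < k → SearchLeft D H s₀ d z j) {s : ℝ} (hs₀ : s₀ ≤ s)
    (hs : ∀ i, i < k → z + s * d ≤ H i + s * D i) :
    z + searchParam D H s₀ d z j * d ≤ H j + searchParam D H s₀ d z j * D j ∧
    (j + 1 < k → H j + searchParam D H s₀ d z j * D j ≤
      H (j + 1) + searchParam D H s₀ d z j * D (j + 1)) ∧ searchParam D H s₀ d z j ≤ s := by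
  have hsj := hs j hj
  unfold searchParam
  split_ifs with hd
  · refine ⟨?_, fun hk => ?_, hs₀⟩
    · have := mul_le_mul_of_nonneg_right hs₀ (sub_nonneg.2 hd)
      linarith
    · have h1 := hc.strict j hk
      have h2 := mul_le_mul_of_nonneg_right (hhi hk).1 (sub_pos.2 h1).le
      have h3 := breakpoint_spec (H := H) h1
      linarith
  · have hd := not_le.1 hd
    have hpos := sub_pos.2 hd
    refine ⟨?_, fun hk => ?_, max_le hs₀ ?_⟩
    · have h1 := mul_le_mul_of_nonneg_right (le_max_right s₀ ((z - H j) / (D j - d))) hpos.le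
      rw [div_mul_cancel₀ _ hpos.ne'] at h1
      linarith
    · have h1 := hc.strict j hk
      have h3 := breakpoint_spec (H := H) h1
      suffices max s₀ ((z - H j) / (D j - d)) ≤ breakpoint D H j by
        have h2 := mul_le_mul_of_nonneg_right this (sub_pos.2 h1).le
        linarith
      refine max_le (hhi hk).1 ?_
      rw [div_le_iff₀ hpos]
      -- The query line is below line `j` at the breakpoint. If line `j + 1` is no steeper than the
      -- query line, then admissibility at some `s` right of the breakpoint carries back to it; for
      -- `s` left of it, line `j` is steeper and the inequality carries forward. Otherwise the
      -- predicate asserts it directly.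
      have h4 : z + breakpoint D H j * d ≤ H j + breakpoint D H j * D j := by
        rcases (hhi hk).2 with h5 | h5
        · rcases le_total s (breakpoint D H j) with h6 | h6
          · have := mul_le_mul_of_nonneg_right h6 hpos.le
            linarith
          · have := mul_le_mul_of_nonneg_right h6 (sub_nonneg.2 h5)
            have := hs (j + 1) hk
            linarith
        · linarith
      linarith
    · rw [div_le_iff₀ hpos]
      linarith

end search

/-! ### Insertion of a line -/

/-- The state of the insertion of the line `(d, h)`, of smallest slope, while lines are removed
from the end of the chain. -/
structure IsPartialEnvelope (X : Set (ℝ × ℝ)) (d h : ℝ) (D H : ℕ → ℝ) (k : ℕ) : Prop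
    extends IsConvexChain D H k where
  mem : ∀ j, j < k → (D j, H j) ∈ X
  dom : ∀ x ∈ X, ∀ s : ℝ, (∃ j < k, H j + s * D j ≤ x.2 + s * x.1) ∨ h + s * d ≤ x.2 + s * x.1
  lt_of_le : ∀ j, j + 1 = k → D j ≤ d → h < H j

theorem isEnvelope_empty (D H : ℕ → ℝ) : IsEnvelope ∅ D H 0 where
  strict := by simp
  convex := by simp
  mem := by simp
  dom := by simp

/-- The last line of the chain is not needed once `(d, h)` is added. -/
def LastRedundant (D H : ℕ → ℝ) (k : ℕ) (d h : ℝ) : Prop :=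
  0 < k ∧ (D (k - 1) ≤ d ∨ 1 < k ∧
    (h - H (k - 1)) * (D (k - 2) - D (k - 1)) ≤ (H (k - 1) - H (k - 2)) * (D (k - 1) - d))

section insert

variable {X : Set (ℝ × ℝ)} {D H : ℕ → ℝ} {k : ℕ} {d h : ℝ}

theorem IsEnvelope.congr {D' H' : ℕ → ℝ} (he : IsEnvelope X D H k) (hD : ∀ j < k, D' j = D j)
    (hH : ∀ j < k, H' j = H j) : IsEnvelope X D' H' k where
  toIsConvexChain := he.toIsConvexChain.congr hD hH
  mem j hj := by rw [hD j hj, hH j hj]; exact he.mem j hj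
  dom x hx s := by
    obtain ⟨j, hj, h⟩ := he.dom x hx s
    exact ⟨j, hj, by rwa [hD j hj, hH j hj]⟩

/-- As `d` is the smallest slope, the two lines are parallel and the new one is not lower. -/
theorem IsEnvelope.insert_of_le (he : IsEnvelope X D H k) (hd : ∀ x ∈ X, d ≤ x.1) {j : ℕ}
    (hj : j < k) (hD : D j ≤ d) (hH : H j ≤ h) : IsEnvelope (insert (d, h) X) D H k where
  toIsConvexChain := he.toIsConvexChain
  mem i hi := Set.mem_insert_of_mem _ (he.mem i hi)
  dom := by
    rintro x (rfl | hx) s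
    · have : D j = d := le_antisymm hD (hd _ (he.mem j hj))
      exact ⟨j, hj, by simp only [this]; linarith⟩
    · exact he.dom x hx s

theorem IsEnvelope.isPartialEnvelope (he : IsEnvelope X D H k)
    (hn : ¬ (0 < k ∧ D (k - 1) ≤ d ∧ H (k - 1) ≤ h)) : IsPartialEnvelope X d h D H k where
  toIsConvexChain := he.toIsConvexChain
  mem := he.mem
  dom x hx s := Or.inl (he.dom x hx s)
  lt_of_le := by
    rintro j rfl hj
    by_contra! hH
    exact hn (by simpa using ⟨hj, hH⟩)

/-- If the last line is parallel to the new one, the new one is strictly lower. Otherwise the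
cross-multiplied test says that the new line meets the last one no later than the last one meets its
predecessor, so at every `s` one of these two lines is at or below the last one. -/
theorem IsPartialEnvelope.pop (he : IsPartialEnvelope X d h D H k) (hd : ∀ x ∈ X, d ≤ x.1)
    (hr : LastRedundant D H k d h) : IsPartialEnvelope X d h D H (k - 1) := by
  obtain ⟨hk, hr⟩ := hr
  obtain ⟨j, rfl⟩ : ∃ j, k = j + 1 := ⟨k - 1, by omega⟩
  have hdj : d ≤ D j := hd _ (he.mem j (by omega))
  have hlast : ∀ s : ℝ, (∃ i < j, H i + s * D i ≤ H j + s * D j) ∨ h + s * d ≤ H j + s * D j := by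
    intro s
    by_cases hD : D j ≤ d
    · right
      have := he.lt_of_le j rfl hD
      rw [le_antisymm hD hdj]
      linarith
    · simp only [Nat.add_sub_cancel, hD, false_or] at hr
      obtain ⟨i, rfl⟩ : ∃ i, j = i + 1 := ⟨j - 1, by omega⟩
      have hcross : (h - H (i + 1)) * (D i - D (i + 1)) ≤
          (H (i + 1) - H i) * (D (i + 1) - d) := by simpa using hr.2
      by_contra! hcon
      have h1 := hcon.1 i (by omega)
      have h2 := hcon.2
      have h3 := he.strict i (by omega)
      have h4 := mul_lt_mul_of_pos_right (a := D i - D (i + 1)) (show s * (D (i + 1) - d) < h - H (i + 1) by linarith)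
        (sub_pos.2 h3)
      have h5 := mul_le_mul_of_nonneg_right (a := D (i + 1) - d)
        (show H (i + 1) - H i ≤ s * (D i - D (i + 1)) by linarith) (sub_nonneg.2 hdj)
      linarith
  refine ⟨⟨fun i hi => he.strict i (by omega), fun i hi => he.convex i (by omega)⟩,
    fun i hi => he.mem i (by omega), fun x hx s => ?_, ?_⟩
  · rcases he.dom x hx s with ⟨i, hi, hle⟩ | hle
    · rcases Nat.lt_succ_iff_lt_or_eq.1 hi with hi | rfl
      · exact Or.inl ⟨i, by simpa using hi, hle⟩
      · rcases hlast s with ⟨l, hl, hle'⟩ | hle'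
        · exact Or.inl ⟨l, by simpa using hl, hle'.trans hle⟩
        · exact Or.inr (hle'.trans hle)
    · exact Or.inr hle
  -- Contradictory hypotheses: the line before the removed one has a slope strictly above that of
  -- the removed one, hence strictly above `d`.
  · intro i hi hD
    have h1 : i + 1 = j := by simpa using hi
    subst h1
    have := he.strict i (by omega)
    linarith

/-- The failed redundancy test supplies precisely the slope and breakpoint inequalities at the new
end of the chain. -/
theorem IsPartialEnvelope.push (he : IsPartialEnvelope X d h D H k)
    (hr : ¬ LastRedundant D H k d h) {D' H' : ℕ → ℝ} (hD : ∀ j < k, D' j = D j)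
    (hH : ∀ j < k, H' j = H j) (hDk : D' k = d) (hHk : H' k = h) :
    IsEnvelope (insert (d, h) X) D' H' (k + 1) := by
  refine ⟨⟨fun j hj => ?_, fun j hj => ?_⟩, fun j hj => ?_, ?_⟩
  · rcases Nat.lt_or_ge (j + 1) k with h1 | h1
    · rw [hD _ h1, hD j (by omega)]
      exact he.strict j h1
    · obtain rfl : k = j + 1 := by omega
      rw [hDk, hD j (by omega)]
      by_contra! hle
      exact hr ⟨by omega, Or.inl (by simpa using hle)⟩
  · rcases Nat.lt_or_ge (j + 2) k with h1 | h1
    · rw [hD _ h1, hH _ h1, hD j (by omega), hH j (by omega), hD (j + 1) (by omega),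
        hH (j + 1) (by omega)]
      exact he.convex j h1
    · obtain rfl : k = j + 2 := by omega
      rw [hDk, hHk, hD j (by omega), hH j (by omega), hD (j + 1) (by omega),
        hH (j + 1) (by omega)]
      by_contra! hle
      exact hr ⟨by omega, Or.inr ⟨by omega, by simpa using hle.le⟩⟩
  · rcases Nat.lt_succ_iff_lt_or_eq.1 hj with h1 | rfl
    · rw [hD j h1, hH j h1]
      exact Set.mem_insert_of_mem _ (he.mem j h1)
    · rw [hDk, hHk]
      exact Set.mem_insert _ _
  · rintro x (rfl | hx) s
    · exact ⟨k, by omega, by rw [hDk, hHk]⟩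
    · rcases he.dom x hx s with ⟨j, hj, hle⟩ | hle
      · exact ⟨j, by omega, by rwa [hD j hj, hH j hj]⟩
      · exact ⟨k, by omega, by rwa [hDk, hHk]⟩

end insert

/-! ### Lowest feasible elevations as queries to lower envelopes -/

namespace ImpreciseTerrain

variable {V : Type*} {T : ImpreciseTerrain V}

/-- The lines of the neighbors of `q` in `N`. -/
def linesAt (T : ImpreciseTerrain V) (N : V → Prop) (q : V) : Set (ℝ × ℝ) :=
  {x | ∃ r, N r ∧ x = (dist (T.pos q) (T.pos r), T.high r)}

/-- The parameter `s` is the steepness from `q` to `u`. Multiplying the condition at `r` by the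
distance turns it into `y ≤ high r + s * |qr|`, while `low q ≤ y` and `z ≤ y` become lower bounds
for `s`. -/
theorem feasible_iff_envelope {q u : V} {z y : ℝ} {D H : ℕ → ℝ} {k : ℕ}
    (hqu : T.graph.Adj q u)
    (he : IsEnvelope (T.linesAt (T.graph.Adj q) q) D H k) {s : ℝ}
    (hs : y = z + s * dist (T.pos q) (T.pos u)) :
    T.Feasible q u z y ↔
      max 0 ((T.low q - z) / dist (T.pos q) (T.pos u)) ≤ s ∧ y ≤ T.high q ∧
      ∀ i, i < k → z + s * dist (T.pos q) (T.pos u) ≤ H i + s * D i := by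
  have hd := T.dist_pos_of_adj hqu
  have hs' : s = (y - z) / dist (T.pos q) (T.pos u) := by
    rw [eq_div_iff hd.ne', hs]; ring
  have h1 : T.low q ≤ y ↔ (T.low q - z) / dist (T.pos q) (T.pos u) ≤ s := by
    rw [div_le_iff₀ hd, hs]
    constructor <;> intro <;> linarith
  have h2 : z ≤ y ↔ 0 ≤ s := by
    rw [hs', le_div_iff₀ hd, zero_mul, sub_nonneg]
  have h3 : (∀ r, T.graph.Adj q r → (y - T.high r) / dist (T.pos q) (T.pos r) ≤ s) ↔
      ∀ i, i < k → y ≤ H i + s * D i := by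
    constructor
    · intro h i hi
      obtain ⟨r, hr, hx⟩ := he.mem i hi
      rw [Prod.mk.injEq] at hx
      rw [hx.1, hx.2]
      have := h r hr
      rw [div_le_iff₀ (T.dist_pos_of_adj hr)] at this
      linarith
    · intro h r hr
      obtain ⟨i, hi, hle⟩ := he.dom _ ⟨r, hr, rfl⟩ s
      rw [div_le_iff₀ (T.dist_pos_of_adj hr)]
      have := h i hi
      simp only at hle
      linarith
  rw [Feasible, ← hs', h3, h1, h2, ← hs, max_le_iff]
  tauto

section query

variable {q u : V} {z s₀ : ℝ} {D H : ℕ → ℝ} {k j : ℕ} {s : ℝ}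

/-- The final test of the search for the lowest feasible elevation of `q`. -/
def SearchTest (T : ImpreciseTerrain V) (q u : V) (z : ℝ) (D H : ℕ → ℝ) (k j : ℕ) (s : ℝ) : Prop :=
  z + s * dist (T.pos q) (T.pos u) ≤ T.high q ∧
    z + s * dist (T.pos q) (T.pos u) ≤ H j + s * D j ∧
    (j + 1 < k → H j + s * D j ≤ H (j + 1) + s * D (j + 1))

theorem isLeast_of_searchTest (hqu : T.graph.Adj q u)
    (he : IsEnvelope (T.linesAt (T.graph.Adj q) q) D H k) (hj : j < k)
    (hs₀ : s₀ = max 0 ((T.low q - z) / dist (T.pos q) (T.pos u)))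
    (hlo : ∀ i, i + 1 = j → ¬ SearchLeft D H s₀ (dist (T.pos q) (T.pos u)) z i)
    (hhi : j + 1 < k → SearchLeft D H s₀ (dist (T.pos q) (T.pos u)) z j)
    (hs : s = searchParam D H s₀ (dist (T.pos q) (T.pos u)) z j)
    (htest : T.SearchTest q u z D H k j s) :
    IsLeast {y | T.Feasible q u z y} (z + s * dist (T.pos q) (T.pos u)) := by
  have hd := T.dist_pos_of_adj hqu
  constructor
  · rw [Set.mem_ofPred_eq, feasible_iff_envelope hqu he rfl, ← hs₀]
    refine ⟨hs ▸ le_searchParam .., htest.1, ?_⟩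
    rw [hs]
    refine he.toIsConvexChain.search_sound hj hlo ?_ ?_
    · rw [← hs]; exact htest.2.1
    · rw [← hs]; exact htest.2.2
  · intro y hy
    rw [Set.mem_ofPred_eq, feasible_iff_envelope hqu he (s := (y - z) / dist (T.pos q) (T.pos u))
      (by field_simp; ring), ← hs₀] at hy
    have := (he.toIsConvexChain.search_complete hj hhi hy.1 hy.2.2).2.2
    rw [← hs, le_div_iff₀ hd] at this
    linarith

/-- The search ignores the upper bound of `q`. This is harmless: the computed parameter is at most
every admissible one, so it meets that bound whenever any of them does. -/
theorem not_feasible_of_not_searchTest (hqu : T.graph.Adj q u)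
    (he : IsEnvelope (T.linesAt (T.graph.Adj q) q) D H k) (hj : j < k)
    (hs₀ : s₀ = max 0 ((T.low q - z) / dist (T.pos q) (T.pos u)))
    (hhi : j + 1 < k → SearchLeft D H s₀ (dist (T.pos q) (T.pos u)) z j)
    (hs : s = searchParam D H s₀ (dist (T.pos q) (T.pos u)) z j)
    (htest : ¬ T.SearchTest q u z D H k j s) (y : ℝ) : ¬ T.Feasible q u z y := by
  have hd := T.dist_pos_of_adj hqu
  intro hy
  rw [feasible_iff_envelope hqu he (s := (y - z) / dist (T.pos q) (T.pos u))
    (by field_simp; ring), ← hs₀] at hy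
  obtain ⟨h1, h2, h3⟩ := he.toIsConvexChain.search_complete hj hhi hy.1 hy.2.2
  rw [← hs] at h1 h2 h3
  refine htest ⟨le_trans ?_ hy.2.1, h1, h2⟩
  rw [le_div_iff₀ hd] at h3
  linarith

end query

end ImpreciseTerrain

/-! ## Reasoning about programs of the real RAM -/

namespace RealRAM

attribute [simp] NatExp.eval RealExp.eval Test.Holds NatExp.cost RealExp.cost Test.cost

section State

variable (σ : State) (a r i x : ℕ) (y : ℝ)

@[simp] theorem State.setNatReg_natReg (r' : ℕ) :
    (σ.setNatReg r x).natReg r' = if r' = r then x else σ.natReg r' := by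
  simp [State.setNatReg, Function.update_apply]

@[simp] theorem State.setNatReg_realReg : (σ.setNatReg r x).realReg = σ.realReg := rfl
@[simp] theorem State.setNatReg_natArr : (σ.setNatReg r x).natArr = σ.natArr := rfl
@[simp] theorem State.setNatReg_realArr : (σ.setNatReg r x).realArr = σ.realArr := rfl

@[simp] theorem State.setRealReg_realReg (r' : ℕ) :
    (σ.setRealReg r y).realReg r' = if r' = r then y else σ.realReg r' := by
  simp [State.setRealReg, Function.update_apply]

@[simp] theorem State.setRealReg_natReg : (σ.setRealReg r y).natReg = σ.natReg := rfl
@[simp] theorem State.setRealReg_natArr : (σ.setRealReg r y).natArr = σ.natArr := rfl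
@[simp] theorem State.setRealReg_realArr : (σ.setRealReg r y).realArr = σ.realArr := rfl

@[simp] theorem State.setNatArr_natArr (a' : ℕ) :
    (σ.setNatArr a i x).natArr a' =
      if a' = a then Function.update (σ.natArr a) i x else σ.natArr a' := by
  simp [State.setNatArr, Function.update_apply]

@[simp] theorem State.setNatArr_natReg : (σ.setNatArr a i x).natReg = σ.natReg := rfl
@[simp] theorem State.setNatArr_realReg : (σ.setNatArr a i x).realReg = σ.realReg := rfl
@[simp] theorem State.setNatArr_realArr : (σ.setNatArr a i x).realArr = σ.realArr := rfl

@[simp] theorem State.setRealArr_realArr (a' : ℕ) :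
    (σ.setRealArr a i y).realArr a' =
      if a' = a then Function.update (σ.realArr a) i y else σ.realArr a' := by
  simp [State.setRealArr, Function.update_apply]

@[simp] theorem State.setRealArr_natReg : (σ.setRealArr a i y).natReg = σ.natReg := rfl
@[simp] theorem State.setRealArr_realReg : (σ.setRealArr a i y).realReg = σ.realReg := rfl
@[simp] theorem State.setRealArr_natArr : (σ.setRealArr a i y).natArr = σ.natArr := rfl

end State

/-- Started in `σ`, the program `c` halts in a state and after a time that satisfy `P`. -/
def Runs (c : Program) (σ : State) (P : State → ℕ → Prop) : Prop :=
  ∃ σ' t, Exec c σ σ' t ∧ P σ' t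

section Runs

variable {σ : State} {P P' : State → ℕ → Prop} {c c₁ c₂ : Program} {b : Test}

theorem Runs.mono (h : Runs c σ P) (hP : ∀ σ' t, P σ' t → P' σ' t) : Runs c σ P' :=
  let ⟨σ', t, he, hp⟩ := h
  ⟨σ', t, he, hP σ' t hp⟩

@[simp] theorem runs_skip : Runs .skip σ P ↔ P σ 1 :=
  ⟨fun ⟨_, _, he, hp⟩ => by cases he; exact hp, fun h => ⟨_, _, .skip σ, h⟩⟩

@[simp] theorem runs_setNatReg {r : ℕ} {e : NatExp} :
    Runs (.setNatReg r e) σ P ↔ P (σ.setNatReg r (e.eval σ)) (e.cost + 1) :=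
  ⟨fun ⟨_, _, he, hp⟩ => by cases he; exact hp, fun h => ⟨_, _, .setNatReg σ r e, h⟩⟩

@[simp] theorem runs_setRealReg {r : ℕ} {e : RealExp} :
    Runs (.setRealReg r e) σ P ↔ P (σ.setRealReg r (e.eval σ)) (e.cost + 1) :=
  ⟨fun ⟨_, _, he, hp⟩ => by cases he; exact hp, fun h => ⟨_, _, .setRealReg σ r e, h⟩⟩

@[simp] theorem runs_setNatArr {a : ℕ} {i e : NatExp} :
    Runs (.setNatArr a i e) σ P ↔
      P (σ.setNatArr a (i.eval σ) (e.eval σ)) (i.cost + e.cost + 1) :=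
  ⟨fun ⟨_, _, he, hp⟩ => by cases he; exact hp, fun h => ⟨_, _, .setNatArr σ a i e, h⟩⟩

@[simp] theorem runs_setRealArr {a : ℕ} {i : NatExp} {e : RealExp} :
    Runs (.setRealArr a i e) σ P ↔
      P (σ.setRealArr a (i.eval σ) (e.eval σ)) (i.cost + e.cost + 1) :=
  ⟨fun ⟨_, _, he, hp⟩ => by cases he; exact hp, fun h => ⟨_, _, .setRealArr σ a i e, h⟩⟩

@[simp] theorem runs_seq :
    Runs (.seq c₁ c₂) σ P ↔
      Runs c₁ σ fun σ₁ t₁ => Runs c₂ σ₁ fun σ₂ t₂ => P σ₂ (t₁ + t₂) := by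
  constructor
  · rintro ⟨_, _, he, hp⟩
    cases he with
    | seq h₁ h₂ => exact ⟨_, _, h₁, _, _, h₂, hp⟩
  · rintro ⟨_, _, h₁, _, _, h₂, hp⟩
    exact ⟨_, _, .seq h₁ h₂, hp⟩

@[simp] theorem runs_cond :
    Runs (.cond b c₁ c₂) σ P ↔
      (b.Holds σ → Runs c₁ σ fun σ' t => P σ' (b.cost + 1 + t)) ∧
        (¬ b.Holds σ → Runs c₂ σ fun σ' t => P σ' (b.cost + 1 + t)) := by
  constructor
  · rintro ⟨_, _, he, hp⟩
    cases he with
    | cond_true hb h => exact ⟨fun _ => ⟨_, _, h, hp⟩, fun hb' => absurd hb hb'⟩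
    | cond_false hb h => exact ⟨fun hb' => absurd hb' hb, fun _ => ⟨_, _, h, hp⟩⟩
  · rintro ⟨h₁, h₂⟩
    by_cases hb : b.Holds σ
    · obtain ⟨_, _, h, hp⟩ := h₁ hb
      exact ⟨_, _, .cond_true hb h, hp⟩
    · obtain ⟨_, _, h, hp⟩ := h₂ hb
      exact ⟨_, _, .cond_false hb h, hp⟩

end Runs

/-! ### Frames -/

/-- The natural number registers that a program writes. -/
@[simp] def Program.natRegs : Program → List ℕ
  | .setNatReg r _ => [r]
  | .seq c₁ c₂ => c₁.natRegs ++ c₂.natRegs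
  | .cond _ c₁ c₂ => c₁.natRegs ++ c₂.natRegs
  | .loop _ c => c.natRegs
  | _ => []

/-- The real registers that a program writes. -/
@[simp] def Program.realRegs : Program → List ℕ
  | .setRealReg r _ => [r]
  | .seq c₁ c₂ => c₁.realRegs ++ c₂.realRegs
  | .cond _ c₁ c₂ => c₁.realRegs ++ c₂.realRegs
  | .loop _ c => c.realRegs
  | _ => []

/-- The natural number arrays that a program writes. -/
@[simp] def Program.natArrs : Program → List ℕ
  | .setNatArr a _ _ => [a]
  | .seq c₁ c₂ => c₁.natArrs ++ c₂.natArrs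
  | .cond _ c₁ c₂ => c₁.natArrs ++ c₂.natArrs
  | .loop _ c => c.natArrs
  | _ => []

/-- The real arrays that a program writes. -/
@[simp] def Program.realArrs : Program → List ℕ
  | .setRealArr a _ _ => [a]
  | .seq c₁ c₂ => c₁.realArrs ++ c₂.realArrs
  | .cond _ c₁ c₂ => c₁.realArrs ++ c₂.realArrs
  | .loop _ c => c.realArrs
  | _ => []

/-- `σ` and `σ'` differ only in what `c` writes. -/
structure Frame (c : Program) (σ σ' : State) : Prop where
  natReg : ∀ r, r ∉ c.natRegs → σ'.natReg r = σ.natReg r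
  realReg : ∀ r, r ∉ c.realRegs → σ'.realReg r = σ.realReg r
  natArr : ∀ a, a ∉ c.natArrs → σ'.natArr a = σ.natArr a
  realArr : ∀ a, a ∉ c.realArrs → σ'.realArr a = σ.realArr a

theorem Frame.refl (c : Program) (σ : State) : Frame c σ σ :=
  ⟨fun _ _ => rfl, fun _ _ => rfl, fun _ _ => rfl, fun _ _ => rfl⟩

theorem Frame.trans {c : Program} {σ₁ σ₂ σ₃ : State} (h : Frame c σ₁ σ₂) (h' : Frame c σ₂ σ₃) :
    Frame c σ₁ σ₃ :=
  ⟨fun r hr => (h'.natReg r hr).trans (h.natReg r hr),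
    fun r hr => (h'.realReg r hr).trans (h.realReg r hr),
    fun r hr => (h'.natArr r hr).trans (h.natArr r hr),
    fun r hr => (h'.realArr r hr).trans (h.realArr r hr)⟩

theorem Frame.weaken {c c' : Program} {σ₁ σ₂ : State} (h : Frame c σ₁ σ₂)
    (h1 : c.natRegs ⊆ c'.natRegs) (h2 : c.realRegs ⊆ c'.realRegs) (h3 : c.natArrs ⊆ c'.natArrs)
    (h4 : c.realArrs ⊆ c'.realArrs) : Frame c' σ₁ σ₂ :=
  ⟨fun r hr => h.natReg r fun h' => hr (h1 h'), fun r hr => h.realReg r fun h' => hr (h2 h'),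
    fun r hr => h.natArr r fun h' => hr (h3 h'), fun r hr => h.realArr r fun h' => hr (h4 h')⟩

theorem Exec.frame {c : Program} {σ σ' : State} {t : ℕ} (h : Exec c σ σ' t) : Frame c σ σ' := by
  induction h with
  | skip σ => exact .refl _ _
  | setNatReg σ r e => constructor <;> simp +contextual
  | setRealReg σ r e => constructor <;> simp +contextual
  | setNatArr σ r e => constructor <;> simp +contextual
  | setRealArr σ r e => constructor <;> simp +contextual
  | seq _ _ ih₁ ih₂ =>
    exact (ih₁.weaken (by simp) (by simp) (by simp) (by simp)).trans
      (ih₂.weaken (by simp) (by simp) (by simp) (by simp))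
  | cond_true _ _ ih => exact ih.weaken (by simp) (by simp) (by simp) (by simp)
  | cond_false _ _ ih => exact ih.weaken (by simp) (by simp) (by simp) (by simp)
  | loop_false _ => exact .refl _ _
  | loop_true _ _ _ ih₁ ih₂ =>
    exact (ih₁.weaken (by simp) (by simp) (by simp) (by simp)).trans ih₂

theorem Runs.frame {c : Program} {σ : State} {P : State → ℕ → Prop} (h : Runs c σ P) :
    Runs c σ fun σ' t => Frame c σ σ' ∧ P σ' t :=
  let ⟨σ', t, he, hp⟩ := h
  ⟨σ', t, he, he.frame, hp⟩

/-- Supplying the frame together with the postcondition keeps specifications short: what a program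
does not write need not be mentioned in them. -/
theorem Runs.then {c : Program} {σ : State} {P P' : State → ℕ → Prop} (h : Runs c σ P)
    (hP : ∀ σ' t, Frame c σ σ' → P σ' t → P' σ' t) : Runs c σ P' :=
  h.frame.mono fun σ' t h => hP σ' t h.1 h.2

/-- The rule for loops, with an invariant `I` and a potential `Φ` that pays for the time. -/
theorem Runs.loop {b : Test} {c : Program} {σ : State} (I : State → Prop) (Φ : State → ℕ)
    (hI : I σ)
    (hstep : ∀ σ', I σ' → Frame c σ σ' → b.Holds σ' →
      Runs c σ' fun σ'' t => I σ'' ∧ b.cost + 1 + t + Φ σ'' ≤ Φ σ') :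
    Runs (.loop b c) σ fun σ' t =>
      I σ' ∧ ¬ b.Holds σ' ∧ t + Φ σ' ≤ Φ σ + (b.cost + 1) := by
  -- Induction on a bound for the potential, which drops strictly in each iteration since evaluating
  -- the test takes time.
  suffices ∀ k σ', Φ σ' ≤ k → I σ' → Frame c σ σ' →
      Runs (.loop b c) σ' fun σ'' t =>
        I σ'' ∧ ¬ b.Holds σ'' ∧ t + Φ σ'' ≤ Φ σ' + (b.cost + 1) from
    this _ σ le_rfl hI (.refl _ _)
  intro k
  induction k with
  | zero =>
    intro σ' hk hI hF
    by_cases hb : b.Holds σ'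
    · obtain ⟨σ'', t, he, -, ht⟩ := hstep σ' hI hF hb
      omega
    · exact ⟨σ', _, .loop_false hb, hI, hb, by omega⟩
  | succ k ih =>
    intro σ' hk hI hF
    by_cases hb : b.Holds σ'
    · obtain ⟨σ'', t, he, hI', ht⟩ := hstep σ' hI hF hb
      obtain ⟨τ, t', he', hI'', hb', ht'⟩ := ih σ'' (by omega) hI' (hF.trans he.frame)
      exact ⟨τ, _, .loop_true hb he he', hI'', hb', by omega⟩
    · exact ⟨σ', _, .loop_false hb, hI, hb, by omega⟩

end RealRAM

/-! ## Tournament trees -/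

/-- `p` is a leaf below the node `i` of the tournament tree with leaves `N, …, 2 * N - 1`. -/
def Below (N i p : ℕ) : Prop := ∃ k, (N + p) / 2 ^ k = i

/-- Every node of the tree holds a leaf below it. -/
def TreeShape (N : ℕ) (t : ℕ → ℕ) : Prop :=
  ∀ i, 1 ≤ i → i < 2 * N → t i < N ∧ Below N i (t i)

/-- Node `i` of the tree holds an active leaf of minimal key, if there is an active leaf below. -/
def TreeMin (N : ℕ) (t act : ℕ → ℕ) (key : ℕ → ℝ) (i : ℕ) : Prop :=
  ∀ p < N, Below N i p → act p = 1 → act (t i) = 1 ∧ key (t i) ≤ key p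

/-- The tournament tree is correct. -/
structure TreeInv (N : ℕ) (t act : ℕ → ℕ) (key : ℕ → ℝ) : Prop where
  shape : TreeShape N t
  min : ∀ i, 1 ≤ i → i < 2 * N → TreeMin N t act key i

section tree

variable {N i p q : ℕ} {t act : ℕ → ℕ} {key : ℕ → ℝ}

theorem below_leaf_iff (hp : p < N) (hq : q < N) : Below N (N + p) q ↔ q = p := by
  constructor
  · rintro ⟨k, hk⟩
    cases k with
    | zero => simpa using hk
    | succ k =>
      have : (N + q) / 2 ^ (k + 1) ≤ (N + q) / 2 := by
        rw [pow_succ', ← Nat.div_div_eq_div_mul]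
        exact Nat.div_le_self _ _
      omega
  · rintro rfl
    exact ⟨0, by simp⟩

theorem Below.half (h : Below N i p) : Below N (i / 2) p := by
  obtain ⟨k, rfl⟩ := h
  exact ⟨k + 1, by rw [pow_succ, Nat.div_div_eq_div_mul]⟩

theorem Below.child (h : Below N i p) (hi : i < N) : ∃ c, Below N c p ∧ c / 2 = i := by
  obtain ⟨k, rfl⟩ := h
  cases k with
  | zero => simp at hi
  | succ k => exact ⟨_, ⟨k, rfl⟩, by rw [pow_succ, Nat.div_div_eq_div_mul]⟩

/-- Repeated halving ends at the leading binary digit, so `N` need not be a power of two. -/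
theorem below_one (hp : p < N) : Below N 1 p := by
  refine ⟨Nat.log 2 (N + p), Nat.div_eq_of_lt_le ?_ ?_⟩
  · rw [one_mul]
    exact Nat.pow_log_le_self 2 (by omega)
  · have := Nat.lt_pow_succ_log_self one_lt_two (N + p)
    rw [pow_succ] at this
    omega

/-- A sibling of an ancestor of a leaf is no ancestor of it. -/
theorem not_below_sibling {c : ℕ} (h : Below N i p) (hi : 1 ≤ i / 2) (hc : c / 2 = i / 2)
    (hci : c ≠ i) : ¬ Below N c p := by
  obtain ⟨k, rfl⟩ := h
  rintro ⟨l, rfl⟩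
  -- A proper ancestor is at most half of its descendant, whereas siblings have the same positive
  -- half.
  have key : ∀ {a b : ℕ}, a < b → (N + p) / 2 ^ b ≤ (N + p) / 2 ^ a / 2 := by
    intro a b hab
    rw [Nat.div_div_eq_div_mul, ← pow_succ]
    exact Nat.div_le_div_left (Nat.pow_le_pow_right two_pos hab) (by positivity)
  rcases lt_trichotomy k l with h | rfl | h
  · have := key h
    omega
  · exact hci rfl
  · have := key h
    omega

theorem TreeInv.root (h : TreeInv N t act key) (hp : p < N) (ha : act p = 1) :
    act (t 1) = 1 ∧ key (t 1) ≤ key p :=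
  h.min 1 le_rfl (by omega) p hp (below_one hp) ha

theorem TreeShape.treeInv (h : TreeShape N t) (hact : ∀ p < N, act p ≠ 1) :
    TreeInv N t act key :=
  ⟨h, fun _ _ _ p hp _ ha => absurd ha (hact p hp)⟩

/-- A change at leaf `p` affects only the ancestors of `p`. -/
theorem TreeInv.treeMin_of_not_below (h : TreeInv N t act key) {act' : ℕ → ℕ} {key' : ℕ → ℝ}
    (hact : ∀ q, q ≠ p → act' q = act q) (hkey : ∀ q, q ≠ p → key' q = key q) (i : ℕ) (hi : 1 ≤ i)
    (hiN : i < 2 * N) (hp : ¬ Below N i p) : TreeMin N t act' key' i := by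
  intro q hq hb ha
  have h1 : q ≠ p := fun he => hp (he ▸ hb)
  have h2 : t i ≠ p := fun he => hp (he ▸ (h.shape i hi hiN).2)
  rw [hact q h1] at ha
  rw [hact _ h2, hkey _ h2, hkey q h1]
  exact h.min i hi hiN q hq hb ha

theorem TreeShape.update (h : TreeShape N t) {x : ℕ} (hx : x < N ∧ Below N i x) :
    TreeShape N (Function.update t i x) := by
  intro j hj hjN
  by_cases hji : j = i
  · subst hji; simpa using hx
  · rw [Function.update_of_ne hji]; exact h j hj hjN

theorem treeMin_leaf (h : TreeShape N t) (hp : p < N) : TreeMin N t act key (N + p) := by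
  intro q hq hb ha
  have h1 := (below_leaf_iff hp hq).1 hb
  obtain ⟨h2, h3⟩ := h (N + p) (by omega) (by omega)
  rw [(below_leaf_iff hp h2).1 h3, ← h1]
  exact ⟨ha, le_rfl⟩

end tree

/-! ### Programs for the tournament tree -/

namespace RealRAM

notation "𝐧" => NatExp.reg
notation "𝐤" => NatExp.const
notation "𝐚" => NatExp.arr
notation "𝐫" => RealExp.reg
notation "𝐜" => RealExp.const
notation "𝐛" => RealExp.arr
infixl:65 "∔" => NatExp.add
infixl:65 "∸" => NatExp.sub
infixr:30 ";;" => Program.seq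
infix:50 "≔" => Program.setNatReg
infix:50 "≔ᵣ" => Program.setRealReg

/-- Recompute the winner at node `5` of the tree from its children. -/
def treeNode : Program :=
  20 ≔ 𝐚 10 (𝐧 5 ∔ 𝐧 5) ;;
  21 ≔ 𝐚 10 (𝐧 5 ∔ 𝐧 5 ∔ 𝐤 1) ;;
  .cond (.and (.natEq (𝐚 11 (𝐧 20)) (𝐤 1))
      (.not (.and (.natEq (𝐚 11 (𝐧 21)) (𝐤 1)) (.not (.realLe (𝐛 7 (𝐧 20)) (𝐛 7 (𝐧 21)))))))
    (.setNatArr 10 (𝐧 5) (𝐧 20))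
    (.setNatArr 10 (𝐧 5) (𝐧 21))

/-- Repair the tournament tree with `natReg 3` leaves after a change at leaf `natReg 4`. The tree is
in array `10`, the activity flags are in array `11` and the keys in real array `7`. -/
def treeFix : Program :=
  5 ≔ 𝐧 3 ∔ 𝐧 4 ;;
  .loop (.natLt (𝐤 1) (𝐧 5)) (5 ≔ .half (𝐧 5) ;; treeNode)

/-- Initialize the tournament tree with `natReg 3` leaves. -/
def treeInit : Program :=
  5 ≔ 𝐧 3 ∔ 𝐧 3 ;;
  .loop (.natLt (𝐤 1) (𝐧 5))
    (5 ≔ 𝐧 5 ∸ 𝐤 1 ;;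
      .cond (.natLt (𝐧 5) (𝐧 3))
        (.setNatArr 10 (𝐧 5) (𝐚 10 (𝐧 5 ∔ 𝐧 5)))
        (.setNatArr 10 (𝐧 5) (𝐧 5 ∸ 𝐧 3)))

theorem treeInit_runs (σ : State) :
    Runs treeInit σ fun σ' t => TreeShape (σ.natReg 3) (σ'.natArr 10) ∧
      t ≤ 50 * (σ.natReg 3 + 1) := by
  set N := σ.natReg 3 with hN
  rw [treeInit, runs_seq, runs_setNatReg]
  -- The index runs downward, so the children of an inner node are filled before it. With no active
  -- leaf any leaf below will do, and the left child's is copied.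
  refine (Runs.loop (fun τ => τ.natReg 3 = N ∧ τ.natReg 5 ≤ 2 * N ∧
    ∀ i, 1 ≤ i → τ.natReg 5 ≤ i → i < 2 * N → τ.natArr 10 i < N ∧ Below N i (τ.natArr 10 i))
    (fun τ => 25 * τ.natReg 5) ?_ ?_).mono ?_
  · simp [← hN]
    exact ⟨by omega, fun i _ h1 h2 => by omega⟩
  · rintro τ ⟨h3, h5, hinv⟩ - hb
    have hb : 1 < τ.natReg 5 := by simpa using hb
    simp [h3]
    refine ⟨fun hlt => ⟨⟨by omega, fun i hi hle hiN => ?_⟩, by omega⟩,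
      fun hge => ⟨⟨by omega, fun i hi hle hiN => ?_⟩, by omega⟩⟩
    · by_cases h : i = τ.natReg 5 - 1
      · subst h
        rw [Function.update_self]
        have := hinv (τ.natReg 5 - 1 + (τ.natReg 5 - 1)) (by omega) (by omega) (by omega)
        refine ⟨this.1, ?_⟩
        have h2 := this.2.half
        rwa [show (τ.natReg 5 - 1 + (τ.natReg 5 - 1)) / 2 = τ.natReg 5 - 1 by omega] at h2
      · rw [Function.update_of_ne h]
        exact hinv i hi (by omega) hiN
    · by_cases h : i = τ.natReg 5 - 1
      · subst h
        rw [Function.update_self]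
        exact ⟨by omega, 0, by simp; omega⟩
      · rw [Function.update_of_ne h]
        exact hinv i hi (by omega) hiN
  · rintro τ t ⟨⟨h3, h5, hinv⟩, hb, ht⟩
    simp at hb ht
    refine ⟨fun i hi hiN => hinv i hi (by omega) hiN, ?_⟩
    simp
    omega

theorem treeNode_runs (σ : State) :
    Runs treeNode σ fun σ' t => t ≤ 45 ∧ σ'.natReg 5 = σ.natReg 5 ∧ σ'.natReg 3 = σ.natReg 3 ∧
      ∃ x, σ'.natArr 10 = Function.update (σ.natArr 10) (σ.natReg 5) x ∧
      (x = σ.natArr 10 (2 * σ.natReg 5) ∨ x = σ.natArr 10 (2 * σ.natReg 5 + 1)) ∧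
      ∀ y, (y = σ.natArr 10 (2 * σ.natReg 5) ∨ y = σ.natArr 10 (2 * σ.natReg 5 + 1)) →
        σ.natArr 11 y = 1 → σ.natArr 11 x = 1 ∧ σ.realArr 7 x ≤ σ.realArr 7 y := by
  simp [treeNode, ← two_mul]
  constructor
  · intro h1 h2
    exact ⟨_, rfl, Or.inl rfl, fun h => ⟨h, le_rfl⟩, fun h => ⟨h1, h2 h⟩⟩
  · intro h
    refine ⟨_, rfl, Or.inr rfl, fun h1 => ?_, fun h1 => ⟨h1, le_rfl⟩⟩
    obtain ⟨h2, h3⟩ := h h1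
    exact ⟨h2, h3.le⟩

/-- Only the ancestors of the changed leaf can be wrong. They are recomputed from the leaf to the
root; at each of them one child has just been repaired and the other is no ancestor of the leaf,
hence intact. -/
theorem treeFix_runs (σ : State) (hp : σ.natReg 4 < σ.natReg 3)
    (hs : TreeShape (σ.natReg 3) (σ.natArr 10))
    (hmin : ∀ i, 1 ≤ i → i < 2 * σ.natReg 3 → ¬ Below (σ.natReg 3) i (σ.natReg 4) →
      TreeMin (σ.natReg 3) (σ.natArr 10) (σ.natArr 11) (σ.realArr 7) i) :
    Runs treeFix σ fun σ' t =>
      TreeInv (σ.natReg 3) (σ'.natArr 10) (σ.natArr 11) (σ.realArr 7) ∧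
      t ≤ 60 * (Nat.log 2 (2 * σ.natReg 3) + 1) := by
  set N := σ.natReg 3 with hN
  set p := σ.natReg 4
  set act := σ.natArr 11
  set key := σ.realArr 7
  rw [treeFix, runs_seq, runs_setNatReg]
  -- Ancestors of `p` are correct from the current node downward, that is, for indices at least that
  -- of the current node.
  refine (Runs.loop (fun τ => 1 ≤ τ.natReg 5 ∧ τ.natReg 5 < 2 * N ∧ Below N (τ.natReg 5) p ∧
      TreeShape N (τ.natArr 10) ∧ ∀ i, 1 ≤ i → i < 2 * N →
        (Below N i p → τ.natReg 5 ≤ i) → TreeMin N (τ.natArr 10) act key i)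
    (fun τ => 55 * Nat.log 2 (τ.natReg 5)) ?_ ?_).mono ?_
  · simp only [State.setNatReg_natReg, State.setNatReg_natArr, NatExp.eval, if_true, ← hN]
    refine ⟨by omega, by omega, ⟨0, by simp; rfl⟩, hs, fun i hi hiN hb => ?_⟩
    by_cases hbi : Below N i p
    · obtain ⟨k, hk⟩ := hbi
      have h1 : i = N + p := by
        have := hk ▸ Nat.div_le_self (N + p) (2 ^ k)
        exact le_antisymm this (hb ⟨k, hk⟩)
      rw [h1]
      exact treeMin_leaf hs hp
    · exact hmin i hi hiN hbi
  · rintro τ ⟨h1, h2, h3, h4, h5⟩ hF hb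
    have hb : 1 < τ.natReg 5 := by simpa using hb
    have hact : τ.natArr 11 = act := by
      rw [hF.natArr 11 (by decide)]; rfl
    have hkey : τ.realArr 7 = key := by
      rw [hF.realArr 7 (by decide)]; rfl
    rw [runs_seq, runs_setNatReg]
    refine (treeNode_runs _).then ?_
    rintro τ' t hF' ⟨ht, h6, -, x, h7, h8, h9⟩
    have hhalf : τ.natReg 5 / 2 < N := by omega
    set i := τ.natReg 5 / 2 with hi
    have e5 : (τ.setNatReg 5 ((NatExp.half (𝐧 5)).eval τ)).natReg 5 = i := by simp [hi]
    simp only [e5, State.setNatReg_natArr, State.setNatReg_realArr, hact, hkey] at h6 h7 h8 h9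
    have hx : x < N ∧ Below N i x := by
      rcases h8 with rfl | rfl
      · have := h4 (2 * i) (by omega) (by omega)
        refine ⟨this.1, ?_⟩
        have := this.2.half
        rwa [show 2 * i / 2 = i by omega] at this
      · have := h4 (2 * i + 1) (by omega) (by omega)
        refine ⟨this.1, ?_⟩
        have := this.2.half
        rwa [show (2 * i + 1) / 2 = i by omega] at this
    have hchild : ∀ c, c / 2 = i → TreeMin N (τ.natArr 10) act key c := by
      intro c hc
      refine h5 c (by omega) (by omega) fun hbc => ?_
      by_contra hlt
      exact not_below_sibling h3 (by omega) (by omega) (by omega) hbc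
    rw [h6, h7]
    refine ⟨⟨by omega, by omega, h3.half, h4.update hx, ?_⟩, ?_⟩
    · intro j hj hjN hjb
      by_cases hji : j = i
      · intro q hq hbq ha
        rw [hji] at hbq ⊢
        rw [Function.update_self]
        obtain ⟨c, hcq, hc⟩ := hbq.child hhalf
        obtain ⟨h10, h11⟩ := hchild c hc q hq hcq ha
        have h12 : τ.natArr 10 c = τ.natArr 10 (2 * i) ∨
            τ.natArr 10 c = τ.natArr 10 (2 * i + 1) := by
          rcases (show c = 2 * i ∨ c = 2 * i + 1 by omega) with rfl | rfl <;> simp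
        obtain ⟨h13, h14⟩ := h9 _ h12 h10
        exact ⟨h13, h14.trans h11⟩
      -- No ancestor of `p` lies strictly between a node on the path and its half, so an ancestor `j
      -- ≥ i` other than `i` was treated before.
      · have := h5 j hj hjN fun hbj => by
          have h10 := hjb hbj
          by_contra hlt
          have h11 : j ≠ τ.natReg 5 := by omega
          obtain ⟨k, hk⟩ := h3
          obtain ⟨l, hl⟩ := hbj
          have key : ∀ {a b : ℕ}, a < b → (N + p) / 2 ^ b ≤ (N + p) / 2 ^ a / 2 := by
            intro a b hab
            rw [Nat.div_div_eq_div_mul, ← pow_succ]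
            exact Nat.div_le_div_left (Nat.pow_le_pow_right two_pos hab) (by positivity)
          rcases lt_trichotomy k l with h | rfl | h
          · have := key h
            omega
          · omega
          · have := key h
            omega
        intro q hq hbq ha
        rw [Function.update_of_ne hji]
        exact this q hq hbq ha
    · simp
      rw [Nat.log_of_one_lt_of_le one_lt_two hb, ← hi]
      omega
  · rintro τ t ⟨⟨h1, h2, h3, h4, h5⟩, hb, ht⟩
    have hb : τ.natReg 5 ≤ 1 := by simpa using hb
    refine ⟨⟨h4, fun i hi hiN => h5 i hi hiN fun _ => by omega⟩, ?_⟩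
    have hlog : Nat.log 2 (N + p) ≤ Nat.log 2 (2 * N) := Nat.log_mono_right (by omega)
    have e5 : (NatExp.add (𝐧 3) (𝐧 4)).eval σ = N + p := rfl
    simp only [State.setNatReg_natReg, if_true, e5, Test.cost, NatExp.cost] at ht ⊢
    omega

end RealRAM

/-! ### The tournament tree as a priority queue -/

namespace RealRAM

/-- Activate leaf `natReg 4`, whose key may have been changed. -/
def treePush : Program :=
  .setNatArr 11 (𝐧 4) (𝐤 1) ;; treeFix

/-- Remove an active leaf of minimal key and put it into `natReg 4`. -/
def treePop : Program :=
  4 ≔ 𝐚 10 (𝐤 1) ;; .setNatArr 11 (𝐧 4) (𝐤 0) ;; treeFix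

/-- The function `key` holds the keys before the caller overwrote the one of the pushed leaf: the
tree is known to be correct only for these. -/
theorem treePush_runs {σ : State} {key : ℕ → ℝ} (hp : σ.natReg 4 < σ.natReg 3)
    (hinv : TreeInv (σ.natReg 3) (σ.natArr 10) (σ.natArr 11) key)
    (hkey : ∀ q, q ≠ σ.natReg 4 → σ.realArr 7 q = key q) :
    Runs treePush σ fun σ' t =>
      σ'.natArr 11 = Function.update (σ.natArr 11) (σ.natReg 4) 1 ∧
      TreeInv (σ.natReg 3) (σ'.natArr 10) (σ'.natArr 11) (σ.realArr 7) ∧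
      t ≤ 60 * (Nat.log 2 (2 * σ.natReg 3) + 1) + 10 := by
  rw [treePush, runs_seq, runs_setNatArr]
  refine (treeFix_runs _ ?_ ?_ ?_).then ?_
  · simpa using hp
  · simpa using hinv.shape
  · simp only [State.setNatArr_natReg, State.setNatArr_natArr, State.setNatArr_realArr]
    exact hinv.treeMin_of_not_below (fun q hq => by simp [hq]) hkey
  · rintro σ' t hF ⟨h1, h2⟩
    have h3 : σ'.natArr 11 = Function.update (σ.natArr 11) (σ.natReg 4) 1 := by
      rw [hF.natArr 11 (by decide)]; simp
    refine ⟨h3, ?_, ?_⟩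
    · rw [h3]; simpa using h1
    · simp at h2 ⊢
      omega

theorem treePop_runs {σ : State} {p : ℕ} (hp : p < σ.natReg 3) (ha : σ.natArr 11 p = 1)
    (hinv : TreeInv (σ.natReg 3) (σ.natArr 10) (σ.natArr 11) (σ.realArr 7)) :
    Runs treePop σ fun σ' t =>
      σ'.natReg 4 = σ.natArr 10 1 ∧ σ'.natReg 4 < σ.natReg 3 ∧ σ.natArr 11 (σ'.natReg 4) = 1 ∧
      (∀ q < σ.natReg 3, σ.natArr 11 q = 1 → σ.realArr 7 (σ'.natReg 4) ≤ σ.realArr 7 q) ∧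
      σ'.natArr 11 = Function.update (σ.natArr 11) (σ'.natReg 4) 0 ∧
      TreeInv (σ.natReg 3) (σ'.natArr 10) (σ'.natArr 11) (σ.realArr 7) ∧
      t ≤ 60 * (Nat.log 2 (2 * σ.natReg 3) + 1) + 10 := by
  rw [treePop, runs_seq, runs_setNatReg, runs_seq, runs_setNatArr]
  have hlt : σ.natArr 10 1 < σ.natReg 3 := (hinv.shape 1 le_rfl (by omega)).1
  refine (treeFix_runs _ ?_ ?_ ?_).then ?_
  · simpa using hlt
  · simpa using hinv.shape
  · simp
    exact hinv.treeMin_of_not_below (fun q hq => by simp [hq]) (fun _ _ => rfl)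
  · rintro σ' t hF ⟨h1, h2⟩
    have h3 : σ'.natArr 11 = Function.update (σ.natArr 11) (σ.natArr 10 1) 0 := by
      rw [hF.natArr 11 (by decide)]; simp
    have h4 : σ'.natReg 4 = σ.natArr 10 1 := by
      rw [hF.natReg 4 (by decide)]; simp
    simp only [h4, h3]
    refine ⟨trivial, hlt, (hinv.root hp ha).1, fun q hq haq => (hinv.root hq haq).2, trivial,
      ?_, ?_⟩
    · simpa using h1
    · simp at h2 ⊢
      omega

/-! ### Insertion into the envelope of a node -/

/-- Remove the redundant lines at the end of the envelope that starts at `natReg 8` and has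
`natReg 9` lines, before the line with slope `realReg 0` and offset `realReg 1` is added. -/
def hullPops : Program :=
  .loop (.and (.natLt (𝐤 0) (𝐧 9))
      (.not (.and (.not (.realLe (𝐛 5 (𝐧 8 ∔ (𝐧 9 ∸ 𝐤 1))) (𝐫 0)))
        (.not (.and (.natLt (𝐤 1) (𝐧 9))
          (.realLe
            (.mul (.sub (𝐫 1) (𝐛 6 (𝐧 8 ∔ (𝐧 9 ∸ 𝐤 1))))
              (.sub (𝐛 5 (𝐧 8 ∔ (𝐧 9 ∸ 𝐤 2))) (𝐛 5 (𝐧 8 ∔ (𝐧 9 ∸ 𝐤 1)))))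
            (.mul (.sub (𝐛 6 (𝐧 8 ∔ (𝐧 9 ∸ 𝐤 1))) (𝐛 6 (𝐧 8 ∔ (𝐧 9 ∸ 𝐤 2))))
              (.sub (𝐛 5 (𝐧 8 ∔ (𝐧 9 ∸ 𝐤 1))) (𝐫 0)))))))))
    (9 ≔ 𝐧 9 ∸ 𝐤 1)

/-- Insert the line with slope `realReg 0` and offset `realReg 1` into the envelope of
node `natReg 6`. -/
def hullInsert : Program :=
  9 ≔ 𝐚 7 (𝐧 6) ;;
  .cond (.and (.natLt (𝐤 0) (𝐧 9)) (.and (.realLe (𝐛 5 (𝐧 8 ∔ (𝐧 9 ∸ 𝐤 1))) (𝐫 0))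
      (.realLe (𝐛 6 (𝐧 8 ∔ (𝐧 9 ∸ 𝐤 1))) (𝐫 1))))
    .skip
    (hullPops ;;
      .setRealArr 5 (𝐧 8 ∔ 𝐧 9) (𝐫 0) ;;
      .setRealArr 6 (𝐧 8 ∔ 𝐧 9) (𝐫 1) ;;
      .setNatArr 7 (𝐧 6) (𝐧 9 ∔ 𝐤 1))

theorem hullPops_runs {σ : State} {X : Set (ℝ × ℝ)} (hX : ∀ x ∈ X, σ.realReg 0 ≤ x.1)
    (he : IsPartialEnvelope X (σ.realReg 0) (σ.realReg 1) (fun j => σ.realArr 5 (σ.natReg 8 + j))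
      (fun j => σ.realArr 6 (σ.natReg 8 + j)) (σ.natReg 9)) :
    Runs hullPops σ fun σ' t =>
      IsPartialEnvelope X (σ.realReg 0) (σ.realReg 1) (fun j => σ.realArr 5 (σ.natReg 8 + j))
        (fun j => σ.realArr 6 (σ.natReg 8 + j)) (σ'.natReg 9) ∧
      ¬ LastRedundant (fun j => σ.realArr 5 (σ.natReg 8 + j))
        (fun j => σ.realArr 6 (σ.natReg 8 + j)) (σ'.natReg 9) (σ.realReg 0) (σ.realReg 1) ∧
      σ'.natReg 9 ≤ σ.natReg 9 ∧ t + 100 * σ'.natReg 9 ≤ 100 * σ.natReg 9 + 80 := by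
  -- The redundancy condition in the shape that simplification gives to the loop test, with an
  -- implication in place of the disjunction.
  have hiff : ∀ τ : State, ((0 < τ.natReg 9 ∧ (σ.realReg 0 < σ.realArr 5 (σ.natReg 8 + (τ.natReg 9 - 1)) →
        1 < τ.natReg 9 ∧ (σ.realReg 1 - σ.realArr 6 (σ.natReg 8 + (τ.natReg 9 - 1))) *
          (σ.realArr 5 (σ.natReg 8 + (τ.natReg 9 - 2)) -
            σ.realArr 5 (σ.natReg 8 + (τ.natReg 9 - 1))) ≤
          (σ.realArr 6 (σ.natReg 8 + (τ.natReg 9 - 1)) -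
            σ.realArr 6 (σ.natReg 8 + (τ.natReg 9 - 2))) *
          (σ.realArr 5 (σ.natReg 8 + (τ.natReg 9 - 1)) - σ.realReg 0))) ↔
      LastRedundant (fun j => σ.realArr 5 (σ.natReg 8 + j))
        (fun j => σ.realArr 6 (σ.natReg 8 + j)) (τ.natReg 9) (σ.realReg 0) (σ.realReg 1)) := by
    intro τ
    simp only [LastRedundant, or_iff_not_imp_left, not_le]
  have hfr : ∀ τ : State, Frame hullPops σ τ → τ.natReg 8 = σ.natReg 8 ∧
      τ.realReg = σ.realReg ∧ τ.realArr = σ.realArr := fun τ hF =>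
    ⟨hF.natReg 8 (by decide), funext fun r => hF.realReg r (by simp [hullPops]),
      funext fun r => hF.realArr r (by simp [hullPops])⟩
  refine (Runs.loop (fun τ => τ.natReg 9 ≤ σ.natReg 9 ∧ IsPartialEnvelope X (σ.realReg 0)
    (σ.realReg 1) (fun j => σ.realArr 5 (σ.natReg 8 + j))
        (fun j => σ.realArr 6 (σ.natReg 8 + j)) (τ.natReg 9)) (fun τ => 100 * τ.natReg 9)
        ⟨le_rfl, he⟩ ?_).then ?_
  · rintro τ ⟨h1, h2⟩ hF hb
    obtain ⟨f1, f2, f3⟩ := hfr τ (hF.weaken (.refl _) (.refl _) (.refl _) (.refl _))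
    have hb' : LastRedundant (fun j => σ.realArr 5 (σ.natReg 8 + j))
        (fun j => σ.realArr 6 (σ.natReg 8 + j)) (τ.natReg 9) (σ.realReg 0) (σ.realReg 1) := by
      rw [← hiff τ]
      simpa [f1, f2, f3] using hb
    have := hb'.1
    simp
    refine ⟨⟨by omega, h2.pop hX hb'⟩, by omega⟩
  · rintro τ t hF ⟨⟨h1, h2⟩, hb, ht⟩
    obtain ⟨f1, f2, f3⟩ := hfr τ hF
    refine ⟨h2, fun hr => hb ?_, h1, ?_⟩
    · rw [← hiff τ] at hr
      simpa [f1, f2, f3] using hr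
    · simp at ht
      omega

/-- The time bound is amortized: an insertion adds at most one line, and removals are paid for by
100 units stored with every line of the chain. The excluded range of `i` ends one cell past the old
chain, where a line that causes no removal is appended. -/
theorem hullInsert_runs {σ : State} {X : Set (ℝ × ℝ)} (hX : ∀ x ∈ X, σ.realReg 0 ≤ x.1)
    (he : IsEnvelope X (fun j => σ.realArr 5 (σ.natReg 8 + j))
      (fun j => σ.realArr 6 (σ.natReg 8 + j)) (σ.natArr 7 (σ.natReg 6))) :
    Runs hullInsert σ fun σ' t => ∃ c,
      σ'.natArr 7 = Function.update (σ.natArr 7) (σ.natReg 6) c ∧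
      IsEnvelope (insert (σ.realReg 0, σ.realReg 1) X) (fun j => σ'.realArr 5 (σ.natReg 8 + j))
        (fun j => σ'.realArr 6 (σ.natReg 8 + j)) c ∧
      c ≤ σ.natArr 7 (σ.natReg 6) + 1 ∧
      (∀ i, i < σ.natReg 8 ∨ σ.natReg 8 + σ.natArr 7 (σ.natReg 6) < i →
        σ'.realArr 5 i = σ.realArr 5 i ∧ σ'.realArr 6 i = σ.realArr 6 i) ∧
      t + 100 * c ≤ 100 * σ.natArr 7 (σ.natReg 6) + 300 := by
  rw [hullInsert, runs_seq, runs_setNatReg, runs_cond]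
  constructor
  · intro hb
    simp at hb
    rw [runs_skip]
    refine ⟨σ.natArr 7 (σ.natReg 6), by simp, ?_, by omega, by simp, ?_⟩
    · simp
      exact he.insert_of_le hX (by omega) hb.2.1 hb.2.2
    · simp
      omega
  · intro hb
    rw [runs_seq]
    have hb' : ¬ (0 < σ.natArr 7 (σ.natReg 6) ∧
        σ.realArr 5 (σ.natReg 8 + (σ.natArr 7 (σ.natReg 6) - 1)) ≤ σ.realReg 0 ∧
        σ.realArr 6 (σ.natReg 8 + (σ.natArr 7 (σ.natReg 6) - 1)) ≤ σ.realReg 1) := by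
      intro h
      exact hb (by simpa using h)
    refine (hullPops_runs (X := X) ?_ ?_).then ?_
    · simpa using hX
    · simpa using he.isPartialEnvelope hb'
    · rintro τ t hF ⟨h1, h2, h3, h4⟩
      have f1 : τ.natReg 8 = σ.natReg 8 := hF.natReg 8 (by decide)
      have f2 : τ.natReg 6 = σ.natReg 6 := hF.natReg 6 (by decide)
      have f3 : τ.realArr = σ.realArr := funext fun r => hF.realArr r (by simp [hullPops])
      have f4 : τ.natArr = σ.natArr := funext fun r => hF.natArr r (by simp [hullPops])
      have f5 : τ.realReg = σ.realReg := funext fun r => hF.realReg r (by simp [hullPops])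
      simp only [State.setNatReg_natReg, State.setNatReg_realReg, State.setNatReg_realArr,
        NatExp.eval, if_true] at h1 h2 h3 h4
      norm_num at h1 h2
      simp [f1, f2, f3, f4, f5]
      refine ⟨τ.natReg 9 + 1, rfl, ?_, by omega, ?_, by omega⟩
      · refine h1.push h2 ?_ ?_ ?_ ?_
        · intro j hj; simp [hj.ne]
        · intro j hj; simp [hj.ne]
        · simp
        · simp
      · intro i hi
        have : i ≠ σ.natReg 8 + τ.natReg 9 := by omega
        simp [this]

end RealRAM

/-! ### Adjacency lists and envelopes in memory -/

namespace RealRAM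

open ImpreciseTerrain

/-- The memory holds the terrain. -/
structure InputData {m n : ℕ} (T : ImpreciseTerrain (Fin m)) (src dst : Fin n → Fin m)
    (σ : State) : Prop where
  nodes : σ.natReg 0 = m
  edges : σ.natReg 1 = n
  src : ∀ e : Fin n, σ.natArr 0 e = src e
  dst : ∀ e : Fin n, σ.natArr 1 e = dst e
  x : ∀ v : Fin m, σ.realArr 0 v = T.pos v 0
  y : ∀ v : Fin m, σ.realArr 1 v = T.pos v 1
  low : ∀ v : Fin m, σ.realArr 2 v = T.low v
  high : ∀ v : Fin m, σ.realArr 3 v = T.high v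

/-- The program does not write to the cells of the input. -/
abbrev Program.KeepsInput (c : Program) : Prop :=
  (∀ r ∈ [0, 1], r ∉ c.natRegs) ∧ (∀ a ∈ [0, 1], a ∉ c.natArrs) ∧
    ∀ a ∈ [0, 1, 2, 3], a ∉ c.realArrs

theorem InputData.frame {m n : ℕ} {T : ImpreciseTerrain (Fin m)} {src dst : Fin n → Fin m}
    {σ σ' : State} {c : Program} (h : InputData T src dst σ) (hF : Frame c σ σ')
    (hc : c.KeepsInput) : InputData T src dst σ' where
  nodes := (hF.natReg 0 (hc.1 0 (by simp))).trans h.nodes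
  edges := (hF.natReg 1 (hc.1 1 (by simp))).trans h.edges
  src e := by rw [hF.natArr 0 (hc.2.1 0 (by simp))]; exact h.src e
  dst e := by rw [hF.natArr 1 (hc.2.1 1 (by simp))]; exact h.dst e
  x e := by rw [hF.realArr 0 (hc.2.2 0 (by simp))]; exact h.x e
  y e := by rw [hF.realArr 1 (hc.2.2 1 (by simp))]; exact h.y e
  low e := by rw [hF.realArr 2 (hc.2.2 2 (by simp))]; exact h.low e
  high e := by rw [hF.realArr 3 (hc.2.2 3 (by simp))]; exact h.high e

/-- The memory holds adjacency lists and envelopes for the adjacency relation `N`. The data of node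
`v` is stored from index `v * n` on. -/
structure AdjData {m : ℕ} (T : ImpreciseTerrain (Fin m)) (n : ℕ) (N : Fin m → Fin m → Prop)
    (σ : State) : Prop where
  base : ∀ v : Fin m, σ.natArr 4 v = v * n
  deg_le : ∀ v : Fin m, σ.natArr 5 v ≤ n
  count_le : ∀ v : Fin m, σ.natArr 7 v ≤ σ.natArr 5 v
  nbr : ∀ (v : Fin m) (j : ℕ), j < σ.natArr 5 v → ∃ w : Fin m, N v w ∧
    σ.natArr 6 (v * n + j) = w ∧ σ.realArr 4 (v * n + j) = dist (T.pos v) (T.pos w)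
  exists_nbr : ∀ v w : Fin m, N v w → ∃ j < σ.natArr 5 v, σ.natArr 6 (v * n + j) = w
  envelope : ∀ v : Fin m, IsEnvelope (T.linesAt (N v) v) (fun j => σ.realArr 5 (v * n + j))
    (fun j => σ.realArr 6 (v * n + j)) (σ.natArr 7 v)

/-- Segments of `n` cells for different nodes do not overlap. The address range is quadratic, but
only accesses cost time and unused cells are never initialized. -/
theorem segment_disjoint {n v w i j : ℕ} (h : v ≠ w) (hi : i < n) (hj : j < n) :
    v * n + i < w * n ∨ w * n + j < v * n + i := by
  rcases lt_or_gt_of_ne h with h | h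
  · have := Nat.mul_le_mul_right n (Nat.succ_le_of_lt h)
    rw [Nat.succ_mul] at this
    omega
  · have := Nat.mul_le_mul_right n (Nat.succ_le_of_lt h)
    rw [Nat.succ_mul] at this
    omega

/-- Add node `natReg 7`, at distance `realReg 0`, to the neighbors of node `natReg 6`. -/
def addHalfEdge : Program :=
  1 ≔ᵣ 𝐛 3 (𝐧 7) ;;
  8 ≔ 𝐚 4 (𝐧 6) ;;
  .setNatArr 6 (𝐧 8 ∔ 𝐚 5 (𝐧 6)) (𝐧 7) ;;
  .setRealArr 4 (𝐧 8 ∔ 𝐚 5 (𝐧 6)) (𝐫 0) ;;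
  .setNatArr 5 (𝐧 6) (𝐚 5 (𝐧 6) ∔ 𝐤 1) ;;
  hullInsert

/-- The hypothesis `hmin` expresses that edges arrive by decreasing length, so the new line has the
smallest slope, as required for appending it to the envelope. -/
theorem addHalfEdge_runs {m n : ℕ} {T : ImpreciseTerrain (Fin m)} {N : Fin m → Fin m → Prop}
    {σ : State} {v w : Fin m} (h : AdjData T n N σ) (h6 : σ.natReg 6 = v) (h7 : σ.natReg 7 = w)
    (h0 : σ.realReg 0 = dist (T.pos v) (T.pos w)) (hhigh : σ.realArr 3 w = T.high w)
    (hdeg : σ.natArr 5 v < n)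
    (hmin : ∀ r, N v r → dist (T.pos v) (T.pos w) ≤ dist (T.pos v) (T.pos r)) :
    Runs addHalfEdge σ fun σ' t =>
      AdjData T n (fun a b => N a b ∨ a = v ∧ b = w) σ' ∧
      σ'.natArr 5 = Function.update (σ.natArr 5) v (σ.natArr 5 v + 1) ∧
      ∃ c, σ'.natArr 7 = Function.update (σ.natArr 7) v c ∧
        t + 100 * c ≤ 100 * σ.natArr 7 v + 400 := by
  have hcount := h.count_le v
  simp only [addHalfEdge, runs_seq, runs_setNatReg, runs_setRealReg, runs_setNatArr,
    runs_setRealArr]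
  refine (hullInsert_runs (X := T.linesAt (N v) v) ?_ ?_).then ?_
  · rintro x ⟨r, hr, rfl⟩
    simpa [h0] using hmin r hr
  · have := h.envelope v
    simpa [h6, h.base] using this
  · rintro σ' t hF ⟨c, g7, genv, gc, gfr, gt⟩
    simp [h6, h7, h0, hhigh, h.base] at g7 genv gc gfr gt
    have g5 : σ'.natArr 5 = Function.update (σ.natArr 5) v (σ.natArr 5 v + 1) := by
      rw [hF.natArr 5 (by decide)]; simp [h6]
    have g6 : σ'.natArr 6 = Function.update (σ.natArr 6) (v * n + σ.natArr 5 v) w := by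
      rw [hF.natArr 6 (by decide)]; simp [h6, h7, h.base]
    have g4 : σ'.realArr 4 =
        Function.update (σ.realArr 4) (v * n + σ.natArr 5 v) (dist (T.pos v) (T.pos w)) := by
      rw [hF.realArr 4 (by decide)]; simp [h6, h0, h.base]
    have gb : σ'.natArr 4 = σ.natArr 4 := by
      rw [hF.natArr 4 (by decide)]; simp
    have hne : ∀ (a : Fin m), a ≠ v → (a : ℕ) ≠ v := fun a ha he => ha (Fin.ext he)
    refine ⟨⟨?_, ?_, ?_, ?_, ?_, ?_⟩, g5, c, g7, ?_⟩
    · simpa [gb] using h.base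
    · intro a
      by_cases ha : a = v
      · subst ha; simp [g5]; omega
      · simpa [g5, hne a ha] using h.deg_le a
    · intro a
      by_cases ha : a = v
      · subst ha; simp [g5, g7]; omega
      · simpa [g5, g7, hne a ha] using h.count_le a
    · intro a j hj
      by_cases ha : a = v
      · subst ha
        by_cases hj' : j = σ.natArr 5 a
        · subst hj'
          exact ⟨w, Or.inr ⟨rfl, rfl⟩, by simp [g6], by simp [g4]⟩
        · simp [g5] at hj
          obtain ⟨r, hr, hr6, hr4⟩ := h.nbr a j (by omega)
          exact ⟨r, Or.inl hr, by simpa [g6, hj'] using hr6, by simpa [g4, hj'] using hr4⟩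
      · rw [g5, Function.update_of_ne (hne a ha)] at hj
        obtain ⟨r, hr, hr6, hr4⟩ := h.nbr a j hj
        have hj' := segment_disjoint (hne a ha) (hj.trans_le (h.deg_le a)) hdeg
        have hj' : (a : ℕ) * n + j ≠ v * n + σ.natArr 5 v := by omega
        exact ⟨r, Or.inl hr, by simpa [g6, hj'] using hr6, by simpa [g4, hj'] using hr4⟩
    · rintro a b (hab | ⟨rfl, rfl⟩)
      · obtain ⟨j, hj, hjb⟩ := h.exists_nbr a b hab
        refine ⟨j, ?_, ?_⟩
        · by_cases ha : a = v
          · subst ha; simp [g5]; omega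
          · simpa [g5, hne a ha] using hj
        · have hj' : (a : ℕ) * n + j ≠ v * n + σ.natArr 5 v := by
            by_cases ha : a = v
            · subst ha; omega
            · have hj' := segment_disjoint (hne a ha) (hj.trans_le (h.deg_le a)) hdeg
              omega
          simpa [g6, hj'] using hjb
      · exact ⟨σ.natArr 5 a, by simp [g5], by simp [g6]⟩
    · intro a
      by_cases ha : a = v
      · subst ha
        have hset : T.linesAt (fun b => N a b ∨ a = a ∧ b = w) a =
            insert (dist (T.pos a) (T.pos w), T.high w) (T.linesAt (N a) a) := by
          ext x
          simp only [linesAt, Set.mem_insert_iff, true_and]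
          constructor
          · rintro ⟨r, hr | rfl, rfl⟩
            · exact Or.inr ⟨r, hr, rfl⟩
            · exact Or.inl rfl
          · rintro (rfl | ⟨r, hr, rfl⟩)
            · exact ⟨w, Or.inr rfl, rfl⟩
            · exact ⟨r, Or.inl hr, rfl⟩
        rw [hset, g7, Function.update_self]
        exact genv
      · have hset : T.linesAt (fun b => N a b ∨ a = v ∧ b = w) a = T.linesAt (N a) a := by
          simp [ha]
        rw [hset, g7, Function.update_of_ne (hne a ha)]
        have hseg : ∀ j < σ.natArr 7 a, (a : ℕ) * n + j < v * n ∨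
            v * n + σ.natArr 7 v < a * n + j := fun j hj =>
          segment_disjoint (hne a ha) (hj.trans_le ((h.count_le a).trans (h.deg_le a)))
            (hcount.trans_lt hdeg)
        exact (h.envelope a).congr (fun j hj => (gfr _ (hseg j hj)).1)
          (fun j hj => (gfr _ (hseg j hj)).2)
    · simp
      omega

end RealRAM

/-! ### Segment addresses and the queue of edges -/

namespace RealRAM

open ImpreciseTerrain

/-- Compute the start of the segment of every node. -/
def initBase : Program :=
  2 ≔ 𝐤 0 ;;
  8 ≔ 𝐤 0 ;;
  .loop (.natLt (𝐧 2) (𝐧 0)) (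
    .setNatArr 4 (𝐧 2) (𝐧 8) ;;
    8 ≔ 𝐧 8 ∔ 𝐧 1 ;;
    2 ≔ 𝐧 2 ∔ 𝐤 1)

/-- The addresses `v * n` are accumulated by additions, since the machine cannot multiply natural
numbers. -/
theorem initBase_runs (σ : State) :
    Runs initBase σ fun σ' t =>
      (∀ v < σ.natReg 0, σ'.natArr 4 v = v * σ.natReg 1) ∧ t ≤ 30 * (σ.natReg 0 + 1) := by
  set m := σ.natReg 0 with hm
  set n := σ.natReg 1 with hn
  simp only [initBase, runs_seq, runs_setNatReg]
  refine (Runs.loop (fun τ => τ.natReg 0 = m ∧ τ.natReg 1 = n ∧ τ.natReg 2 ≤ m ∧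
    τ.natReg 8 = τ.natReg 2 * n ∧ ∀ v < τ.natReg 2, τ.natArr 4 v = v * n)
    (fun τ => 20 * (m - τ.natReg 2)) ?_ ?_).mono ?_
  · simp [← hm, ← hn]
  · rintro τ ⟨h0, h1, h2, h8, h4⟩ - hb
    have hb : τ.natReg 2 < m := by simpa [h0] using hb
    simp [h0, h1, h8]
    refine ⟨⟨by omega, by ring, fun v hv => ?_⟩, by omega⟩
    by_cases hv' : v = τ.natReg 2
    · simp [hv']
    · simp [hv']
      exact h4 v (by omega)
  · rintro τ t ⟨⟨h0, h1, h2, h8, h4⟩, hb, ht⟩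
    have hb : m ≤ τ.natReg 2 := by simpa [h0] using hb
    simp at ht ⊢
    exact ⟨fun v hv => h4 v (by omega), by omega⟩

/-- The coordinate in array `a` of one end of edge `natReg 2` minus that of the other end. -/
def edgeDiff (a : ℕ) : RealExp :=
  .sub (𝐛 a (𝐚 0 (𝐧 2))) (𝐛 a (𝐚 1 (𝐧 2)))

/-- Put the edges into the tournament tree, the longest one with highest priority. -/
def initEdges : Program :=
  3 ≔ 𝐧 1 ;;
  treeInit ;;
  2 ≔ 𝐤 0 ;;
  .loop (.natLt (𝐧 2) (𝐧 1)) (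
    .setRealArr 7 (𝐧 2) (.sub (𝐜 0)
      (.sqrt (.add (.mul (edgeDiff 0) (edgeDiff 0)) (.mul (edgeDiff 1) (edgeDiff 1))))) ;;
    4 ≔ 𝐧 2 ;;
    treePush ;;
    2 ≔ 𝐧 2 ∔ 𝐤 1)

theorem dist_eq_sqrt (p q : EuclideanSpace ℝ (Fin 2)) :
    dist p q = √((p 0 - q 0) * (p 0 - q 0) + (p 1 - q 1) * (p 1 - q 1)) := by
  rw [EuclideanSpace.dist_eq, Fin.sum_univ_two]
  simp only [Real.dist_eq, sq, abs_mul_abs_self]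

/-- Time for one operation on a tournament tree with `N` leaves. -/
def treeTime (N : ℕ) : ℕ := 60 * (Nat.log 2 (2 * N) + 1) + 10

theorem initEdges_runs {m n : ℕ} {T : ImpreciseTerrain (Fin m)} {src dst : Fin n → Fin m}
    {σ : State} (hσ : InputData T src dst σ) (hact : ∀ p, σ.natArr 11 p = 0) :
    Runs initEdges σ fun σ' t =>
      TreeInv n (σ'.natArr 10) (σ'.natArr 11) (σ'.realArr 7) ∧ σ'.natReg 3 = n ∧
      (∀ e : Fin n, σ'.natArr 11 e = 1 ∧
        σ'.realArr 7 e = -dist (T.pos (src e)) (T.pos (dst e))) ∧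
      (∀ p, n ≤ p → σ'.natArr 11 p = 0) ∧
      t ≤ n * (treeTime n + 50) + 50 * (n + 2) := by
  rw [initEdges, runs_seq, runs_setNatReg, runs_seq]
  refine (treeInit_runs _).then ?_
  rintro σ₁ t₁ F₁ ⟨hs, ht₁⟩
  have e3 : (σ.setNatReg 3 ((𝐧 1).eval σ)).natReg 3 = n := by simp [hσ.edges]
  rw [e3] at hs ht₁
  have i1 : InputData T src dst σ₁ :=
    InputData.frame (σ := σ) (c := 3 ≔ 𝐧 1 ;; treeInit) hσ
      ((Exec.frame (.setNatReg σ 3 (𝐧 1))).weaken (by simp) (by simp) (by simp) (by simp)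
        |>.trans (F₁.weaken (by simp) (by simp) (by simp) (by simp))) (by decide)
  have g3 : σ₁.natReg 3 = n := by rw [F₁.natReg 3 (by decide)]; exact e3
  have g11 : ∀ p, σ₁.natArr 11 p = 0 := by
    intro p; rw [F₁.natArr 11 (by decide)]; exact hact p
  rw [runs_seq, runs_setNatReg]
  refine (Runs.loop (fun τ => τ.natReg 2 ≤ n ∧
    TreeInv n (τ.natArr 10) (τ.natArr 11) (τ.realArr 7) ∧
    (∀ e : Fin n, e < τ.natReg 2 → τ.natArr 11 e = 1 ∧
        τ.realArr 7 e = -dist (T.pos (src e)) (T.pos (dst e))) ∧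
      (∀ p, τ.natReg 2 ≤ p → τ.natArr 11 p = 0))
    (fun τ => (treeTime n + 50) * (n - τ.natReg 2)) ?_ ?_).then ?_
  · simp [g11]
    exact hs.treeInv fun p _ => by simp [g11]
  · rintro τ ⟨h2, hT, hedge, hzero⟩ F hb
    have f0 := i1.frame (σ' := τ) (c := 2 ≔ 𝐤 0 ;; .loop (.natLt (𝐧 2) (𝐧 1)) (
      .setRealArr 7 (𝐧 2) (.sub (𝐜 0)
        (.sqrt (.add (.mul (edgeDiff 0) (edgeDiff 0)) (.mul (edgeDiff 1) (edgeDiff 1))))) ;;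
      4 ≔ 𝐧 2 ;; treePush ;; 2 ≔ 𝐧 2 ∔ 𝐤 1))
      (((Exec.frame (.setNatReg σ₁ 2 (𝐤 0))).weaken (by simp) (by simp) (by simp) (by simp)).trans
        (F.weaken (by simp) (by simp) (by simp) (by simp))) (by decide)
    have f3 : τ.natReg 3 = n := by rw [F.natReg 3 (by decide)]; simpa using g3
    have hb : τ.natReg 2 < n := by simpa [f0.edges] using hb
    simp only [runs_seq, runs_setNatReg, runs_setRealArr]
    have hval : ∀ e : Fin n, (e : ℕ) = τ.natReg 2 →
        RealExp.eval τ (.sub (𝐜 0) (.sqrt (.add (.mul (edgeDiff 0) (edgeDiff 0))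
          (.mul (edgeDiff 1) (edgeDiff 1))))) = -dist (T.pos (src e)) (T.pos (dst e)) := by
      intro e he
      simp [edgeDiff, ← he, f0.src, f0.dst, f0.x, f0.y, dist_eq_sqrt]
    refine (treePush_runs (key := τ.realArr 7) ?_ ?_ ?_).then ?_
    · simpa [f3] using hb
    · simpa [f3] using hT
    · intro q hq
      simp at hq ⊢
      simp [hq]
    · rintro τ' t F' ⟨k1, k2, k3⟩
      have k4 : τ'.natReg 2 = τ.natReg 2 := by rw [F'.natReg 2 (by decide)]; simp
      have k5 : τ'.realArr 7 = Function.update (τ.realArr 7) (τ.natReg 2)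
          (RealExp.eval τ (.sub (𝐜 0) (.sqrt (.add (.mul (edgeDiff 0) (edgeDiff 0))
          (.mul (edgeDiff 1) (edgeDiff 1)))))) := by
        rw [F'.realArr 7 (by decide)]; simp
      have k6 : τ'.natArr 11 = Function.update (τ.natArr 11) (τ.natReg 2) 1 := by
        rw [k1]; simp
      refine ⟨⟨?_, ?_, ?_, ?_⟩, ?_⟩
      · simp [k4]; omega
      · have : τ'.realArr 7 = ((τ.setRealArr 7 ((𝐧 2).eval τ) (RealExp.eval τ
          (.sub (𝐜 0) (.sqrt (.add (.mul (edgeDiff 0) (edgeDiff 0))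
          (.mul (edgeDiff 1) (edgeDiff 1))))))).realArr 7) := by
          rw [k5]; simp
        simp only [State.setNatReg_natArr, State.setNatReg_realArr]
        rw [this]
        simpa [f3] using k2
      · intro e he
        simp only [State.setNatReg_natReg, State.setNatReg_natArr, State.setNatReg_realArr, k5, k6,
          NatExp.eval, if_true, k4] at he ⊢
        by_cases hee : (e : ℕ) = τ.natReg 2
        · rw [hval e hee, hee]
          simp
        · simp [hee]
          exact hedge e (by omega)
      · intro p hp
        simp only [State.setNatReg_natReg, State.setNatReg_natArr, k6, NatExp.eval, if_true, k4]
          at hp ⊢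
        rw [Function.update_of_ne (by omega)]
        exact hzero p (by omega)
      · have h7 : (treeTime n + 50) * (n - τ.natReg 2) =
            (treeTime n + 50) * (n - (τ.natReg 2 + 1)) + (treeTime n + 50) := by
          rw [← Nat.mul_succ]; congr 1; omega
        simp [f3, edgeDiff, k4] at k3 ⊢
        rw [h7]
        unfold treeTime
        omega
  · rintro τ t F ⟨⟨h2, hT, hedge, hzero⟩, hb, ht⟩
    have f3 : τ.natReg 3 = n := by rw [F.natReg 3 (by decide)]; simpa using g3
    have f1 : τ.natReg 1 = n := by rw [F.natReg 1 (by decide)]; simpa using i1.edges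
    have hb : n ≤ τ.natReg 2 := by simpa [f1] using hb
    refine ⟨hT, f3, fun e => hedge e (by omega), fun p hp => hzero p (by omega), ?_⟩
    simp [mul_comm] at ht ⊢
    omega

end RealRAM

/-! ### Building all envelopes in order of decreasing edge length -/

namespace RealRAM

open ImpreciseTerrain

/-- The removed value is added on the left, which avoids truncated subtraction. -/
theorem sum_update_fin {m : ℕ} (f : ℕ → ℕ) (v : Fin m) (c : ℕ) :
    ∑ a : Fin m, Function.update f v c a + f v = ∑ a : Fin m, f a + c := by
  rw [← Finset.add_sum_erase _ _ (Finset.mem_univ v), ← Finset.add_sum_erase _ (fun a : Fin m => f a) (Finset.mem_univ v),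
    Function.update_self, Finset.sum_congr rfl (g := fun a : Fin m => f a)]
  · omega
  · intro a ha
    exact Function.update_of_ne (fun h => Finset.ne_of_mem_erase ha (Fin.ext h)) _ _

/-- Add edge `natReg 4` to the data of both of its ends. -/
def addEdge : Program :=
  0 ≔ᵣ .sub (𝐜 0) (𝐛 7 (𝐧 4)) ;;
  6 ≔ 𝐚 0 (𝐧 4) ;;
  7 ≔ 𝐚 1 (𝐧 4) ;;
  addHalfEdge ;;
  6 ≔ 𝐚 1 (𝐧 4) ;;
  7 ≔ 𝐚 0 (𝐧 4) ;;
  addHalfEdge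

/-- Here `k` is the number of edges treated so far. It bounds all degrees and is less than `n`, so
the segments have room; the two ends differ, so no degree grows by more than one. -/
theorem addEdge_runs {m n : ℕ} {T : ImpreciseTerrain (Fin m)} {src dst : Fin n → Fin m}
    {N : Fin m → Fin m → Prop} {σ : State} {e : Fin n} {k : ℕ} (hσ : InputData T src dst σ)
    (h : AdjData T n N σ) (h4 : σ.natReg 4 = e)
    (hkey : σ.realArr 7 e = -dist (T.pos (src e)) (T.pos (dst e)))
    (hdeg : ∀ v : Fin m, σ.natArr 5 v ≤ k) (hk : k < n) (hne : src e ≠ dst e)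
    (hmin : ∀ v r, N v r → dist (T.pos (src e)) (T.pos (dst e)) ≤ dist (T.pos v) (T.pos r)) :
    Runs addEdge σ fun σ' t =>
      AdjData T n (fun a b => N a b ∨ s(src e, dst e) = s(a, b)) σ' ∧
      (∀ v : Fin m, σ'.natArr 5 v ≤ k + 1) ∧
      ∑ v : Fin m, σ'.natArr 5 v = ∑ v : Fin m, σ.natArr 5 v + 2 ∧
      t + 100 * ∑ v : Fin m, σ'.natArr 7 v ≤ 100 * ∑ v : Fin m, σ.natArr 7 v + 900 := by
  simp only [addEdge, runs_seq, runs_setNatReg, runs_setRealReg]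
  have hne' : (dst e : ℕ) ≠ src e := fun he => hne (Fin.ext he.symm)
  refine (addHalfEdge_runs (T := T) (n := n) (N := N) (v := src e) (w := dst e)
    ⟨?_, ?_, ?_, ?_, ?_, ?_⟩ ?_ ?_ ?_ ?_ ?_ ?_).then ?_
  · simpa using h.base
  · simpa using h.deg_le
  · simpa using h.count_le
  · simpa using h.nbr
  · simpa using h.exists_nbr
  · simpa using h.envelope
  · simp [h4, hσ.src]
  · simp [h4, hσ.dst]
  · simp [h4, hkey]
  · simpa using hσ.high _
  · have := hdeg (src e)
    simp
    omega
  · exact hmin _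
  · rintro σ₁ t₁ F₁ ⟨a1, a2, c, a3, a4⟩
    simp only [State.setNatReg_natArr, State.setRealReg_natArr] at a2 a3 a4
    have i1 : σ₁.natArr 0 = σ.natArr 0 := by rw [F₁.natArr 0 (by decide)]; simp
    have i2 : σ₁.natArr 1 = σ.natArr 1 := by rw [F₁.natArr 1 (by decide)]; simp
    have i3 : σ₁.natReg 4 = e := by rw [F₁.natReg 4 (by decide)]; simpa using h4
    have i4 : σ₁.realReg 0 = dist (T.pos (src e)) (T.pos (dst e)) := by
      rw [F₁.realReg 0 (by decide)]; simp [h4, hkey]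
    have i5 : σ₁.realArr 3 = σ.realArr 3 := by rw [F₁.realArr 3 (by decide)]; simp
    refine (addHalfEdge_runs (T := T) (n := n) (N := fun a b => N a b ∨ a = src e ∧ b = dst e)
      (v := dst e) (w := src e) ⟨?_, ?_, ?_, ?_, ?_, ?_⟩ ?_ ?_ ?_ ?_ ?_ ?_).then ?_
    · simpa using a1.base
    · simpa using a1.deg_le
    · simpa using a1.count_le
    · simpa using a1.nbr
    · simpa using a1.exists_nbr
    · simpa using a1.envelope
    · simp [i3, i2, hσ.dst]
    · simp [i3, i1, hσ.src]
    · simp [i4, dist_comm]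
    · simpa [i5] using hσ.high _
    · have := hdeg (dst e)
      simp [a2, hne']
      omega
    · rintro r (hr | ⟨hr, -⟩)
      · rw [dist_comm]; exact hmin _ _ hr
      · exact absurd hr.symm hne
    · rintro σ₂ t₂ F₂ ⟨b1, b2, c', b3, b4⟩
      simp only [State.setNatReg_natArr] at b2 b3 b4
      refine ⟨?_, ?_, ?_, ?_⟩
      · have hN : (fun a b => N a b ∨ s(src e, dst e) = s(a, b)) =
            fun a b => (N a b ∨ a = src e ∧ b = dst e) ∨ a = dst e ∧ b = src e := by
          funext a b
          simp only [Sym2.eq_iff, or_assoc, eq_iff_iff]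
          constructor <;> rintro (h | ⟨h, h'⟩ | ⟨h, h'⟩) <;> simp [*]
        rw [hN]
        exact b1
      · intro v
        have hv := hdeg v
        rw [b2]
        by_cases h1 : (v : ℕ) = dst e
        · rw [h1, Function.update_self, a2, Function.update_of_ne hne']
          have := hdeg (dst e)
          omega
        · rw [Function.update_of_ne h1, a2]
          by_cases h2 : (v : ℕ) = src e
          · rw [h2, Function.update_self]
            have := hdeg (src e)
            omega
          · rw [Function.update_of_ne h2]
            omega
      · have s1 := sum_update_fin (σ.natArr 5) (src e) (σ.natArr 5 (src e) + 1)
        have s2 := sum_update_fin (σ₁.natArr 5) (dst e) (σ₁.natArr 5 (dst e) + 1)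
        rw [← a2] at s1
        rw [← b2] at s2
        omega
      · have s1 := sum_update_fin (σ.natArr 7) (src e) c
        have s2 := sum_update_fin (σ₁.natArr 7) (dst e) c'
        rw [← a3] at s1
        rw [← b3] at s2
        simp
        omega

/-- Take the edges out of the tournament tree and add them to the data of their ends. -/
def sortEdges : Program :=
  2 ≔ 𝐤 0 ;;
  .loop (.natLt (𝐧 2) (𝐧 1)) (treePop ;; addEdge ;; 2 ≔ 𝐧 2 ∔ 𝐤 1)

theorem sortEdges_runs {m n : ℕ} {T : ImpreciseTerrain (Fin m)} {src dst : Fin n → Fin m}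
    {σ : State} (hσ : InputData T src dst σ) (hE : IsEdgeList T.graph src dst)
    (hbase : ∀ v : Fin m, σ.natArr 4 v = v * n) (hdeg : ∀ v, σ.natArr 5 v = 0)
    (hcount : ∀ v, σ.natArr 7 v = 0)
    (h3 : σ.natReg 3 = n)
    (hT : TreeInv n (σ.natArr 10) (σ.natArr 11) (σ.realArr 7))
    (hact : ∀ e : Fin n, σ.natArr 11 e = 1 ∧
        σ.realArr 7 e = -dist (T.pos (src e)) (T.pos (dst e)))
    (hact' : ∀ p, n ≤ p → σ.natArr 11 p = 0) :
    Runs sortEdges σ fun σ' t =>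
      AdjData T n T.graph.Adj σ' ∧ ∑ v : Fin m, σ'.natArr 5 v = 2 * n ∧
      (∀ p, σ'.natArr 11 p = 0) ∧ t ≤ n * (treeTime n + 950) + 10 := by
  classical
  have hne : ∀ e, src e ≠ dst e := by
    intro e
    have : s(src e, dst e) ∈ T.graph.edgeSet := hE.2 ▸ ⟨e, rfl⟩
    exact (SimpleGraph.mem_edgeSet _).1 this |>.ne
  rw [sortEdges, runs_seq, runs_setNatReg]
  -- `P` consists of the edges taken out so far, none of them shorter than a remaining one. The
  -- potential includes 100 units per envelope line, for the amortized cost of removals.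
  refine (Runs.loop (fun τ => ∃ P : Finset (Fin n), P.card = τ.natReg 2 ∧ τ.natReg 2 ≤ n ∧
    TreeInv n (τ.natArr 10) (τ.natArr 11) (τ.realArr 7) ∧
    (∀ e : Fin n, τ.natArr 11 e = if e ∈ P then 0 else 1) ∧
    (∀ p, n ≤ p → τ.natArr 11 p = 0) ∧
    (∀ e ∈ P, ∀ f ∉ P, dist (T.pos (src f)) (T.pos (dst f)) ≤
      dist (T.pos (src e)) (T.pos (dst e))) ∧
    AdjData T n (fun v w => ∃ e ∈ P, s(src e, dst e) = s(v, w)) τ ∧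
    (∀ v : Fin m, τ.natArr 5 v ≤ τ.natReg 2) ∧
    ∑ v : Fin m, τ.natArr 5 v = 2 * τ.natReg 2)
    (fun τ => (treeTime n + 950) * (n - τ.natReg 2) + 100 * ∑ v : Fin m, τ.natArr 7 v)
    ?_ ?_).then ?_
  · refine ⟨∅, by simp, by simp, by simpa using hT, by simpa using fun e => (hact e).1,
      by simpa using hact', by simp, ?_, by simp [hdeg], by simp [hdeg]⟩
    constructor
    · simpa using hbase
    · simp [hdeg]
    · simp [hdeg, hcount]
    · simp [hdeg]
    · simp
    · intro v
      simp [hcount, linesAt]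
      exact isEnvelope_empty _ _
  · rintro τ ⟨P, hP, h2, hTr, hPa, hz, hmax, hA, hd, hs⟩ F hb
    have fn : τ.natReg 1 = n := by rw [F.natReg 1 (by decide)]; simpa using hσ.edges
    have f3 : τ.natReg 3 = n := by rw [F.natReg 3 (by decide)]; simpa using h3
    have fin : InputData T src dst τ := hσ.frame (c := sortEdges)
      (((Exec.frame (.setNatReg σ 2 (𝐤 0))).weaken (by simp [sortEdges]) (by simp) (by simp)
        (by simp)).trans (F.weaken (by simp [sortEdges]) (by simp [sortEdges])
          (by simp [sortEdges]) (by simp [sortEdges]))) (by decide)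
    have fkey : ∀ e : Fin n, τ.realArr 7 e = -dist (T.pos (src e)) (T.pos (dst e)) := by
      intro e
      rw [F.realArr 7 (by decide)]; simpa using (hact e).2
    have hb : τ.natReg 2 < n := by simpa [fn] using hb
    obtain ⟨f, hf⟩ : ∃ f : Fin n, f ∉ P := by
      by_contra! hall
      have : P = Finset.univ := by ext; simp [hall]
      rw [this] at hP
      simp at hP
      omega
    rw [runs_seq]
    refine (treePop_runs (p := f) (by simp [f3]) (by simp [hPa, hf]) (by simpa [f3] using hTr)).then ?_
    rintro τ₁ t₁ F₁ ⟨-, b2, b3, b4, b5, b6, b7⟩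
    rw [f3] at b2 b4 b6 b7
    set e : Fin n := ⟨τ₁.natReg 4, b2⟩ with he
    have he4 : τ₁.natReg 4 = e := rfl
    rw [he4] at b3 b4 b5
    have heP : e ∉ P := by
      intro h
      rw [hPa, if_pos h] at b3
      simp at b3
    have hemax : ∀ f ∉ P, dist (T.pos (src f)) (T.pos (dst f)) ≤
        dist (T.pos (src e)) (T.pos (dst e)) := by
      intro f hf
      have := b4 f f.2 (by simp [hPa, hf])
      rw [fkey, fkey] at this
      linarith
    have g5 : τ₁.natArr 5 = τ.natArr 5 := F₁.natArr 5 (by decide)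
    have g7 : τ₁.natArr 7 = τ.natArr 7 := F₁.natArr 7 (by decide)
    have gk : τ₁.realArr 7 = τ.realArr 7 := F₁.realArr 7 (by decide)
    have g2 : τ₁.natReg 2 = τ.natReg 2 := F₁.natReg 2 (by decide)
    have hA1 : AdjData T n (fun v w => ∃ e ∈ P, s(src e, dst e) = s(v, w)) τ₁ := by
      constructor
      · rw [F₁.natArr 4 (by decide)]; exact hA.base
      · rw [g5]; exact hA.deg_le
      · rw [g5, g7]; exact hA.count_le
      · rw [g5, F₁.natArr 6 (by decide), F₁.realArr 4 (by decide)]; exact hA.nbr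
      · rw [g5, F₁.natArr 6 (by decide)]; exact hA.exists_nbr
      · rw [g7, F₁.realArr 5 (by decide), F₁.realArr 6 (by decide)]; exact hA.envelope
    rw [runs_seq]
    refine (addEdge_runs (k := τ.natReg 2) (fin.frame F₁ (by decide)) hA1 he4
      (by rw [gk]; exact fkey e) (by rw [g5]; exact hd) hb (hne e) ?_).then ?_
    · rintro v r ⟨f, hf, hs⟩
      have := hmax f hf e heP
      rcases Sym2.eq_iff.1 hs with ⟨rfl, rfl⟩ | ⟨rfl, rfl⟩
      · exact this
      · rwa [dist_comm (T.pos (dst f))]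
    · rintro τ₂ t₂ F₂ ⟨c1, c2, c3, c4⟩
      have k2 : τ₂.natReg 2 = τ.natReg 2 := by rw [F₂.natReg 2 (by decide), g2]
      have k11 : τ₂.natArr 11 = Function.update (τ.natArr 11) e 0 := by
        rw [F₂.natArr 11 (by decide), b5]
      rw [runs_setNatReg]
      refine ⟨⟨insert e P, ?_, ?_, ?_, ?_, ?_, ?_, ?_, ?_, ?_⟩, ?_⟩
      · simp [heP, hP, k2]
      · simp [k2]; omega
      · simp only [State.setNatReg_natArr, State.setNatReg_realArr]
        rw [F₂.natArr 10 (by decide), F₂.natArr 11 (by decide), F₂.realArr 7 (by decide), gk]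
        exact b6
      · intro f
        simp only [State.setNatReg_natArr, k11, Finset.mem_insert]
        by_cases hfe : f = e
        · subst hfe; simp
        · have : (f : ℕ) ≠ e := fun h => hfe (Fin.ext h)
          rw [Function.update_of_ne this, hPa]
          simp [hfe]
      · intro p hp
        simp only [State.setNatReg_natArr, k11]
        rw [Function.update_of_ne (by omega)]
        exact hz p hp
      · intro g hg f hf
        rw [Finset.mem_insert, not_or] at hf
        rcases Finset.mem_insert.1 hg with rfl | hg
        · exact hemax f hf.2
        · exact hmax g hg f hf.2
      · have hN : (fun v w => ∃ f ∈ insert e P, s(src f, dst f) = s(v, w)) = fun a b =>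
            (∃ f ∈ P, s(src f, dst f) = s(a, b)) ∨ s(src e, dst e) = s(a, b) := by
          funext a b
          simp only [Finset.mem_insert, exists_eq_or_imp, eq_iff_iff]
          exact or_comm
        rw [hN]
        exact ⟨c1.base, c1.deg_le, c1.count_le, c1.nbr, c1.exists_nbr, c1.envelope⟩
      · intro v
        have := c2 v
        simpa [k2] using this
      · simp [k2, c3, g5, hs]; ring
      · have h8 : (treeTime n + 950) * (n - τ.natReg 2) =
            (treeTime n + 950) * (n - (τ.natReg 2 + 1)) + (treeTime n + 950) := by
          rw [← Nat.mul_succ]; congr 1; omega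
        rw [g7] at c4
        simp [k2]
        rw [h8]
        unfold treeTime at *
        omega
  · rintro τ t F ⟨⟨P, hP, h2, hTr, hPa, hz, hmax, hA, hd, hs⟩, hb, ht⟩
    have fn : τ.natReg 1 = n := by rw [F.natReg 1 (by decide)]; simpa using hσ.edges
    have hb : n ≤ τ.natReg 2 := by simpa [fn] using hb
    have h2n : τ.natReg 2 = n := by omega
    have hPu : P = Finset.univ := by
      rw [← Finset.card_eq_iff_eq_univ]; simp [hP, h2n]
    subst hPu
    have hN : (fun v w => ∃ e ∈ Finset.univ, s(src e, dst e) = s(v, w)) = T.graph.Adj := by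
      funext v w
      simp only [Finset.mem_univ, true_and, eq_iff_iff]
      rw [← SimpleGraph.mem_edgeSet, ← hE.2]
      rfl
    rw [hN] at hA
    refine ⟨hA, by rw [hs, h2n], fun p => ?_, ?_⟩
    · by_cases hp : p < n
      · simpa using hPa ⟨p, hp⟩
      · exact hz p (by omega)
    · simp [hcount, mul_comm] at ht ⊢
      omega

end RealRAM

namespace RealRAM

open ImpreciseTerrain

/-! ## The search for the lowest feasible elevation -/

/-- One step of the binary search on the envelope of node `natReg 12`. -/
def searchStep : Program :=
  16 ≔ .half (𝐧 14 ∔ 𝐧 15) ;;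
  5 ≔ᵣ .div (.sub (𝐛 6 (𝐧 8 ∔ (𝐧 16 ∔ 𝐤 1))) (𝐛 6 (𝐧 8 ∔ 𝐧 16)))
    (.sub (𝐛 5 (𝐧 8 ∔ 𝐧 16)) (𝐛 5 (𝐧 8 ∔ (𝐧 16 ∔ 𝐤 1)))) ;;
  .cond (.and (.realLe (𝐫 6) (𝐫 5)) (.not (.and (.not (.realLe (𝐛 5 (𝐧 8 ∔ (𝐧 16 ∔ 𝐤 1))) (𝐫 0)))
      (.not (.realLe (.add (𝐫 2) (.mul (𝐫 5) (𝐫 0)))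
        (.add (𝐛 6 (𝐧 8 ∔ (𝐧 16 ∔ 𝐤 1)))
          (.mul (𝐫 5) (𝐛 5 (𝐧 8 ∔ (𝐧 16 ∔ 𝐤 1))))))))))
    (15 ≔ 𝐧 16) (14 ≔ 𝐧 16 ∔ 𝐤 1)

/-- Binary search for the line of the envelope that starts at `natReg 8`. -/
def searchLoop : Program :=
  .loop (.natLt (𝐧 14) (𝐧 15)) searchStep

/-- Compute the parameter `realReg 4` from the line `natReg 14` found by the binary search. -/
def searchFinish : Program :=
  4 ≔ᵣ 𝐫 6 ;;
  .cond (.realLe (𝐛 5 (𝐧 8 ∔ 𝐧 14)) (𝐫 0)) .skip (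
    5 ≔ᵣ .div (.sub (𝐫 2) (𝐛 6 (𝐧 8 ∔ 𝐧 14))) (.sub (𝐛 5 (𝐧 8 ∔ 𝐧 14)) (𝐫 0)) ;;
    .cond (.realLe (𝐫 5) (𝐫 4)) .skip (4 ≔ᵣ 𝐫 5))

/-- Compute the elevation `realReg 3` and decide in `natReg 13` whether it is feasible. -/
def searchDecide : Program :=
  3 ≔ᵣ .add (𝐫 2) (.mul (𝐫 4) (𝐫 0)) ;;
  .cond (.and (.realLe (𝐫 3) (𝐛 3 (𝐧 12)))
      (.and (.realLe (𝐫 3) (.add (𝐛 6 (𝐧 8 ∔ 𝐧 14)) (.mul (𝐫 4) (𝐛 5 (𝐧 8 ∔ 𝐧 14)))))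
        (.not (.and (.natLt (𝐧 14 ∔ 𝐤 1) (𝐚 7 (𝐧 12)))
          (.not (.realLe (.add (𝐛 6 (𝐧 8 ∔ 𝐧 14)) (.mul (𝐫 4) (𝐛 5 (𝐧 8 ∔ 𝐧 14))))
            (.add (𝐛 6 (𝐧 8 ∔ (𝐧 14 ∔ 𝐤 1)))
              (.mul (𝐫 4) (𝐛 5 (𝐧 8 ∔ (𝐧 14 ∔ 𝐤 1)))))))))))
    (13 ≔ 𝐤 1) (13 ≔ 𝐤 0)

/-- The search, with the lowest admissible parameter in `realReg 6`. -/
def searchTail : Program :=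
  8 ≔ 𝐚 4 (𝐧 12) ;;
  14 ≔ 𝐤 0 ;;
  15 ≔ 𝐚 7 (𝐧 12) ∸ 𝐤 1 ;;
  searchLoop ;;
  searchFinish ;;
  searchDecide

/-- Find the lowest feasible elevation of node `natReg 12` when its neighbor at distance
`realReg 0` has elevation `realReg 2`. -/
def search : Program :=
  6 ≔ᵣ .div (.sub (𝐛 2 (𝐧 12)) (𝐫 2)) (𝐫 0) ;;
  .cond (.realLe (𝐜 0) (𝐫 6)) .skip (6 ≔ᵣ 𝐜 0) ;;
  searchTail

/-- The direction predicate need not be monotone in `j`. It suffices to keep it false just before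
the lower end and true at the upper end of the interval, unless these are the ends of the chain. -/
theorem searchLoop_runs (σ : State) {k : ℕ} (h14 : σ.natReg 14 = 0) (h15 : σ.natReg 15 = k - 1)
    (hk : 0 < k) {D H : ℕ → ℝ} (hD : ∀ j, D j = σ.realArr 5 (σ.natReg 8 + j))
    (hH : ∀ j, H j = σ.realArr 6 (σ.natReg 8 + j)) :
    Runs searchLoop σ fun σ' t => σ'.natReg 14 < k ∧
      (∀ i, i + 1 = σ'.natReg 14 →
        ¬ SearchLeft D H (σ.realReg 6) (σ.realReg 0) (σ.realReg 2) i) ∧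
      (σ'.natReg 14 + 1 < k →
        SearchLeft D H (σ.realReg 6) (σ.realReg 0) (σ.realReg 2) (σ'.natReg 14)) ∧
      t ≤ 100 * Nat.log 2 (2 * k) + 10 := by
  refine (Runs.loop (fun τ => τ.natReg 14 ≤ τ.natReg 15 ∧ τ.natReg 15 < k ∧
      (∀ i, i + 1 = τ.natReg 14 →
        ¬ SearchLeft D H (σ.realReg 6) (σ.realReg 0) (σ.realReg 2) i) ∧
      (τ.natReg 15 + 1 < k →
        SearchLeft D H (σ.realReg 6) (σ.realReg 0) (σ.realReg 2) (τ.natReg 15)))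
      -- The factor 2 inside the logarithm distinguishes length 1 (logarithm 1) from length 0
      -- (logarithm 0), so that also the last step pays.
      (fun τ => 100 * Nat.log 2 (2 * (τ.natReg 15 - τ.natReg 14))) ?_ ?_).mono ?_
  · refine ⟨by omega, by omega, by omega, by omega⟩
  · rintro τ ⟨h1, h2, h3, h4⟩ F hb
    have hb : τ.natReg 14 < τ.natReg 15 := by simpa using hb
    have f8 : τ.natReg 8 = σ.natReg 8 := F.natReg 8 (by decide)
    have r0 : τ.realReg 0 = σ.realReg 0 := F.realReg 0 (by decide)
    have r2 : τ.realReg 2 = σ.realReg 2 := F.realReg 2 (by decide)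
    have r6 : τ.realReg 6 = σ.realReg 6 := F.realReg 6 (by decide)
    have ra : τ.realArr = σ.realArr := funext fun a => F.realArr a (by simp [searchStep])
    have hlog : ∀ x, 2 * x ≤ τ.natReg 15 - τ.natReg 14 →
        Nat.log 2 (2 * x) + 1 ≤ Nat.log 2 (2 * (τ.natReg 15 - τ.natReg 14)) := by
      intro x hx
      rw [Nat.log_of_one_lt_of_le (n := 2 * (τ.natReg 15 - τ.natReg 14)) one_lt_two (by omega),
        Nat.mul_div_cancel_left _ two_pos]
      exact Nat.succ_le_succ (Nat.log_mono_right hx)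
    -- Only the right side is unfolded below, into the form that simplifying the program's test
    -- yields.
    have hP : SearchLeft D H (σ.realReg 6) (σ.realReg 0) (σ.realReg 2)
          ((τ.natReg 14 + τ.natReg 15) / 2) ↔ SearchLeft D H (σ.realReg 6) (σ.realReg 0)
            (σ.realReg 2) ((τ.natReg 14 + τ.natReg 15) / 2) := Iff.rfl
    conv_rhs at hP => rw [SearchLeft, breakpoint, hD, hD, hH, hH, or_iff_not_imp_left, not_le]
    have l1 := hlog ((τ.natReg 14 + τ.natReg 15) / 2 - τ.natReg 14) (by omega)
    have l2 := hlog (τ.natReg 15 - ((τ.natReg 14 + τ.natReg 15) / 2 + 1)) (by omega)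
    simp [searchStep, f8, r0, r2, r6, ra]
    refine ⟨fun g1 g2 => ⟨⟨by omega, by omega, h3, fun _ => hP.2 ⟨g1, g2⟩⟩, by omega⟩,
      fun g => ⟨⟨by omega, h2, ?_, h4⟩, by omega⟩⟩
    rintro hleft
    obtain ⟨g1, g2⟩ := hP.1 hleft
    obtain ⟨g3, g4⟩ := g g1
    exact (g2 g3).not_gt g4
  · rintro τ t ⟨⟨h1, h2, h3, h4⟩, hb, ht⟩
    have hb : τ.natReg 15 ≤ τ.natReg 14 := by simpa using hb
    have he : τ.natReg 15 = τ.natReg 14 := by omega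
    rw [he] at h2 h4
    refine ⟨h2, h3, h4, ?_⟩
    have : Nat.log 2 (2 * (σ.natReg 15 - σ.natReg 14)) ≤ Nat.log 2 (2 * k) :=
      Nat.log_mono_right (by omega)
    simp at ht
    omega

theorem searchFinish_runs (σ : State) {D H : ℕ → ℝ}
    (hD : ∀ j, D j = σ.realArr 5 (σ.natReg 8 + j))
    (hH : ∀ j, H j = σ.realArr 6 (σ.natReg 8 + j)) :
    Runs searchFinish σ fun σ' t => σ'.realReg 4 =
        searchParam D H (σ.realReg 6) (σ.realReg 0) (σ.realReg 2) (σ.natReg 14) ∧ t ≤ 60 := by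
  simp only [searchParam, hD, hH]
  simp [searchFinish]
  refine ⟨fun h => by simp [h], fun h => ⟨fun h' => ?_, fun h' => ?_⟩⟩
  · exact fun _ => h'
  · simp [h.not_ge, h'.le]

theorem search_runs {m n : ℕ} {T : ImpreciseTerrain (Fin m)} {src dst : Fin n → Fin m}
    {σ : State} {q u : Fin m} (hσ : InputData T src dst σ) (hA : AdjData T n T.graph.Adj σ)
    (h12 : σ.natReg 12 = q) (hqu : T.graph.Adj q u)
    (h0 : σ.realReg 0 = dist (T.pos q) (T.pos u)) :
    Runs search σ fun σ' t =>
      (σ'.natReg 13 = 1 ∧ IsLeast {y | T.Feasible q u (σ.realReg 2) y} (σ'.realReg 3) ∨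
        σ'.natReg 13 = 0 ∧ ∀ y, ¬ T.Feasible q u (σ.realReg 2) y) ∧
      t ≤ 100 * Nat.log 2 (2 * n) + 300 := by
  set k := σ.natArr 7 q with hk
  set z := σ.realReg 2 with hz
  set d := dist (T.pos q) (T.pos u) with hd
  set D : ℕ → ℝ := fun j => σ.realArr 5 (q * n + j) with hD
  set H : ℕ → ℝ := fun j => σ.realArr 6 (q * n + j) with hH
  have henv : IsEnvelope (T.linesAt (T.graph.Adj q) q) D H k := hA.envelope q
  have hkpos : 0 < k := by
    obtain ⟨j, hj, -⟩ := henv.dom _ ⟨u, hqu, rfl⟩ 0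
    omega
  have hlog : Nat.log 2 (2 * k) ≤ Nat.log 2 (2 * n) :=
    Nat.log_mono_right (Nat.mul_le_mul_left 2 ((hA.count_le q).trans (hA.deg_le q)))
  -- The branches of the initial clamping at 0 both leave `s₀` in real register 6; the remaining
  -- program is treated once for both.
  have tail : ∀ σ₁ : State, σ₁.natReg 12 = q → σ₁.realReg 0 = d → σ₁.realReg 2 = z →
      σ₁.realReg 6 = max 0 ((T.low q - z) / d) → σ₁.natArr = σ.natArr →
      σ₁.realArr = σ.realArr →
      Runs searchTail σ₁ fun σ' t =>
      (σ'.natReg 13 = 1 ∧ IsLeast {y | T.Feasible q u z y} (σ'.realReg 3) ∨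
        σ'.natReg 13 = 0 ∧ ∀ y, ¬ T.Feasible q u z y) ∧
      t ≤ 100 * Nat.log 2 (2 * n) + 250 := by
    intro σ₁ g12 g0 g2 g6 gna gra
    simp only [searchTail, runs_seq, runs_setNatReg]
    refine (searchLoop_runs _ (k := k) (D := D) (H := H) ?_ ?_ hkpos ?_ ?_).then ?_
    · simp
    · simp [g12, gna, hk]
    · simp [hD, g12, gna, gra, hA.base]
    · simp [hH, g12, gna, gra, hA.base]
    rintro σ₂ t₂ F₂ ⟨a1, a2, a3, a4⟩
    simp [g0, g2, g6] at a2 a3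
    have b8 : σ₂.natReg 8 = q * n := by
      rw [F₂.natReg 8 (by decide)]; simp [g12, gna, hA.base]
    have b12 : σ₂.natReg 12 = q := by rw [F₂.natReg 12 (by decide)]; simp [g12]
    have b0 : σ₂.realReg 0 = d := by rw [F₂.realReg 0 (by decide)]; simp [g0]
    have b2 : σ₂.realReg 2 = z := by rw [F₂.realReg 2 (by decide)]; simp [g2]
    have b6 : σ₂.realReg 6 = max 0 ((T.low q - z) / d) := by
      rw [F₂.realReg 6 (by decide)]; simp [g6]
    have bra : σ₂.realArr = σ.realArr := by
      rw [← gra]; exact funext fun a => F₂.realArr a (by simp [searchLoop, searchStep])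
    have bna : σ₂.natArr = σ.natArr := by
      rw [← gna]; exact funext fun a => F₂.natArr a (by simp [searchLoop, searchStep])
    refine (searchFinish_runs σ₂ (D := D) (H := H) ?_ ?_).then ?_
    · simp [hD, b8, bra]
    · simp [hH, b8, bra]
    rintro σ₃ t₃ F₃ ⟨c1, c2⟩
    rw [b6, b0, b2] at c1
    set j := σ₂.natReg 14 with hj
    have d14 : σ₃.natReg 14 = j := F₃.natReg 14 (by decide)
    have d8 : σ₃.natReg 8 = q * n := (F₃.natReg 8 (by decide)).trans b8
    have d12 : σ₃.natReg 12 = q := (F₃.natReg 12 (by decide)).trans b12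
    have d0 : σ₃.realReg 0 = d := (F₃.realReg 0 (by decide)).trans b0
    have d2 : σ₃.realReg 2 = z := (F₃.realReg 2 (by decide)).trans b2
    have dra : σ₃.realArr = σ.realArr := by
      rw [← bra]; exact funext fun a => F₃.realArr a (by simp [searchFinish])
    have dna : σ₃.natArr = σ.natArr := by
      rw [← bna]; exact funext fun a => F₃.natArr a (by simp [searchFinish])
    set s := σ₃.realReg 4 with hs
    have htest : T.SearchTest q u z D H k j s ↔ T.SearchTest q u z D H k j s := Iff.rfl
    conv_rhs at htest => rw [SearchTest, ← hd, hD, hH]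
    simp [searchDecide, d14, d8, d12, d0, d2, dra, dna, hσ.high, ← hk, ← hs]
    refine ⟨fun e1 e2 e3 => ⟨?_, ?_⟩, fun e => ⟨?_, ?_⟩⟩
    · exact isLeast_of_searchTest hqu henv a1 rfl a2 a3 c1 (htest.2 ⟨e1, e2, e3⟩)
    · omega
    · refine not_feasible_of_not_searchTest hqu henv a1 rfl a3 c1 fun ht => ?_
      obtain ⟨e1, e2, e3⟩ := htest.1 ht
      obtain ⟨e4, e5⟩ := e e1 e2
      exact (e3 e4).not_gt e5
    · omega
  simp only [search, runs_seq, runs_setRealReg, runs_cond, runs_skip]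
  constructor
  · intro hle
    simp [h12, h0, hσ.low] at hle
    refine (tail _ ?_ ?_ ?_ ?_ ?_ ?_).mono ?_
    · simpa using h12
    · simpa using h0
    · simp [hz]
    · simp [h12, h0, hσ.low, ← hz]
      exact hle
    · simp
    · simp
    · rintro σ' t ⟨h1, h2⟩
      refine ⟨h1, ?_⟩
      simp
      omega
  · intro hle
    simp [h12, h0, hσ.low] at hle
    refine (tail _ ?_ ?_ ?_ ?_ ?_ ?_).mono ?_
    · simpa using h12
    · simpa using h0
    · simp [hz]
    · simp
      exact hle.le
    · simp
    · simp
    · rintro σ' t ⟨h1, h2⟩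
      refine ⟨h1, ?_⟩
      simp
      omega

end RealRAM

namespace RealRAM

open ImpreciseTerrain

/-! ## The label setting algorithm on the real RAM -/

/-- Improve the label of node `natReg 12` by means of its final neighbor at distance `realReg 0`
with label `realReg 2`; nodes that are marked in array `b` are skipped. -/
def relax (b : ℕ) : Program :=
  .cond (.and (.natEq (𝐚 b (𝐧 12)) (𝐤 0)) (.natEq (𝐚 8 (𝐧 12)) (𝐤 0)))
    (search ;;
      .cond (.and (.natEq (𝐧 13) (𝐤 1))
          (.not (.and (.natEq (𝐚 11 (𝐧 12)) (𝐤 1)) (.realLe (𝐛 7 (𝐧 12)) (𝐫 3)))))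
        (.setRealArr 7 (𝐧 12) (𝐫 3) ;; 4 ≔ 𝐧 12 ;; treePush)
        .skip)
    .skip

/-- The tournament tree is a correct queue of nodes, and the flags of final nodes are `0` or `1`. -/
structure QueueInv (m : ℕ) (σ : State) : Prop where
  size : σ.natReg 3 = m
  tree : TreeInv m (σ.natArr 10) (σ.natArr 11) (σ.realArr 7)
  act : ∀ p, σ.natArr 11 p = 0 ∨ σ.natArr 11 p = 1
  act_out : ∀ p, m ≤ p → σ.natArr 11 p = 0
  done : ∀ v : Fin m, σ.natArr 8 v = 0 ∨ σ.natArr 8 v = 1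

/-- The invariant of the label setting algorithm, for the labels in the memory. -/
abbrev Labels {m : ℕ} (T : ImpreciseTerrain (Fin m)) (B S : Set (Fin m)) (σ : State)
    (rank : Fin m → ℕ) (C : Fin m → Fin m → Prop) : Prop :=
  T.LabelInv B S (fun v => σ.natArr 11 v = 1) (fun v => σ.natArr 8 v = 1)
    (fun v => σ.realArr 7 v) rank C

theorem AdjData.congr {m n : ℕ} {T : ImpreciseTerrain (Fin m)} {N : Fin m → Fin m → Prop}
    {σ σ' : State} (h : AdjData T n N σ) (h4 : σ'.natArr 4 = σ.natArr 4)
    (h5 : σ'.natArr 5 = σ.natArr 5) (h6 : σ'.natArr 6 = σ.natArr 6)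
    (h7 : σ'.natArr 7 = σ.natArr 7) (k4 : σ'.realArr 4 = σ.realArr 4)
    (k5 : σ'.realArr 5 = σ.realArr 5) (k6 : σ'.realArr 6 = σ.realArr 6) : AdjData T n N σ' where
  base := by rw [h4]; exact h.base
  deg_le := by rw [h5]; exact h.deg_le
  count_le := by rw [h5, h7]; exact h.count_le
  nbr := by rw [h5, h6, k4]; exact h.nbr
  exists_nbr := by rw [h5, h6]; exact h.exists_nbr
  envelope := by rw [h7, k5, k6]; exact h.envelope

/-- The program does not write to the adjacency lists and envelopes. -/
abbrev Program.KeepsAdj (c : Program) : Prop :=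
  (∀ a ∈ [4, 5, 6, 7], a ∉ c.natArrs) ∧ ∀ a ∈ [4, 5, 6], a ∉ c.realArrs

theorem AdjData.frame {m n : ℕ} {T : ImpreciseTerrain (Fin m)} {N : Fin m → Fin m → Prop}
    {σ σ' : State} {c : Program} (h : AdjData T n N σ) (hF : Frame c σ σ') (hc : c.KeepsAdj) :
    AdjData T n N σ' :=
  h.congr (hF.natArr 4 (hc.1 4 (by simp))) (hF.natArr 5 (hc.1 5 (by simp)))
    (hF.natArr 6 (hc.1 6 (by simp))) (hF.natArr 7 (hc.1 7 (by simp)))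
    (hF.realArr 4 (hc.2 4 (by simp))) (hF.realArr 5 (hc.2 5 (by simp)))
    (hF.realArr 6 (hc.2 6 (by simp)))

/-- Time for one search. -/
def searchTime (n : ℕ) : ℕ := 100 * Nat.log 2 (2 * n) + 300

/-- The label of `q` may stay if `q` is forbidden, if nothing is feasible, if its present label is
no higher, or if `q` is final: then its label is at most that of `u`, hence at most every feasible
elevation. -/
theorem relax_runs {m n : ℕ} {T : ImpreciseTerrain (Fin m)} {src dst : Fin n → Fin m}
    {B S : Set (Fin m)} {C : Fin m → Fin m → Prop} {rank : Fin m → ℕ} {b : ℕ}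
    {σ : State} {q u : Fin m} (hσ : InputData T src dst σ) (hA : AdjData T n T.graph.Adj σ)
    (hQ : QueueInv m σ) (hb : σ.natArr b q = 0 ↔ q ∉ B) (hL : Labels T B S σ rank C)
    (h12 : σ.natReg 12 = q) (h0 : σ.realReg 0 = dist (T.pos q) (T.pos u))
    (h2 : σ.realReg 2 = σ.realArr 7 u) (hqu : T.graph.Adj q u) (hu : σ.natArr 8 u = 1)
    (hmax : ∀ p : Fin m, σ.natArr 8 p = 1 → σ.realArr 7 p ≤ σ.realArr 7 u) :
    Runs (relax b) σ fun σ' t =>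
      QueueInv m σ' ∧ Labels T B S σ' rank (fun v r => C v r ∨ v = u ∧ r = q) ∧
      (∀ p : Fin m, σ.natArr 8 p = 1 → σ'.realArr 7 p = σ.realArr 7 p) ∧
      t ≤ treeTime m + searchTime n + 100 := by
  rw [relax, runs_cond]
  constructor
  · intro hc
    have hc : q ∉ B ∧ σ.natArr 8 q = 0 := by simpa [h12, hb] using hc
    obtain ⟨hqB, hqd⟩ := hc
    have hqd' : ¬ σ.natArr 8 q = 1 := by omega
    rw [runs_seq]
    refine (search_runs hσ hA h12 hqu h0).then ?_
    rintro σ₁ t₁ F₁ ⟨hres, ht₁⟩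
    have n3 : σ₁.natReg 3 = σ.natReg 3 := F₁.natReg 3 (by decide)
    have n12 : σ₁.natReg 12 = q := (F₁.natReg 12 (by decide)).trans h12
    have na : σ₁.natArr = σ.natArr := funext fun a => F₁.natArr a (by
      simp [search, searchTail, searchLoop, searchStep, searchFinish, searchDecide])
    have ra : σ₁.realArr = σ.realArr := funext fun a => F₁.realArr a (by
      simp [search, searchTail, searchLoop, searchStep, searchFinish, searchDecide])
    rw [h2] at hres
    rw [runs_cond]
    constructor
    · intro hc
      have hc : σ₁.natReg 13 = 1 ∧ (σ.natArr 11 q = 1 → σ₁.realReg 3 < σ.realArr 7 q) := by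
        simpa [n12, na, ra] using hc
      have hmin := (hres.resolve_right fun h => by omega).2
      simp only [runs_seq, runs_setRealArr, runs_setNatReg]
      refine (treePush_runs (key := σ.realArr 7) ?_ ?_ ?_).then ?_
      · simp [n12, n3, hQ.size]
      · simpa [n3, hQ.size, na] using hQ.tree
      · intro p hp
        simp [n12] at hp
        simp [ra, n12, hp]
      · rintro σ₂ t₂ F₂ ⟨k1, k2, k3⟩
        have k4 : σ₂.natReg 3 = m := by
          rw [F₂.natReg 3 (by decide)]; simp [n3, hQ.size]
        have k5 : σ₂.natArr 11 = Function.update (σ.natArr 11) q 1 := by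
          rw [k1]; simp [na, n12]
        have k6 : σ₂.realArr 7 = Function.update (σ.realArr 7) q (σ₁.realReg 3) := by
          rw [F₂.realArr 7 (by decide)]; simp [ra, n12]
        have k7 : σ₂.natArr 8 = σ.natArr 8 := by
          rw [F₂.natArr 8 (by decide)]; simp [na]
        have hne : ∀ {p : Fin m}, p ≠ q → (p : ℕ) ≠ q := fun h he => h (Fin.ext he)
        refine ⟨⟨k4, ?_, ?_, ?_, ?_⟩, ?_, ?_, ?_⟩
        · rw [k6]
          simpa [n3, hQ.size, ra, n12] using k2
        · intro p
          rw [k5]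
          by_cases hp : p = q
          · simp [hp]
          · simpa [hp] using hQ.act p
        · intro p hp
          rw [k5, Function.update_of_ne (by omega)]
          exact hQ.act_out p hp
        · rw [k7]; exact hQ.done
        · simp only [Labels, k7]
          refine hL.relax hu hqu hqB hqd' hmax hmin.1 hmin.2
            (fun h => (hc.2 h).le) ?_ ?_
          · intro p
            rw [k5]
            by_cases hp : p = q
            · simp [hp]
            · simp [hne hp, hp]
          · intro p
            rw [k6]
            by_cases hp : p = q
            · simp [hp]
            · simp [hne hp, hp]
        · intro p hp
          have : p ≠ q := fun h => hqd' (h ▸ hp)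
          rw [k6, Function.update_of_ne (hne this)]
        · simp [n3, hQ.size] at k3 ⊢
          unfold treeTime searchTime
          omega
    · intro hc
      have hc : σ₁.natReg 13 = 1 → σ.natArr 11 q = 1 ∧ σ.realArr 7 q ≤ σ₁.realReg 3 := by
        simpa [n12, na, ra] using hc
      rw [runs_skip]
      refine ⟨⟨n3.trans hQ.size, ?_, ?_, ?_, ?_⟩, ?_, ?_, ?_⟩
      · rw [na, ra]; exact hQ.tree
      · rw [na]; exact hQ.act
      · rw [na]; exact hQ.act_out
      · rw [na]; exact hQ.done
      · simp only [Labels, na, ra]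
        refine hL.skip fun _ y hy => ?_
        rcases hres with ⟨h13, hmin⟩ | ⟨-, hno⟩
        · obtain ⟨h11, hle⟩ := hc h13
          exact ⟨Or.inl h11, hle.trans (hmin.2 hy)⟩
        · exact absurd hy (hno y)
      · simp [ra]
      · simp
        unfold searchTime
        omega
  · intro hc
    have hc : q ∉ B → ¬ σ.natArr 8 q = 0 := by simpa [h12, hb] using hc
    rw [runs_skip]
    refine ⟨hQ, hL.skip fun hqB y hy => ?_, fun _ _ => rfl, ?_⟩
    · have hqd := (hQ.done q).resolve_left (hc hqB)
      exact ⟨Or.inr hqd, (hmax q hqd).trans hy.2.2.1⟩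
    · simp

/-- Improve the label of neighbor number `natReg 18` of node `natReg 19`. -/
def expandStep (b : ℕ) : Program :=
  12 ≔ 𝐚 6 (𝐧 17 ∔ 𝐧 18) ;;
  0 ≔ᵣ 𝐛 4 (𝐧 17 ∔ 𝐧 18) ;;
  relax b ;;
  18 ≔ 𝐧 18 ∔ 𝐤 1

/-- Expand node `natReg 19`: use it to improve the labels of all its neighbors. -/
def expand (b : ℕ) : Program :=
  2 ≔ᵣ 𝐛 7 (𝐧 19) ;;
  17 ≔ 𝐚 4 (𝐧 19) ;;
  18 ≔ 𝐤 0 ;;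
  .loop (.natLt (𝐧 18) (𝐚 5 (𝐧 19))) (expandStep b)

/-- Time for treating one neighbor in the expansion of a node. -/
def relaxTime (m n : ℕ) : ℕ := treeTime m + searchTime n + 150

theorem expand_runs {m n : ℕ} {T : ImpreciseTerrain (Fin m)} {src dst : Fin n → Fin m}
    {B S : Set (Fin m)} {rank : Fin m → ℕ} {b : ℕ} (hb8 : b ∉ [10, 11])
    {σ : State} {u : Fin m} (hσ : InputData T src dst σ) (hA : AdjData T n T.graph.Adj σ)
    (hQ : QueueInv m σ) (hb : ∀ q : Fin m, σ.natArr b q = 0 ↔ q ∉ B)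
    (hL : Labels T B S σ rank fun v _ => v ≠ u)
    (h19 : σ.natReg 19 = u) (hu : σ.natArr 8 u = 1)
    (hmax : ∀ p : Fin m, σ.natArr 8 p = 1 → σ.realArr 7 p ≤ σ.realArr 7 u) :
    Runs (expand b) σ fun σ' t =>
      QueueInv m σ' ∧ Labels T B S σ' rank (fun _ _ => True) ∧
      t ≤ relaxTime m n * σ.natArr 5 u + 50 := by
  simp only [expand, runs_seq, runs_setNatReg, runs_setRealReg]
  -- The pairs of `u` with an already scanned entry of its adjacency list are accounted for; labels
  -- of nodes that are final at the start stay fixed, so the copy of the label of `u` in real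
  -- register 2 remains valid.
  refine (Runs.loop (fun τ => QueueInv m τ ∧ Labels T B S τ rank (fun v q => v ≠ u ∨
      ∃ j < τ.natReg 18, σ.natArr 6 (u * n + j) = q) ∧
      (∀ p : Fin m, σ.natArr 8 p = 1 → τ.realArr 7 p = σ.realArr 7 p))
      (fun τ => relaxTime m n * (σ.natArr 5 u - τ.natReg 18)) ?_ ?_).then ?_
  · refine ⟨⟨?_, ?_, ?_, ?_, ?_⟩, ?_, ?_⟩
    · simpa using hQ.size
    · simpa using hQ.tree
    · simpa using hQ.act
    · simpa using hQ.act_out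
    · simpa using hQ.done
    · simpa [Labels] using hL
    · simp
  · rintro τ ⟨gQ, gL, gk⟩ F hb'
    -- The set of written cells does not depend on the array number `b`, which is only read; a
    -- numeral in its place makes membership decidable by evaluation.
    replace F : Frame (expandStep 0) _ τ := ⟨F.1, F.2, F.3, F.4⟩
    have hsub : ∀ a, a ∉ [10, 11] → τ.natArr a = σ.natArr a := fun a ha => by
      rw [F.natArr a (by simpa [expandStep, relax, search, searchTail, searchLoop, searchStep, searchFinish,
        searchDecide, treePush, treeFix, treeNode, and_comm] using ha)]
      simp
    have hsubr : ∀ a, a ≠ 7 → τ.realArr a = σ.realArr a := fun a ha => by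
      rw [F.realArr a (by simpa [expandStep, relax, search, searchTail, searchLoop, searchStep, searchFinish,
        searchDecide, treePush, treeFix, treeNode, and_comm] using ha)]
      simp
    have f17 : τ.natReg 17 = u * n := by
      rw [F.natReg 17 (by decide)]; simp [h19, hA.base]
    have f19 : τ.natReg 19 = u := by
      rw [F.natReg 19 (by decide)]; simp [h19]
    have f2 : τ.realReg 2 = σ.realArr 7 u := by
      rw [F.realReg 2 (by decide)]; simp [h19]
    have fσ : InputData T src dst τ := by
      refine ⟨?_, ?_, ?_, ?_, ?_, ?_, ?_, ?_⟩
      · rw [F.natReg 0 (by decide)]; simpa using hσ.nodes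
      · rw [F.natReg 1 (by decide)]; simpa using hσ.edges
      · rw [hsub 0 (by decide)]; exact hσ.src
      · rw [hsub 1 (by decide)]; exact hσ.dst
      · rw [hsubr 0 (by decide)]; exact hσ.x
      · rw [hsubr 1 (by decide)]; exact hσ.y
      · rw [hsubr 2 (by decide)]; exact hσ.low
      · rw [hsubr 3 (by decide)]; exact hσ.high
    have fA : AdjData T n T.graph.Adj τ := hA.congr (hsub 4 (by decide)) (hsub 5 (by decide))
      (hsub 6 (by decide)) (hsub 7 (by decide)) (hsubr 4 (by decide)) (hsubr 5 (by decide))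
      (hsubr 6 (by decide))
    have hb' : τ.natReg 18 < σ.natArr 5 u := by
      simpa [f19, hsub 5 (by decide)] using hb'
    obtain ⟨q, huq, hq6, hq4⟩ := hA.nbr u _ hb'
    simp only [expandStep, runs_seq, runs_setNatReg, runs_setRealReg]
    refine (relax_runs (T := T) (n := n) (src := src) (dst := dst) (B := B) (S := S)
      (C := fun v q => v ≠ u ∨ ∃ j < τ.natReg 18, σ.natArr 6 (u * n + j) = q) (rank := rank)
      (q := q) (u := u) ?_ ?_ ?_ ?_ ?_ ?_ ?_ ?_ huq.symm ?_ ?_).then ?_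
    · exact ⟨by simpa using fσ.nodes, by simpa using fσ.edges, by simpa using fσ.src,
        by simpa using fσ.dst, by simpa using fσ.x, by simpa using fσ.y, by simpa using fσ.low,
        by simpa using fσ.high⟩
    · exact fA.congr (by simp) (by simp) (by simp) (by simp) (by simp) (by simp) (by simp)
    · exact ⟨by simpa using gQ.size, by simpa using gQ.tree, by simpa using gQ.act,
        by simpa using gQ.act_out, by simpa using gQ.done⟩
    · simpa [hsub b hb8] using hb q
    · simpa [Labels] using gL
    · simp [f17, hsub 6 (by decide), hq6]
    · simp [f17, hsubr 4 (by decide), hq4, dist_comm]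
    · simp [f2, gk u hu]
    · simpa [hsub 8 (by decide)] using hu
    · intro p hp
      have hp : σ.natArr 8 p = 1 := by simpa [hsub 8 (by decide)] using hp
      simpa [gk p hp, gk u hu] using hmax p hp
    · rintro τ' t F' ⟨kQ, kL, kk, kt⟩
      replace F' : Frame (relax 0) _ τ' := ⟨F'.1, F'.2, F'.3, F'.4⟩
      have e18 : τ'.natReg 18 = τ.natReg 18 := by
        rw [F'.natReg 18 (by decide)]
        simp
      refine ⟨⟨⟨by simpa using kQ.size, by simpa using kQ.tree, by simpa using kQ.act,
        by simpa using kQ.act_out, by simpa using kQ.done⟩, ?_, ?_⟩, ?_⟩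
      · simp only [Labels, State.setNatReg_natArr, State.setNatReg_realArr,
          State.setNatReg_natReg, NatExp.eval, if_true, e18]
        refine kL.mono_closed ?_
        rintro v r - - (hv | ⟨j, hj, hjr⟩)
        · exact Or.inl (Or.inl hv)
        · by_cases hv : v = u
          · rcases Nat.lt_succ_iff_lt_or_eq.1 hj with hj | rfl
            · exact Or.inl (Or.inr ⟨j, hj, hjr⟩)
            · exact Or.inr ⟨hv, Fin.ext (hjr.symm.trans hq6)⟩
          · exact Or.inl (Or.inl hv)
      · intro p hp
        have := kk p (by simpa [hsub 8 (by decide)] using hp)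
        simpa [gk p hp] using this
      · have h8 : relaxTime m n * (σ.natArr 5 u - τ.natReg 18) =
            relaxTime m n * (σ.natArr 5 u - (τ.natReg 18 + 1)) + relaxTime m n := by
          rw [← Nat.mul_succ]; congr 1; omega
        simp [e18]
        rw [h8]
        have : relaxTime m n = treeTime m + searchTime n + 150 := rfl
        omega
  · rintro τ t F ⟨⟨gQ, gL, gk⟩, hb', ht⟩
    replace F : Frame (expandStep 0) _ τ := ⟨F.1, F.2, F.3, F.4⟩
    have f19 : τ.natReg 19 = u := by
      rw [F.natReg 19 (by decide)]; simp [h19]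
    have f5 : τ.natArr 5 = σ.natArr 5 := by
      rw [F.natArr 5 (by decide)]; simp
    have hb' : σ.natArr 5 u ≤ τ.natReg 18 := by simpa [f19, f5] using hb'
    refine ⟨gQ, gL.mono_closed ?_, ?_⟩
    · rintro v r - hvr -
      by_cases hv : v = u
      · subst hv
        obtain ⟨j, hj, hjr⟩ := hA.exists_nbr v r hvr.symm
        exact Or.inr ⟨j, by omega, hjr⟩
      · exact Or.inl hv
    · simp at ht ⊢
      omega

end RealRAM

/-! ### Initialization and main loop of the label setting algorithm -/

namespace RealRAM

open ImpreciseTerrain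

/-- Initialize the label of node `natReg 2`. -/
def initStep (s b : ℕ) : Program :=
  .setNatArr 8 (𝐧 2) (𝐤 0) ;;
  .cond (.and (.natEq (𝐚 s (𝐧 2)) (𝐤 1)) (.natEq (𝐚 b (𝐧 2)) (𝐤 0)))
    (.setRealArr 7 (𝐧 2) (𝐛 2 (𝐧 2)) ;; 4 ≔ 𝐧 2 ;; treePush)
    .skip ;;
  2 ≔ 𝐧 2 ∔ 𝐤 1

/-- Put the unmarked sources into the queue, labelled with their lowest elevations. -/
def initLabels (s b : ℕ) : Program :=
  3 ≔ 𝐧 0 ;;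
  treeInit ;;
  2 ≔ 𝐤 0 ;;
  .loop (.natLt (𝐧 2) (𝐧 0)) (initStep s b)

theorem initLabels_runs {m n : ℕ} {T : ImpreciseTerrain (Fin m)} {src dst : Fin n → Fin m}
    {B S : Set (Fin m)} {s b : ℕ} (hs : s ∉ [8, 10, 11]) (hb : b ∉ [8, 10, 11]) {σ : State}
    (hσ : InputData T src dst σ) (hact : ∀ p, σ.natArr 11 p = 0)
    (hS : ∀ v : Fin m, σ.natArr s v = 1 ↔ v ∈ S) (hB : ∀ v : Fin m, σ.natArr b v = 0 ↔ v ∉ B) :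
    Runs (initLabels s b) σ fun σ' t =>
      QueueInv m σ' ∧ Labels T B S σ' (fun _ => 0) (fun _ _ => True) ∧
      (∀ v : Fin m, σ'.natArr 8 v = 0) ∧ t ≤ m * (treeTime m + 150) + 100 := by
  rw [initLabels, runs_seq, runs_setNatReg, runs_seq]
  refine (treeInit_runs _).then ?_
  rintro σ₁ t₁ F₁ ⟨hshape, ht₁⟩
  have e3 : (σ.setNatReg 3 ((𝐧 0).eval σ)).natReg 3 = m := by simp [hσ.nodes]
  rw [e3] at hshape ht₁
  have g3 : σ₁.natReg 3 = m := by rw [F₁.natReg 3 (by decide)]; exact e3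
  have gm : σ₁.natReg 0 = m := by rw [F₁.natReg 0 (by decide)]; simpa using hσ.nodes
  have ga : ∀ a, a ≠ 10 → σ₁.natArr a = σ.natArr a := fun a ha => by
    rw [F₁.natArr a (by simpa [treeInit] using ha)]; simp
  have gr : σ₁.realArr = σ.realArr := by
    funext a; rw [F₁.realArr a (by simp [treeInit])]; simp
  rw [runs_seq, runs_setNatReg]
  refine (Runs.loop (fun τ => τ.natReg 2 ≤ m ∧
    TreeInv m (τ.natArr 10) (τ.natArr 11) (τ.realArr 7) ∧
    (∀ p, τ.natArr 11 p = 0 ∨ τ.natArr 11 p = 1) ∧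
    (∀ p, τ.natReg 2 ≤ p → τ.natArr 11 p = 0) ∧
    (∀ v : Fin m, v < τ.natReg 2 → τ.natArr 8 v = 0 ∧ (τ.natArr 11 v = 1 ↔ v ∈ S ∧ v ∉ B) ∧
      (τ.natArr 11 v = 1 → τ.realArr 7 v = T.low v)))
    (fun τ => (treeTime m + 80) * (m - τ.natReg 2)) ?_ ?_).then ?_
  · refine ⟨by simp, ?_, ?_, ?_, by simp⟩
    · simpa using hshape.treeInv fun p _ => by simp [ga 11 (by decide), hact]
    · simp [ga 11 (by decide), hact]
    · simp [ga 11 (by decide), hact]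
  · rintro τ ⟨h2, hT, hbit, hzero, hlab⟩ F hc
    replace F : Frame (initStep 0 0) _ τ := ⟨F.1, F.2, F.3, F.4⟩
    have f3 : τ.natReg 3 = m := by rw [F.natReg 3 (by decide)]; simpa using g3
    have fm : τ.natReg 0 = m := by rw [F.natReg 0 (by decide)]; simpa using gm
    have fa : ∀ a, a ∉ [8, 10, 11] → τ.natArr a = σ.natArr a := fun a ha => by
      rw [F.natArr a (by
        simpa [initStep, treePush, treeFix, treeNode, or_comm, and_comm, and_assoc] using ha)]
      simp at ha ⊢
      exact ga a ha.2.1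
    have fr : τ.realArr 2 = σ.realArr 2 := by
      rw [F.realArr 2 (by decide)]; simp [gr]
    have hlt : τ.natReg 2 < m := by simpa [fm] using hc
    obtain ⟨v, hv⟩ : ∃ v : Fin m, (v : ℕ) = τ.natReg 2 := ⟨⟨_, hlt⟩, rfl⟩
    have h8 : (treeTime m + 80) * (m - τ.natReg 2) =
        (treeTime m + 80) * (m - (τ.natReg 2 + 1)) + (treeTime m + 80) := by
      rw [← Nat.mul_succ]; congr 1; omega
    have hs8 : s ≠ 8 := fun h => hs (by simp [h])
    have hb8 : b ≠ 8 := fun h => hb (by simp [h])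
    simp only [initStep, runs_seq, runs_setNatArr, runs_cond, runs_setRealArr, runs_setNatReg,
      runs_skip]
    constructor
    · intro hc
      have hc : v ∈ S ∧ v ∉ B := by
        simpa [hs8, hb8, fa s hs, fa b hb, ← hv, hS, hB] using hc
      refine (treePush_runs (key := τ.realArr 7) ?_ ?_ ?_).then ?_
      · simpa [f3] using hlt
      · simpa [f3] using hT
      · intro q hq
        simp at hq
        simp [hq]
      · rintro τ' t F' ⟨k1, k2, k3⟩
        have k4 : τ'.natReg 2 = τ.natReg 2 := by rw [F'.natReg 2 (by decide)]; simp
        have k5 : τ'.realArr 7 = Function.update (τ.realArr 7) v (T.low v) := by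
          rw [F'.realArr 7 (by decide)]; simp [← hv, fr, hσ.low]
        have k6 : τ'.natArr 11 = Function.update (τ.natArr 11) v 1 := by
          rw [k1]; simp [← hv]
        have k7 : τ'.natArr 8 = Function.update (τ.natArr 8) v 0 := by
          rw [F'.natArr 8 (by decide)]; simp [← hv]
        refine ⟨⟨?_, ?_, ?_, ?_, ?_⟩, ?_⟩
        · simp [k4]; omega
        · simp only [State.setNatReg_natArr, State.setNatReg_realArr, k5]
          simpa [f3, ← hv, fr, hσ.low] using k2
        · intro p
          simp only [State.setNatReg_natArr, k6]
          by_cases hp : p = v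
          · simp [hp]
          · simpa [hp] using hbit p
        · intro p hp
          simp [k4] at hp
          simp only [State.setNatReg_natArr, k6]
          rw [Function.update_of_ne (by omega)]
          exact hzero p (by omega)
        · intro w hw
          simp [k4] at hw
          simp only [State.setNatReg_natArr, State.setNatReg_realArr, k5, k6, k7]
          by_cases hwv : w = v
          · subst hwv; simp [hc]
          · have : (w : ℕ) ≠ v := fun h => hwv (Fin.ext h)
            simp only [Function.update_of_ne this]
            exact hlab w (by omega)
        · simp [k4, f3] at k3 ⊢
          rw [h8]
          unfold treeTime
          omega
    · intro hc
      have hc : v ∈ S → v ∈ B := by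
        have : ¬ (v ∈ S ∧ v ∉ B) := by
          simpa [hs8, hb8, fa s hs, fa b hb, ← hv, hS, hB] using hc
        tauto
      refine ⟨⟨?_, ?_, ?_, ?_, ?_⟩, ?_⟩
      · simp; omega
      · simpa using hT
      · simpa using hbit
      · intro p hp
        simp at hp ⊢
        exact hzero p (by omega)
      · intro w hw
        simp at hw
        simp [← hv]
        by_cases hwv : w = v
        · subst hwv
          have : τ.natArr 11 w = 0 := hzero w (by omega)
          simpa [this] using hc
        · have : (w : ℕ) ≠ v := fun h => hwv (Fin.ext h)
          simp only [Function.update_of_ne this]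
          exact hlab w (by omega)
      · simp
        rw [h8]
        omega
  · rintro τ t F ⟨⟨h2, hT, hbit, hzero, hlab⟩, hc, ht⟩
    replace F : Frame (initStep 0 0) _ τ := ⟨F.1, F.2, F.3, F.4⟩
    have f3 : τ.natReg 3 = m := by rw [F.natReg 3 (by decide)]; simpa using g3
    have fm : τ.natReg 0 = m := by rw [F.natReg 0 (by decide)]; simpa using gm
    have hc : m ≤ τ.natReg 2 := by simpa [fm] using hc
    have hlab : ∀ v : Fin m, _ := fun v => hlab v (by omega)
    refine ⟨⟨f3, hT, hbit, fun p hp => hzero p (by omega), fun v => Or.inl (hlab v).1⟩, ?_,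
      fun v => (hlab v).1, ?_⟩
    · have : (fun v : Fin m => τ.natArr 8 v = 1) = fun _ => False := by
        funext v; simp [(hlab v).1]
      rw [Labels, this]
      exact LabelInv.of_sources (fun v => (hlab v).2.1) fun v => (hlab v).2.2
    · simp at ht ⊢
      have : m * (treeTime m + 150) = (treeTime m + 80) * m + 70 * m := by ring
      omega

/-- Make the node with the lowest label final and expand it. -/
def mainStep (b : ℕ) : Program :=
  treePop ;;
  19 ≔ 𝐧 4 ;;
  .setNatArr 8 (𝐧 19) (𝐤 1) ;;
  expand b

/-- Expand nodes until the queue is empty. -/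
def mainLoop (b : ℕ) : Program :=
  .loop (.natEq (𝐚 11 (𝐚 10 (𝐤 1))) (𝐤 1)) (mainStep b)

/-- The potential of the main loop drops by the share `w u` when `u` becomes final. -/
theorem sum_done_update {m : ℕ} (done w : ℕ → ℕ) {u : Fin m} (hu : done u ≠ 1) :
    ∑ v : Fin m, (if Function.update done u 1 v = 1 then 0 else w v) + w u =
      ∑ v : Fin m, if done v = 1 then 0 else w v := by
  rw [← Finset.add_sum_erase _ _ (Finset.mem_univ u),
    ← Finset.add_sum_erase _ (fun v : Fin m => if done v = 1 then 0 else w v) (Finset.mem_univ u),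
    Function.update_self, if_pos rfl, if_neg hu,
    Finset.sum_congr rfl (g := fun v : Fin m => if done v = 1 then 0 else w v)]
  · omega
  · intro a ha
    rw [Function.update_of_ne fun h => Finset.ne_of_mem_erase ha (Fin.ext h)]

/-- Every node becomes final at most once and then pays for one queue operation and for one search
per entry of its adjacency list. Summation gives the degree sum times the cost of one relaxation,
plus the queue operations. -/
theorem mainLoop_runs {m n : ℕ} {T : ImpreciseTerrain (Fin m)} {src dst : Fin n → Fin m}
    {B S : Set (Fin m)} {b : ℕ} (hb : b ∉ [8, 10, 11]) {σ : State}
    (hσ : InputData T src dst σ) (hA : AdjData T n T.graph.Adj σ)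
    (hQ : QueueInv m σ) (hB : ∀ v : Fin m, σ.natArr b v = 0 ↔ v ∉ B)
    (hL : Labels T B S σ (fun _ => 0) fun _ _ => True) :
    Runs (mainLoop b) σ fun σ' t =>
      (∀ v : Fin m, (T.Reaches B S v → σ'.natArr 8 v = 1) ∧
        (¬ T.Reaches B S v → σ'.natArr 8 v = 0)) ∧
      (∀ p, σ'.natArr 11 p = 0) ∧
      t ≤ relaxTime m n * ∑ v : Fin m, σ.natArr 5 v + m * (treeTime m + 150) + 10 := by
  have hsub : ∀ τ, Frame (mainStep 0) σ τ → ∀ a, a ∉ [8, 10, 11] → τ.natArr a = σ.natArr a := by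
    intro τ F a ha
    simp only [List.mem_cons, List.not_mem_nil, or_false, not_or] at ha
    exact F.natArr a (by simp [mainStep, expand, expandStep, relax, search, searchTail, searchLoop,
      searchStep, searchFinish, searchDecide, treePop, treePush, treeFix, treeNode, ha])
  set w : ℕ → ℕ := fun v => relaxTime m n * σ.natArr 5 v + (treeTime m + 150) with hw
  refine (Runs.loop (fun τ => QueueInv m τ ∧ ∃ rank, Labels T B S τ rank fun _ _ => True)
    (fun τ => ∑ v : Fin m, if τ.natArr 8 v = 1 then 0 else w v) ⟨hQ, _, hL⟩ ?_).then ?_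
  · rintro τ ⟨gQ, rank, gL⟩ F hc
    replace F : Frame (mainStep 0) _ τ := ⟨F.1, F.2, F.3, F.4⟩
    have fσ := hσ.frame F (by decide)
    have fA := hA.frame F (by decide)
    have fb := hsub τ F
    have hc : τ.natArr 11 (τ.natArr 10 1) = 1 := by simpa using hc
    -- Flags from index `m` on are 0, so a passed loop test yields a genuine node even though
    -- nothing is known about the root cell if `m = 0`.
    have hlt : τ.natArr 10 1 < m := by
      by_contra! hge
      rw [gQ.act_out _ hge] at hc
      simp at hc
    rw [mainStep, runs_seq]
    refine (treePop_runs (p := τ.natArr 10 1) (by rw [gQ.size]; exact hlt) hc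
      (by rw [gQ.size]; exact gQ.tree)).then ?_
    rintro τ₁ t₁ F₁ ⟨-, b2, b3, b4, b5, b6, b7⟩
    rw [gQ.size] at b2 b4 b6 b7
    obtain ⟨u, hu⟩ : ∃ u : Fin m, (u : ℕ) = τ₁.natReg 4 := ⟨⟨_, b2⟩, rfl⟩
    rw [← hu] at b3 b4 b5
    have und : τ.natArr 8 u ≠ 1 := fun h => gL.disjoint u h b3
    have e8 : τ₁.natArr 8 = τ.natArr 8 := F₁.natArr 8 (by decide)
    have e5 : τ₁.natArr 5 = σ.natArr 5 := by
      rw [F₁.natArr 5 (by decide), fb 5 (by decide)]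
    have eb : τ₁.natArr b = σ.natArr b := by
      have hb' := hb
      simp only [List.mem_cons, List.not_mem_nil, or_false, not_or] at hb'
      rw [F₁.natArr b (by simp [treePop, treeFix, treeNode, hb']), fb b hb]
    have e7 : τ₁.realArr 7 = τ.realArr 7 := F₁.realArr 7 (by decide)
    have e3 : τ₁.natReg 3 = m := (F₁.natReg 3 (by decide)).trans gQ.size
    have hne : ∀ {p : Fin m}, p ≠ u → (p : ℕ) ≠ u := fun h he => h (Fin.ext he)
    have hb8 : b ≠ 8 := fun h => hb (by simp [h])
    obtain ⟨rank', hL'⟩ := gL.extract (u := u) b3 (fun a ha => b4 a a.2 ha)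
      (act' := fun v => τ₁.natArr 11 v = 1)
      (done' := fun v => Function.update (τ₁.natArr 8) u 1 v = 1)
      (fun p => by
        rw [b5]
        by_cases hp : p = u
        · simp [hp]
        · simp [hne hp, hp])
      (fun p => by
        rw [e8]
        by_cases hp : p = u
        · simp [hp]
        · simp [hne hp, hp])
    simp only [runs_seq, runs_setNatReg, runs_setNatArr]
    have i1 := fσ.frame F₁ (by decide)
    refine (expand_runs (T := T) (n := n) (src := src) (dst := dst) (B := B) (S := S)
      (rank := rank') (b := b) (u := u) (fun h => hb (by simp at h ⊢; tauto)) ?_ ?_ ?_ ?_ ?_ ?_ ?_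
      ?_).then ?_
    · exact ⟨by simpa using i1.nodes, by simpa using i1.edges, by simpa using i1.src,
        by simpa using i1.dst, by simpa using i1.x, by simpa using i1.y, by simpa using i1.low,
        by simpa using i1.high⟩
    · exact (fA.frame F₁ (by decide)).congr (by simp) (by simp) (by simp) (by simp) (by simp)
        (by simp) (by simp)
    · refine ⟨by simpa using e3, by simpa [e7] using b6, ?_, ?_, ?_⟩
      · intro p
        simp [b5]
        by_cases hp : p = u
        · simp [hp]
        · simpa [hp] using gQ.act p
      · intro p hp
        simp [b5]
        rw [Function.update_of_ne (by omega)]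
        exact gQ.act_out p hp
      · intro v
        simp [← hu, e8]
        by_cases hp : v = u
        · simp [hp]
        · simpa [hne hp] using gQ.done v
    · simpa [hb8, eb] using hB
    · simpa [Labels, e7, ← hu] using hL'
    · simp [hu]
    · simp [hu]
    · intro p hp
      simp [← hu, e8, e7] at hp ⊢
      by_cases hpu : p = u
      · rw [hpu]
      · rw [Function.update_of_ne (hne hpu)] at hp
        exact gL.done_le p hp u b3
    · rintro τ₂ t₂ F₂ ⟨k1, k2, k3⟩
      replace F₂ : Frame (expand 0) _ τ₂ := ⟨F₂.1, F₂.2, F₂.3, F₂.4⟩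
      have k8 : τ₂.natArr 8 = Function.update (τ.natArr 8) u 1 := by
        rw [F₂.natArr 8 (by decide)]; simp [← hu, e8]
      refine ⟨⟨k1, rank', k2⟩, ?_⟩
      have hsum := sum_done_update (τ.natArr 8) w und
      rw [k8, ← hsum]
      simp [e5] at k3 ⊢
      simp only [hw]
      unfold treeTime at *
      omega
  · rintro τ t F ⟨⟨gQ, rank, gL⟩, hc, ht⟩
    have hc : τ.natArr 11 (τ.natArr 10 1) ≠ 1 := by simpa using hc
    have hzero : ∀ p, τ.natArr 11 p = 0 := by
      intro p
      rcases Nat.lt_or_ge p m with hp | hp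
      · exact (gQ.act p).resolve_right fun h => hc (gQ.tree.root hp h).1
      · exact gQ.act_out p hp
    have hdone := gL.done_iff (fun _ _ => trivial) (fun p => by simp [hzero])
    refine ⟨fun v => ⟨fun h => (hdone v).2 h, fun h =>
      (gQ.done v).resolve_right fun h' => h ((hdone v).1 h')⟩, hzero, ?_⟩
    have hle : ∑ v : Fin m, (if σ.natArr 8 v = 1 then 0 else w v) ≤ ∑ v : Fin m, w v :=
      Finset.sum_le_sum fun v _ => by split_ifs <;> simp
    have hsum : ∑ v : Fin m, w v =
        relaxTime m n * ∑ v : Fin m, σ.natArr 5 v + m * (treeTime m + 150) := by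
      simp [hw, Finset.sum_add_distrib, Finset.mul_sum]
    simp at ht
    omega

/-- Mark in array `8` the nodes that reach a node marked in array `s` and avoid the nodes marked in
array `b`. -/
def findReaching (s b : ℕ) : Program :=
  initLabels s b ;; mainLoop b

theorem findReaching_runs {m n : ℕ} {T : ImpreciseTerrain (Fin m)} {src dst : Fin n → Fin m}
    {B S : Set (Fin m)} {s b : ℕ} (hs : s ∉ [8, 10, 11]) (hb : b ∉ [8, 10, 11]) {σ : State}
    (hσ : InputData T src dst σ) (hA : AdjData T n T.graph.Adj σ) (hact : ∀ p, σ.natArr 11 p = 0)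
    (hS : ∀ v : Fin m, σ.natArr s v = 1 ↔ v ∈ S) (hB : ∀ v : Fin m, σ.natArr b v = 0 ↔ v ∉ B) :
    Runs (findReaching s b) σ fun σ' t =>
      (∀ v : Fin m, (T.Reaches B S v → σ'.natArr 8 v = 1) ∧
        (¬ T.Reaches B S v → σ'.natArr 8 v = 0)) ∧
      (∀ p, σ'.natArr 11 p = 0) ∧
      t ≤ relaxTime m n * ∑ v : Fin m, σ.natArr 5 v + 2 * (m * (treeTime m + 150)) + 110 := by
  rw [findReaching, runs_seq]
  refine (initLabels_runs hs hb hσ hact hS hB).then ?_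
  rintro σ₁ t₁ F₁ ⟨h1, h2, -, ht₁⟩
  replace F₁ : Frame (initLabels 0 0) σ σ₁ := ⟨F₁.1, F₁.2, F₁.3, F₁.4⟩
  have e5 : σ₁.natArr 5 = σ.natArr 5 := F₁.natArr 5 (by decide)
  have eb : σ₁.natArr b = σ.natArr b := F₁.natArr b (by
    simp only [List.mem_cons, List.not_mem_nil, or_false, not_or] at hb
    simp [initLabels, initStep, treeInit, treePush, treeFix, treeNode, hb])
  refine (mainLoop_runs hb (hσ.frame F₁ (by decide)) (hA.frame F₁ (by decide)) h1
    (by rw [eb]; exact hB) h2).mono ?_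
  rintro σ₂ t₂ ⟨h3, h4, ht₂⟩
  rw [e5] at ht₂
  exact ⟨h3, h4, by omega⟩

end RealRAM

/-! ### The whole algorithm and its running time -/

namespace RealRAM

open ImpreciseTerrain

/-- Write the complement of the indicator in array `8` into array `a`. -/
def writeCompl (a : ℕ) : Program :=
  2 ≔ 𝐤 0 ;;
  .loop (.natLt (𝐧 2) (𝐧 0)) (.setNatArr a (𝐧 2) (𝐤 1 ∸ 𝐚 8 (𝐧 2)) ;; 2 ≔ 𝐧 2 ∔ 𝐤 1)

theorem writeCompl_runs {a : ℕ} (ha : a ≠ 8) (σ : State) :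
    Runs (writeCompl a) σ fun σ' t =>
      (∀ v < σ.natReg 0, σ'.natArr a v = 1 - σ.natArr 8 v) ∧ t ≤ 30 * (σ.natReg 0 + 1) := by
  set m := σ.natReg 0 with hm
  rw [writeCompl, runs_seq, runs_setNatReg]
  refine (Runs.loop (fun τ => τ.natReg 2 ≤ m ∧ ∀ v < τ.natReg 2, τ.natArr a v = 1 - σ.natArr 8 v)
    (fun τ => 20 * (m - τ.natReg 2)) ?_ ?_).then ?_
  · simp
  · rintro τ ⟨h2, h4⟩ F hb
    have h0 : τ.natReg 0 = m := by rw [F.natReg 0 (by simp)]; simp [hm]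
    have h8 : τ.natArr 8 = σ.natArr 8 := by rw [F.natArr 8 (by simp [ha.symm])]; simp
    have hb : τ.natReg 2 < m := by simpa [h0] using hb
    simp [h8]
    refine ⟨⟨by omega, fun v hv => ?_⟩, by omega⟩
    by_cases hv' : v = τ.natReg 2
    · simp [hv']
    · simp [hv']
      exact h4 v (by omega)
  · rintro τ t F ⟨⟨h2, h4⟩, hb, ht⟩
    have h0 : τ.natReg 0 = m := by rw [F.natReg 0 (by simp)]; simp [hm]
    have hb : m ≤ τ.natReg 2 := by simpa [h0] using hb
    simp at ht ⊢
    exact ⟨fun v hv => h4 v (by omega), by omega⟩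

/-- Compute adjacency lists and envelopes. -/
def prepare : Program :=
  initBase ;; initEdges ;; sortEdges

theorem prepare_runs {m n : ℕ} {T : ImpreciseTerrain (Fin m)} {src dst : Fin n → Fin m}
    {σ : State} (hσ : InputData T src dst σ) (hE : IsEdgeList T.graph src dst)
    (h5 : ∀ p, σ.natArr 5 p = 0) (h7 : ∀ p, σ.natArr 7 p = 0) (h11 : ∀ p, σ.natArr 11 p = 0) :
    Runs prepare σ fun σ' t =>
      AdjData T n T.graph.Adj σ' ∧ ∑ v : Fin m, σ'.natArr 5 v = 2 * n ∧
      (∀ p, σ'.natArr 11 p = 0) ∧ t ≤ 30 * (m + 1) + 2 * (n * (treeTime n + 950)) + 50 * (n + 3) := by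
  rw [prepare, runs_seq]
  refine (initBase_runs σ).then ?_
  rintro σ₁ t₁ F₁ ⟨h4, ht₁⟩
  rw [hσ.nodes, hσ.edges] at h4
  rw [hσ.nodes] at ht₁
  have i1 := hσ.frame F₁ (by decide)
  rw [runs_seq]
  refine (initEdges_runs i1 (by rw [F₁.natArr 11 (by decide)]; exact h11)).then ?_
  rintro σ₂ t₂ F₂ ⟨a1, a2, a3, a4, ht₂⟩
  refine (sortEdges_runs (i1.frame F₂ (by decide)) hE ?_ ?_ ?_ a2 a1 a3 a4).mono ?_
  · rw [F₂.natArr 4 (by decide)]; exact fun v => h4 v v.2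
  · rw [F₂.natArr 5 (by decide), F₁.natArr 5 (by decide)]; exact h5
  · rw [F₂.natArr 7 (by decide), F₁.natArr 7 (by decide)]; exact h7
  · rintro σ₃ t₃ ⟨b1, b2, b3, ht₃⟩
    refine ⟨b1, b2, b3, ?_⟩
    have e1 : n * (treeTime n + 50) = n * treeTime n + 50 * n := by ring
    have e2 : n * (treeTime n + 950) = n * treeTime n + 950 * n := by ring
    omega

/-- Compute the persistent watershed. -/
def persistentWatershed : Program :=
  prepare ;; findReaching 2 12 ;; writeCompl 9 ;; findReaching 9 2 ;; writeCompl 3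

/-- An upper bound for the running time in terms of the numbers of nodes and edges. -/
def timeBound (m n : ℕ) : ℕ :=
  90 * (m + 1) + 2 * (n * (treeTime n + 950)) + 50 * (n + 3) +
    2 * (relaxTime m n * (2 * n) + 2 * (m * (treeTime m + 150)) + 110)

theorem inputData_inputState {m n : ℕ} (T : ImpreciseTerrain (Fin m)) (src dst : Fin n → Fin m)
    (Q : Set (Fin m)) : InputData T src dst (inputState T src dst Q) where
  nodes := rfl
  edges := rfl
  src e := by simp [inputState, padZero]
  dst e := by simp [inputState, padZero]
  x e := by simp [inputState, padZero]
  y e := by simp [inputState, padZero]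
  low e := by simp [inputState, padZero]
  high e := by simp [inputState, padZero]

theorem persistentWatershed_runs {m n : ℕ} {T : ImpreciseTerrain (Fin m)}
    {src dst : Fin n → Fin m} {Q : Set (Fin m)} (hE : IsEdgeList T.graph src dst) :
    Runs persistentWatershed (inputState T src dst Q) fun σ t =>
      OutputsSet σ (T.PsWS Q) ∧ t ≤ timeBound m n := by
  set σ := inputState T src dst Q with hσdef
  have hσ : InputData T src dst σ := inputData_inputState T src dst Q
  have hQ : ∀ v : Fin m, (σ.natArr 2 v = 1 ↔ v ∈ Q) ∧ (σ.natArr 2 v = 0 ↔ v ∉ Q) := by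
    intro v
    by_cases hv : v ∈ Q <;> simp [hσdef, inputState, padZero, hv]
  rw [persistentWatershed, runs_seq]
  refine (prepare_runs hσ hE (fun _ => rfl) (fun _ => rfl) (fun _ => rfl)).then ?_
  rintro σ₁ t₁ F₁ ⟨hA, hdeg, hact, ht₁⟩
  have i1 := hσ.frame F₁ (by decide)
  rw [runs_seq]
  refine (findReaching_runs (B := ∅) (S := Q) (by decide) (by decide) i1 hA hact ?_ ?_).then ?_
  · rw [F₁.natArr 2 (by decide)]; exact fun v => (hQ v).1
  -- Array 12 is still in its initial zero state and represents the empty set of forbidden nodes.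
  · rw [F₁.natArr 12 (by decide)]; simp [hσdef, inputState]
  rintro σ₂ t₂ F₂ ⟨hr₂, hact₂, ht₂⟩
  have i2 := i1.frame F₂ (by decide)
  rw [runs_seq]
  refine (writeCompl_runs (by decide) σ₂).then ?_
  rintro σ₃ t₃ F₃ ⟨h9, ht₃⟩
  rw [i2.nodes] at h9 ht₃
  have i3 := i2.frame F₃ (by decide)
  have hA₃ := (hA.frame F₂ (by decide)).frame F₃ (by decide)
  rw [runs_seq]
  refine (findReaching_runs (B := Q) (S := {s | ¬ T.Reaches ∅ Q s}) (by decide) (by decide) i3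
    hA₃ (by rw [F₃.natArr 11 (by decide)]; exact hact₂) ?_ ?_).then ?_
  · intro v
    rw [h9 v v.2, Set.mem_ofPred_eq]
    by_cases hv : T.Reaches ∅ Q v
    · simp [(hr₂ v).1 hv, hv]
    · simp [(hr₂ v).2 hv, hv]
  · rw [F₃.natArr 2 (by decide), F₂.natArr 2 (by decide), F₁.natArr 2 (by decide)]
    exact fun v => (hQ v).2
  rintro σ₄ t₄ F₄ ⟨hr₄, -, ht₄⟩
  refine (writeCompl_runs (by decide) σ₄).mono ?_
  rintro σ₅ t₅ ⟨h3, ht₅⟩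
  rw [(i3.frame F₄ (by decide)).nodes] at h3 ht₅
  refine ⟨fun v => ?_, ?_⟩
  · rw [h3 v v.2, mem_PsWS_iff]
    by_cases hv : T.Reaches Q {s | ¬ T.Reaches ∅ Q s} v
    · simp [(hr₄ v).1 hv, hv]
    · simp [(hr₄ v).2 hv, hv]
  · have e5 : σ₃.natArr 5 = σ₁.natArr 5 := by
      rw [F₃.natArr 5 (by decide), F₂.natArr 5 (by decide)]
    rw [hdeg] at ht₂
    rw [e5, hdeg] at ht₄
    unfold timeBound
    omega

/-- With `m ≤ 2 * n`, all logarithms are at most `Nat.log 2 n + 2`; since `Nat.log 2 n ≥ 1` for `n ≥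
2`, additive constants and linear terms are absorbed. The constant is generous. -/
theorem timeBound_le {m n : ℕ} (hn : 2 ≤ n) (hm : m ≤ 2 * n) :
    timeBound m n ≤ 10000 * (n * Nat.log 2 n) := by
  set l := Nat.log 2 n with hl
  have hl1 : 1 ≤ l := Nat.log_pos one_lt_two hn
  have h2n : Nat.log 2 (2 * n) = l + 1 := by
    rw [mul_comm, Nat.log_mul_base one_lt_two (by omega)]
  have h4n : Nat.log 2 (2 * m) ≤ l + 2 := by
    refine (Nat.log_mono_right (Nat.mul_le_mul_left 2 hm)).trans ?_
    rw [mul_comm, Nat.log_mul_base one_lt_two (by omega), h2n]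
  have t1 : treeTime n ≤ 190 * l := by unfold treeTime; omega
  have t2 : treeTime m ≤ 250 * l := by unfold treeTime; omega
  have t3 : searchTime n ≤ 500 * l := by unfold searchTime; omega
  have t4 : relaxTime m n ≤ 900 * l := by unfold relaxTime; omega
  have k1 : n * (treeTime n + 950) ≤ n * (1140 * l) := Nat.mul_le_mul_left n (by omega)
  have k2 : m * (treeTime m + 150) ≤ 2 * n * (400 * l) := Nat.mul_le_mul hm (by omega)
  have k3 : relaxTime m n * (2 * n) ≤ 900 * l * (2 * n) := Nat.mul_le_mul_right _ t4
  have k4 : n ≤ n * l := Nat.le_mul_of_pos_right n hl1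
  have r1 : n * (1140 * l) = 1140 * (n * l) := by ring
  have r2 : 2 * n * (400 * l) = 800 * (n * l) := by ring
  have r3 : 900 * l * (2 * n) = 1800 * (n * l) := by ring
  unfold timeBound
  omega

end RealRAM

/-- Without isolated nodes, the `2 * n` edge ends cover all nodes. -/
theorem IsEdgeList.card_le {m n : ℕ} {G : SimpleGraph (Fin m)} {src dst : Fin n → Fin m}
    (hE : IsEdgeList G src dst) (hG : ∀ v, ∃ w, G.Adj v w) : m ≤ 2 * n := by
  have hsurj : Function.Surjective (Sum.elim src dst) := by
    intro v
    obtain ⟨w, hw⟩ := hG v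
    rw [← SimpleGraph.mem_edgeSet, ← hE.2] at hw
    obtain ⟨e, he⟩ := hw
    rcases Sym2.eq_iff.1 he with ⟨h, -⟩ | ⟨-, h⟩
    · exact ⟨Sum.inl e, h⟩
    · exact ⟨Sum.inr e, h⟩
  simpa [two_mul] using Fintype.card_le_of_surjective _ hsurj

/-- A single real RAM program computes the persistent watershed of every set of nodes of every
imprecise terrain, in time `O(n log n)` for terrains with `n` edges and no isolated nodes. -/
theorem mainTheorem3 :
    ∃ (prog : RealRAM.Program) (C : ℝ),
      ∀ (m n : ℕ) (T : ImpreciseTerrain (Fin m)) (src dst : Fin n → Fin m) (Q : Set (Fin m)),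
        IsEdgeList T.graph src dst →
          ∃ (σ : RealRAM.State) (t : ℕ),
            RealRAM.Exec prog (inputState T src dst Q) σ t ∧
            OutputsSet σ (T.PsWS Q) ∧
            (2 ≤ n → (∀ v, ∃ w, T.graph.Adj v w) → (t : ℝ) ≤ C * (n * Real.log n)) := by
  -- Dividing by `Real.log 2` converts the binary logarithm into the natural one.
  refine ⟨RealRAM.persistentWatershed, 10000 / Real.log 2, fun m n T src dst Q hE => ?_⟩
  obtain ⟨σ, t, hexec, hout, ht⟩ := RealRAM.persistentWatershed_runs (Q := Q) hE
  refine ⟨σ, t, hexec, hout, fun hn hG => ?_⟩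
  have h1 : (t : ℝ) ≤ 10000 * (n * Nat.log 2 n) := by
    exact_mod_cast ht.trans (RealRAM.timeBound_le hn (hE.card_le hG))
  have h2 : (Nat.log 2 n : ℝ) ≤ Real.log n / Real.log 2 := by
    have := Real.natLog_le_logb n 2
    simpa [Real.logb] using this
  calc (t : ℝ) ≤ 10000 * (n * Nat.log 2 n) := h1
    _ ≤ 10000 * (n * (Real.log n / Real.log 2)) := by gcongr
    _ = 10000 / Real.log 2 * (n * Real.log n) := by ring
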